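/- Conventions. For a C*-algebra $B$, let $T(B)$ be the set of tracial states of $B$ and $\overline{T(B)}^{w}$ its weak* closure in the dual $B^*$. A quasitrace on $B$ is a function $\tau:B\to\mathbb{C}$ such that (i) $0\le\tau(x^*x)=\tau(xx^*)$ for all $x$, (ii) $\tau(a+ib)=\tau(a)+i\tau(b)$ for self-adjoint $a,b$, (iii) $\tau$ is linear on every commutative $*$-subalgebra, and (iv) for every $n\ge 1$ there is a function $\tau_n:M_n(B)\to\mathbb{C}$ that satisfies (i)-(iii) and $\tau_n(x\otimes e_{11})=\tau(x)$ for all $x\in B$. Let $QT(B)$ be the set of quasitraces $\tau$ with $\|\tau\|:=\sup\{\tau(x): x\in B_+,\ \|x\|\le 1\}=1$. For $a,b\in B_+$ write $a\lesssim b$ if $x_n^*bx_n\to a$ in norm for some sequence $(x_n)$ in $B$. Let $f_{1/4}:\mathbb{R}\to[0,1]$ be $0$ on $(-\infty,1/8]$, $1$ on $[1/4,\infty)$, and linear in between. Let $\mathcal{C}_0$ be the class of nonzero C*-algebras $C$ that are isomorphic to $$\{(f,g)\in C([0,1],F_2)\oplus F_1:\ f(0)=\phi_0(g),\ f(1)=\phi_1(g)\}$$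 for finite-dimensional C*-algebras $F_1,F_2$ and (not necessarily unital) $*$-homomorphisms $\phi_0,\phi_1:F_1\to F_2$, and that satisfy $K_1(C)=\{0\}$, $K_0(C)_+=\{0\}$ and $0\notin\overline{T(C)}^{w}$. Let $\mathcal{C}_0'$ be the class of full hereditary C*-subalgebras of algebras in $\mathcal{C}_0$. A simple C*-algebra $A$ belongs to $\mathcal{D}$ if it has a strictly positive element $a$ with $\|a\|=1$ for which there is a number $0<\mathfrak{f}_a<1$ such that for every $\varepsilon>0$, every finite $\mathcal{F}\subset A$ and every $b\in A_+\setminus\{0\}$ there are a C*-subalgebra $D\subset A$ with $D\in\mathcal{C}_0'$ and completely positive contractive maps $\phi:A\to A$ and $\psi:A\to D$ with $\|\phi(xy)-\phi(x)\phi(y)\|<\varepsilon$ and $\|\psi(xy)-\psi(x)\psi(y)\|<\varepsilon$ for $x,y\in\mathcal{F}$, with $\phi(A)D=\{0\}$, $\|x-(\phi(x)+\psi(x))\|<\varepsilon$ for $x\in\mathcal{F}\cup\{a\}$, $\phi(a)\lesssim b$, and $t(f_{1/4}(\psi(a)))\ge\mathfrak{f}_a$ for all $t\in T(D)$. Proposition.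 Let $A$ be a nonzero separable simple C*-algebra in $\mathcal{D}$. Then $QT(A)=T(A)\neq\emptyset$. Moreover, $0\notin\overline{T(A)}^{w}$. -/

import Mathlib

open scoped ComplexOrder CStarAlgebra Topology

noncomputable section

universe u

namespace CStarD

/-! ### Traces and quasitraces -/

/-- The tracial state space of `B`, as a subset of the dual of `B` with the weak* topology. -/
def tracialStates (B : Type u) [NonUnitalCStarAlgebra B] : Set (WeakDual ℂ B) :=
  {τ | (∀ x : B, 0 ≤ τ (star x * x)) ∧ (∀ x y : B, τ (x * y) = τ (y * x)) ∧
    ‖WeakDual.toStrongDual τ‖ = 1}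

/-- The axioms of a quasitrace which do not involve matrices over `B`. -/
structure IsOneQuasitrace {B : Type u} [NonUnitalRing B] [StarRing B] [Module ℂ B]
    (τ : B → ℂ) : Prop where
  nonneg : ∀ x : B, 0 ≤ τ (star x * x)
  tracial : ∀ x : B, τ (star x * x) = τ (x * star x)
  add_I_smul : ∀ a b : B, IsSelfAdjoint a → IsSelfAdjoint b →
    τ (a + Complex.I • b) = τ a + Complex.I * τ b
  add_of_comm : ∀ S : NonUnitalStarSubalgebra ℂ B, (∀ x ∈ S, ∀ y ∈ S, x * y = y * x) →
    ∀ x ∈ S, ∀ y ∈ S, τ (x + y) = τ x + τ y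
  smul_of_comm : ∀ S : NonUnitalStarSubalgebra ℂ B, (∀ x ∈ S, ∀ y ∈ S, x * y = y * x) →
    ∀ x ∈ S, ∀ c : ℂ, τ (c • x) = c * τ x

/-- A quasitrace: the axioms above hold for `τ` and, for every `n ≥ 1`, for some extension of `τ`
to the `n × n` matrices, where `x` is identified with the matrix that has `x` in the upper left
corner and zeros elsewhere. -/
def IsQuasitrace {B : Type u} [NonUnitalRing B] [StarRing B] [Module ℂ B] (τ : B → ℂ) : Prop :=
  IsOneQuasitrace τ ∧
    ∀ n : ℕ, ∃ τn : Matrix (Fin (n + 1)) (Fin (n + 1)) B → ℂ,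
      IsOneQuasitrace τn ∧ ∀ x : B, τn (Matrix.single 0 0 x) = τ x

/-- The set `QT(B)` of quasitraces of norm one, where the norm of `τ` is the supremum of its values
on the positive part of the unit ball. -/
def normalizedQuasitraces (B : Type u) [NonUnitalCStarAlgebra B] : Set (B → ℂ) :=
  {τ | IsQuasitrace τ ∧ IsLUB {r : ℝ | ∃ x : B, ‖star x * x‖ ≤ 1 ∧ r = (τ (star x * x)).re} 1}

/-! ### K-theory -/

section KTheory

variable {R : Type u}

/-- The block diagonal matrix with blocks `p` and `q`. -/
def blockSum [Zero R] {m n : ℕ} (p : Matrix (Fin m) (Fin m) R) (q : Matrix (Fin n) (Fin n) R) :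
    Matrix (Fin (m + n)) (Fin (m + n)) R :=
  (Matrix.fromBlocks p 0 0 q).submatrix finSumFinEquiv.symm finSumFinEquiv.symm

theorem blockSum_mul [NonUnitalNonAssocSemiring R] {m n : ℕ} (p p' : Matrix (Fin m) (Fin m) R)
    (q q' : Matrix (Fin n) (Fin n) R) :
    blockSum p q * blockSum p' q' = blockSum (p * p') (q * q') := by
  simp [blockSum, Matrix.submatrix_mul_equiv, Matrix.fromBlocks_multiply]

theorem star_blockSum [NonUnitalSemiring R] [StarRing R] {m n : ℕ} (p : Matrix (Fin m) (Fin m) R)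
    (q : Matrix (Fin n) (Fin n) R) : star (blockSum p q) = blockSum (star p) (star q) := by
  simp [blockSum, Matrix.star_eq_conjTranspose, Matrix.conjTranspose_submatrix,
    Matrix.fromBlocks_conjTranspose]

theorem blockSum_one [NonAssocSemiring R] {m n : ℕ} :
    blockSum (1 : Matrix (Fin m) (Fin m) R) (1 : Matrix (Fin n) (Fin n) R) = 1 := by
  simp [blockSum, Matrix.fromBlocks_one]

variable (R) in
/-- Projections in the `n × n` matrices over `R`. -/
abbrev MatProj [NonUnitalSemiring R] [StarRing R] (n : ℕ) : Type u :=
  {p : Matrix (Fin n) (Fin n) R // IsStarProjection p}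

/-- The direct sum of two projections. -/
def MatProj.sum [NonUnitalSemiring R] [StarRing R] {m n : ℕ} (p : MatProj R m) (q : MatProj R n) :
    MatProj R (m + n) :=
  ⟨blockSum p.1 q.1, by
    constructor
    · rw [IsIdempotentElem, blockSum_mul, p.2.isIdempotentElem.eq, q.2.isIdempotentElem.eq]
    · rw [IsSelfAdjoint, star_blockSum, p.2.isSelfAdjoint.star_eq, q.2.isSelfAdjoint.star_eq]⟩

/-- Murray-von Neumann equivalence of projections in matrix algebras over `R`. -/
def MatProj.Equivalent [NonUnitalSemiring R] [StarRing R] {m n : ℕ} (p : MatProj R m)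
    (q : MatProj R n) : Prop :=
  ∃ w : Matrix (Fin n) (Fin m) R, w.conjTranspose * w = p.1 ∧ w * w.conjTranspose = q.1

variable (R) in
/-- The relations between projections that define `K₀`. -/
def K0Rel [Ring R] [StarRing R] : AddSubgroup (FreeAbelianGroup (Σ n : ℕ, MatProj R n)) :=
  AddSubgroup.closure
    ({x | ∃ (m n : ℕ) (p : MatProj R m) (q : MatProj R n),
        x = .of ⟨m + n, p.sum q⟩ - (.of ⟨m, p⟩ + .of ⟨n, q⟩)} ∪
      {x | ∃ (m n : ℕ) (p : MatProj R m) (q : MatProj R n), p.Equivalent q ∧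
        x = .of ⟨m, p⟩ - .of ⟨n, q⟩})

variable (R) in
/-- `K₀` of a unital *-ring: the universal abelian group that receives an additive invariant of
Murray-von Neumann classes of projections in matrix algebras, that is, the Grothendieck group of
the monoid of these classes. -/
abbrev K0 [Ring R] [StarRing R] : Type u :=
  FreeAbelianGroup (Σ n : ℕ, MatProj R n) ⧸ K0Rel R

/-- The class of a projection in `K₀`. -/
def K0.mk [Ring R] [StarRing R] {n : ℕ} (p : MatProj R n) : K0 R :=
  QuotientAddGroup.mk (FreeAbelianGroup.of ⟨n, p⟩)

variable (R) in
/-- Unitaries in the `n × n` matrices over `R`. -/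
abbrev MatUnitary [Ring R] [StarRing R] (n : ℕ) : Type u :=
  unitary (Matrix (Fin n) (Fin n) R)

/-- The direct sum of two unitaries. -/
def MatUnitary.sum [Ring R] [StarRing R] {m n : ℕ} (p : MatUnitary R m) (q : MatUnitary R n) :
    MatUnitary R (m + n) :=
  ⟨blockSum p.1 q.1, by
    rw [Unitary.mem_iff, star_blockSum, blockSum_mul, blockSum_mul,
      Unitary.star_mul_self_of_mem p.2, Unitary.star_mul_self_of_mem q.2,
      Unitary.mul_star_self_of_mem p.2, Unitary.mul_star_self_of_mem q.2, blockSum_one]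
    exact ⟨rfl, rfl⟩⟩

variable (R) in
/-- The relations between unitaries that define `K₁`. -/
def K1Rel [Ring R] [StarRing R] [TopologicalSpace R] :
    AddSubgroup (FreeAbelianGroup (Σ n : ℕ, MatUnitary R n)) :=
  AddSubgroup.closure
    ({x | ∃ (m n : ℕ) (p : MatUnitary R m) (q : MatUnitary R n),
        x = .of ⟨m + n, p.sum q⟩ - (.of ⟨m, p⟩ + .of ⟨n, q⟩)} ∪
      {x | ∃ (n : ℕ) (p q : MatUnitary R n), Joined p q ∧ x = .of ⟨n, p⟩ - .of ⟨n, q⟩} ∪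
      {x | ∃ n : ℕ, x = .of ⟨n, 1⟩})

variable (R) in
/-- `K₁` of a unital C*-algebra: the universal abelian group that receives an additive homotopy
invariant of unitaries in matrix algebras which vanishes on the identity matrices. -/
abbrev K1 [Ring R] [StarRing R] [TopologicalSpace R] : Type u :=
  FreeAbelianGroup (Σ n : ℕ, MatUnitary R n) ⧸ K1Rel R

variable {C : Type u} [NonUnitalCStarAlgebra C]

/-- A projection over `C`, regarded as a projection over the unitization of `C`. -/
def MatProj.inr {n : ℕ} (p : MatProj C n) : MatProj (Unitization ℂ C) n :=
  ⟨p.1.map (Unitization.inrNonUnitalStarAlgHom ℂ C), by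
    constructor
    · rw [IsIdempotentElem, ← Matrix.map_mul, p.2.isIdempotentElem.eq]
    · rw [IsSelfAdjoint, Matrix.star_eq_conjTranspose, ← Matrix.conjTranspose_map _ (map_star _),
        ← Matrix.star_eq_conjTranspose, p.2.isSelfAdjoint.star_eq]⟩

variable (C) in
/-- `K₀(C)₊`, the set of classes of projections in matrix algebras over `C`. It is regarded as a
subset of `K₀` of the unitization of `C`, of which `K₀(C)` is a subgroup. -/
def K0Pos : Set (K0 (Unitization ℂ C)) :=
  {x | ∃ (n : ℕ) (p : MatProj C n), x = K0.mk p.inr}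

end KTheory

/-! ### The building blocks -/

/-- `A(F₁, F₂, φ₀, φ₁) = {(f, g) ∈ C([0,1], F₂) ⊕ F₁ : f(0) = φ₀(g), f(1) = φ₁(g)}`. -/
def mappingTorus {F₁ F₂ : Type u} [NonUnitalCStarAlgebra F₁] [NonUnitalCStarAlgebra F₂]
    (φ₀ φ₁ : F₁ →⋆ₙₐ[ℂ] F₂) : NonUnitalStarSubalgebra ℂ (C(unitInterval, F₂) × F₁) where
  carrier := {x | x.1 0 = φ₀ x.2 ∧ x.1 1 = φ₁ x.2}
  add_mem' := by
    rintro x y ⟨h0, h1⟩ ⟨k0, k1⟩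
    simp [h0, h1, k0, k1]
  zero_mem' := by simp
  mul_mem' := by
    rintro x y ⟨h0, h1⟩ ⟨k0, k1⟩
    simp [h0, h1, k0, k1]
  smul_mem' := by
    rintro c x ⟨h0, h1⟩
    simp [h0, h1]
  star_mem' := by
    rintro x ⟨h0, h1⟩
    simp [h0, h1, map_star]

/-- The class `𝒞`: algebras `A(F₁, F₂, φ₀, φ₁)` with `F₁` and `F₂` finite dimensional. -/
def InClassC (C : Type u) [NonUnitalCStarAlgebra C] : Prop :=
  ∃ (F₁ F₂ : Type) (_ : NonUnitalCStarAlgebra F₁) (_ : NonUnitalCStarAlgebra F₂)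
    (φ₀ φ₁ : F₁ →⋆ₙₐ[ℂ] F₂), FiniteDimensional ℂ F₁ ∧ FiniteDimensional ℂ F₂ ∧
      Nonempty (C ≃⋆ₐ[ℂ] mappingTorus φ₀ φ₁)

/-- The class `𝒞₀`: nonzero algebras `C` in `𝒞` with `K₁(C) = {0}`, `K₀(C)₊ = {0}`, and `0` not in
the weak* closure of the tracial state space. -/
structure InClassC0 (C : Type u) [NonUnitalCStarAlgebra C] : Prop where
  nontrivial : Nontrivial C
  inClassC : InClassC C
  k1 : Subsingleton (K1 (Unitization ℂ C))
  k0 : K0Pos C = {0}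
  zero_notMem : (0 : WeakDual ℂ C) ∉ closure (tracialStates C)

/-- Hereditary: `0 ≤ x ≤ y` and `y ∈ B` imply `x ∈ B`. Here `x = u*u` and `y - x = w*w`. -/
def IsHereditary {C : Type u} [NonUnitalCStarAlgebra C] (B : NonUnitalStarSubalgebra ℂ C) : Prop :=
  ∀ u w : C, star u * u + star w * w ∈ B → star u * u ∈ B

/-- Full: no proper closed two-sided ideal contains `B`. -/
def IsFull {C : Type u} [NonUnitalCStarAlgebra C] (B : NonUnitalStarSubalgebra ℂ C) : Prop :=
  ∀ I : TwoSidedIdeal C, IsClosed {x | x ∈ I} → (∀ x ∈ B, x ∈ I) → I = ⊤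

/-- The class `𝒞₀'`: full hereditary C*-subalgebras of algebras in `𝒞₀`. -/
def InClassC0' (D : Type u) [NonUnitalCStarAlgebra D] : Prop :=
  ∃ (C : Type) (_ : NonUnitalCStarAlgebra C) (B : NonUnitalStarSubalgebra ℂ C),
    InClassC0 C ∧ IsClosed (B : Set C) ∧ IsHereditary B ∧ IsFull B ∧ Nonempty (D ≃⋆ₐ[ℂ] B)

/-! ### The class `𝒟` -/

/-- No closed two-sided ideals other than `0` and `A`. -/
def IsSimpleCStar (A : Type u) [NonUnitalCStarAlgebra A] : Prop :=
  ∀ I : TwoSidedIdeal A, IsClosed {x | x ∈ I} → I = ⊥ ∨ I = ⊤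

/-- The function that is `0` up to `ε/2`, `1` from `ε` on, and linear in between. -/
def cutoff (ε t : ℝ) : ℝ :=
  if t ≤ ε / 2 then 0 else if t ≤ ε then (t - ε / 2) / (ε / 2) else 1

section ClassD

variable {A : Type u} [NonUnitalCStarAlgebra A]

/-- Cuntz subequivalence of positive elements. -/
def CuntzLE (a b : A) : Prop :=
  ∃ x : ℕ → A, Filter.Tendsto (fun n => star (x n) * b * x n) Filter.atTop (𝓝 a)

/-- `φ` is multiplicative on `F` up to `ε`. -/
def IsApproxMul (F : Finset A) (ε : ℝ) (φ : A → A) : Prop :=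
  ∀ x ∈ F, ∀ y ∈ F, ‖φ (x * y) - φ x * φ y‖ < ε

variable [PartialOrder A] [StarOrderedRing A]

/-- `a` is a strictly positive element of `A`: it is positive and `aAa` is dense in `A`. -/
def IsStrictlyPos (a : A) : Prop :=
  0 ≤ a ∧ Dense (Set.range fun x : A => a * x * a)

/-- The approximation of `A` which the class `𝒟` requires for `ε`, `F` and `b`. The map `ψ : A → D`
is given as a map into `A` with values in `D`. -/
def HasApprox (a : A) (f : ℝ) (ε : ℝ) (F : Finset A) (b : A) : Prop :=
  ∃ (D : NonUnitalStarSubalgebra ℂ A) (_ : IsClosed (D : Set A)) (φ ψ : A →CP A)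
    (hψ : ∀ x, ψ x ∈ D),
    (∀ x, ‖φ x‖ ≤ ‖x‖) ∧ (∀ x, ‖ψ x‖ ≤ ‖x‖) ∧
    IsApproxMul F ε φ ∧ IsApproxMul F ε ψ ∧
    (∀ x, ∀ d ∈ D, φ x * d = 0) ∧
    (∀ x ∈ F, ‖x - (φ x + ψ x)‖ < ε) ∧ ‖a - (φ a + ψ a)‖ < ε ∧
    InClassC0' D ∧
    CuntzLE (φ a) b ∧
    ∀ t ∈ tracialStates D, f ≤ (t (cfcₙ (cutoff (1 / 4)) (⟨ψ a, hψ a⟩ : D))).re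

variable (A) in
/-- The class `𝒟`. -/
def InClassD : Prop :=
  IsSimpleCStar A ∧ ∃ a : A, IsStrictlyPos a ∧ ‖a‖ = 1 ∧ ∃ f : ℝ, 0 < f ∧ f < 1 ∧
    ∀ ε : ℝ, 0 < ε → ∀ (F : Finset A) (b : A), 0 ≤ b → b ≠ 0 → HasApprox a f ε F b

end ClassD

end CStarD

end

/-! The heart of the matter is that every quasitrace `t` on `A` is additive on positive elements; it
is then the restriction of a positive linear functional, and the trace identity follows by
polarization.

Additivity is transported from the building blocks. In the approximation x ≈ φ(x) + ψ(x) the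
summands are orthogonal, ψ is linear with values in `D`, and φ(a) is Cuntz below an element b whose
dimension under `t` may be prescribed as small as desired. As `t` is monotone and Lipschitz on the
positive cone (`IsPosQuasitrace.abs_sub_le`) and every positive x is nearly below a multiple of the
strictly positive a, t(φ(x)) is negligible and t(x) ≈ t(ψ(x)) (`ApproxProperty.exists_abs_sub_le`).
A suitable b exists because `D` has no nonzero projections: K₀(C)₊ = 0 forces traces to vanish on
projections, while traces through finite dimensional quotients separate points. Hence nonzero
self-adjoint elements of `D` have infinite spectrum and support arbitrarily many orthogonal pieces.

On `D` the argument is convexity. `D` sits in C([0,1], F₂) ⊕ F₁ and is stable under multiplication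
by functions with equal values at 0 and 1. By Krein–Milman an extreme quasitrace may be assumed.
Central multipliers act on it by scalars, so it sees only two points of the interval and the F₁
component (`exists_eq_of_extreme`). It thus factors through a finite dimensional algebra, where
expansion in minimal projections gives additivity (`add_of_finiteDimensional`).

For existence, tracial states of the blocks composed with ψ are almost tracial and bounded below at
a, so they have a nonzero tracial weak* cluster point. Conversely every tracial state satisfies τ(a)
≥ f/32 (`ApproxProperty.le_re_apply`), a weak* closed condition that excludes 0. -/

noncomputable section

universe u

namespace CStarD

/-! ### Factorization of positive elements below y⋆y -/

section Comparison

theorem cfcn_mul_eq {A : Type*} [NonUnitalCStarAlgebra A] {h : A} {F G K : ℝ → ℝ}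
    (hF : ContinuousOn F (quasispectrum ℝ h)) (hG : ContinuousOn G (quasispectrum ℝ h))
    (hF0 : F 0 = 0) (hG0 : G 0 = 0) (hK : ∀ s ∈ quasispectrum ℝ h, F s * G s = K s) :
    cfcₙ F h * cfcₙ G h = cfcₙ K h := by
  rw [← cfcₙ_mul F G h hF hF0 hG hG0]
  exact cfcₙ_congr hK

variable {A : Type*} [NonUnitalCStarAlgebra A] [PartialOrder A] [StarOrderedRing A]

theorem cfcn_mul_self_mul_eq {h : A} (hh : 0 ≤ h) {F G K : ℝ → ℝ}
    (hF : ContinuousOn F (quasispectrum ℝ h)) (hG : ContinuousOn G (quasispectrum ℝ h))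
    (hF0 : F 0 = 0) (hG0 : G 0 = 0) (hK : ∀ s ∈ quasispectrum ℝ h, F s * s * G s = K s) :
    cfcₙ F h * h * cfcₙ G h = cfcₙ K h := by
  have h1 : cfcₙ F h * h = cfcₙ (fun s => F s * s) h := by
    conv_lhs => enter [2]; rw [← cfcₙ_id ℝ h]
    exact cfcn_mul_eq hF continuousOn_id hF0 rfl fun s _ => rfl
  rw [h1]
  exact cfcn_mul_eq (hF.mul continuousOn_id) hG (by simp) hG0 hK

theorem cfcn_sqrt_mul_self {h : A} (hh : 0 ≤ h) :
    cfcₙ Real.sqrt h * cfcₙ Real.sqrt h = h := by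
  rw [cfcn_mul_eq (K := id) Real.continuous_sqrt.continuousOn Real.continuous_sqrt.continuousOn
    (by simp) (by simp) fun s hs => ?_, cfcₙ_id ℝ h]
  exact Real.mul_self_sqrt (quasispectrum_nonneg_of_nonneg h hh s hs)

/-- By polar decomposition y may be replaced by h^(1/2), where h = y⋆y. Then q ≤ h reduces the
squared norm to that of a function of h. It is the Cauchy estimate for the sequence in
`exists_star_mul_self_eq_of_le`. -/
theorem norm_mul_cfcn_mul_le {q y x : A} (hx : IsSelfAdjoint x) (hxq : x * x = q)
    (hle : q ≤ star y * y) {D : ℝ → ℝ} (hD : ContinuousOn D (quasispectrum ℝ (star y * y)))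
    (hD0 : D 0 = 0) {M : ℝ} (hM : ∀ s ∈ quasispectrum ℝ (star y * y), |s * D s| ≤ M) :
    ‖y * cfcₙ D (star y * y) * x‖ ≤ M := by
  set h := star y * y with hh
  have hpos : 0 ≤ h := star_mul_self_nonneg y
  have hspec : ∀ s ∈ quasispectrum ℝ h, 0 ≤ s := quasispectrum_nonneg_of_nonneg h hpos
  have hM0 : 0 ≤ M := (abs_nonneg _).trans (hM 0 (quasispectrum.zero_mem ℝ h))
  set d := cfcₙ D h with hd
  set w := cfcₙ Real.sqrt h with hw
  have hww : w * w = h := cfcn_sqrt_mul_self hpos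
  have hds : star d = d := IsSelfAdjoint.cfcₙ
  have hws : star w = w := IsSelfAdjoint.cfcₙ
  have e1 : ‖y * d * x‖ * ‖y * d * x‖ = ‖w * d * x‖ * ‖w * d * x‖ := by
    rw [← CStarRing.norm_star_mul_self, ← CStarRing.norm_star_mul_self]
    simp only [star_mul, hds, hws, hx.star_eq]
    congr 1
    calc x * (d * star y) * (y * d * x) = x * d * (star y * y) * d * x := by simp only [mul_assoc]
      _ = x * (d * w) * (w * d * x) := by rw [← hh, ← hww]; simp only [mul_assoc]
  have e2 : ‖w * d * x‖ * ‖w * d * x‖ ≤ M ^ 2 := by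
    rw [← CStarRing.norm_self_mul_star]
    have : w * d * x * star (w * d * x) = (w * d) * q * star (w * d) := by
      simp only [star_mul, hx.star_eq, ← hxq, mul_assoc]
    rw [this]
    have hq : 0 ≤ q := by rw [← hxq]; nth_rw 1 [← hx.star_eq]; exact star_mul_self_nonneg x
    refine (CStarAlgebra.norm_le_norm_of_nonneg_of_le (star_right_conjugate_nonneg hq _)
      (star_right_conjugate_le_conjugate hle _)).trans ?_
    have : (w * d) * h * star (w * d) = cfcₙ (fun s => (s * D s) ^ 2) h := by
      have h1 : w * d = cfcₙ (fun s => √s * D s) h := by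
        rw [cfcₙ_mul _ _ _ Real.continuous_sqrt.continuousOn (by simp) hD hD0]
      have hc : ContinuousOn (fun s => √s * D s) (quasispectrum ℝ h) :=
        Real.continuous_sqrt.continuousOn.mul hD
      have h2 : star (w * d) = w * d := by rw [h1]; exact IsSelfAdjoint.cfcₙ
      rw [h2, h1]
      refine cfcn_mul_self_mul_eq hpos hc hc (by simp) (by simp) fun s hs => ?_
      have := Real.mul_self_sqrt (hspec s hs)
      linear_combination s * (D s) ^ 2 * this
    rw [this]
    refine norm_cfcₙ_le fun s hs => ?_
    rw [Real.norm_eq_abs, abs_pow]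
    exact pow_le_pow_left₀ (abs_nonneg _) (hM s hs) 2
  nlinarith [norm_nonneg (y * d * x)]

/-- Formally this compares (1-e)q(1-e) with (1-e)h(1-e). The algebra may lack a unit, so the
conjugations are spelled out through square roots of q, h and h - q. -/
theorem norm_sub_cfcn_mul_le {q h x : A} (hx : IsSelfAdjoint x) (hxq : x * x = q)
    (hpos : 0 ≤ h) (hle : q ≤ h) {E : ℝ → ℝ} (hE : ContinuousOn E (quasispectrum ℝ h))
    (hE0 : E 0 = 0) {M : ℝ} (hM0 : 0 ≤ M)
    (hM : ∀ s ∈ quasispectrum ℝ h, |s * (1 - E s) ^ 2| ≤ M ^ 2) :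
    ‖x - cfcₙ E h * x‖ ≤ M := by
  set e := cfcₙ E h with he
  have hes : star e = e := IsSelfAdjoint.cfcₙ
  have hq : 0 ≤ q := by rw [← hxq]; nth_rw 1 [← hx.star_eq]; exact star_mul_self_nonneg x
  have key : ∀ v : A, IsSelfAdjoint v → (v - e * v) * star (v - e * v) =
      v * v - e * (v * v) - v * v * e + e * (v * v) * e := by
    intro v hv
    simp only [star_sub, star_mul, hes, hv.star_eq, sub_mul, mul_sub, mul_assoc]
    abel
  have e2 : ‖x - e * x‖ * ‖x - e * x‖ ≤ M ^ 2 := by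
    rw [← CStarRing.norm_self_mul_star]
    set w := cfcₙ Real.sqrt (h - q)
    have hw : w * w = h - q := cfcn_sqrt_mul_self (sub_nonneg.2 hle)
    have hws : IsSelfAdjoint w := IsSelfAdjoint.cfcₙ
    set k := cfcₙ Real.sqrt h
    have hk : k * k = h := cfcn_sqrt_mul_self hpos
    have hks : IsSelfAdjoint k := IsSelfAdjoint.cfcₙ
    have hle' : (x - e * x) * star (x - e * x) ≤ (k - e * k) * star (k - e * k) := by
      rw [← sub_nonneg]
      convert mul_star_self_nonneg (w - e * w) using 1
      rw [key x hx, key k hks, key w hws, hw, hk, hxq]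
      simp only [mul_sub, sub_mul]
      abel
    refine (CStarAlgebra.norm_le_norm_of_nonneg_of_le (mul_star_self_nonneg _) hle').trans ?_
    rw [key k hks, hk]
    have hid : h = cfcₙ (fun s : ℝ => s) h := (cfcₙ_id ℝ h).symm
    have c1 : ContinuousOn (fun s : ℝ => s) (quasispectrum ℝ h) := continuousOn_id
    have e1 : e * h = cfcₙ (fun s => E s * s) h := by
      conv_lhs => enter [2]; rw [hid]
      exact cfcn_mul_eq hE c1 hE0 rfl fun s _ => rfl
    have e3 : h * e = cfcₙ (fun s => E s * s) h := by
      conv_lhs => enter [1]; rw [hid]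
      exact cfcn_mul_eq c1 hE rfl hE0 fun s _ => mul_comm _ _
    have e4 : e * h * e = cfcₙ (fun s => E s * s * E s) h := by
      rw [e1]
      exact cfcn_mul_eq (hE.mul c1) hE (by simp) hE0 fun s _ => rfl
    rw [e4, e3, e1]
    nth_rw 1 [hid]
    have c2 : ContinuousOn (fun s => E s * s) (quasispectrum ℝ h) := hE.mul c1
    have c3 : ContinuousOn (fun s => s - E s * s) (quasispectrum ℝ h) := c1.sub c2
    have c4 : ContinuousOn (fun s => s - E s * s - E s * s) (quasispectrum ℝ h) := c3.sub c2
    have c5 : ContinuousOn (fun s => E s * s * E s) (quasispectrum ℝ h) := c2.mul hE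
    rw [← cfcₙ_sub _ _ h c1 rfl c2 (by simp), ← cfcₙ_sub _ _ h c3 (by simp) c2 (by simp),
      ← cfcₙ_add _ _ h c4 (by simp) c5 (by simp)]
    refine norm_cfcₙ_le fun s hs => ?_
    rw [Real.norm_eq_abs]
    convert hM s hs using 2
    ring
  nlinarith [norm_nonneg (x - e * x)]

/-- If `0 ≤ q ≤ y⋆y`, then `q = z⋆z` for some `z` in the closed right ideal generated by `y`. -/
theorem exists_star_mul_self_eq_of_le {q y : A} (hq : 0 ≤ q) (hle : q ≤ star y * y) :
    ∃ z : A, star z * z = q ∧ ∀ l : A, l * y = y → l * z = z := by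
  set h := star y * y with hh
  have hpos : 0 ≤ h := star_mul_self_nonneg y
  have hspec : ∀ s ∈ quasispectrum ℝ h, 0 ≤ s := quasispectrum_nonneg_of_nonneg h hpos
  set x := cfcₙ Real.sqrt q
  have hx : IsSelfAdjoint x := IsSelfAdjoint.cfcₙ
  have hxq : x * x = q := cfcn_sqrt_mul_self hq
  let δ : ℕ → ℝ := fun n => 1 / ((n : ℝ) + 1)
  have hδ : ∀ n, 0 < δ n := fun n => by positivity
  -- A regularized inverse square root: the limit of z n stands for y h^(-1/2) q^(1/2), and s · ρ n
  -- s → √s uniformly.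
  let ρ : ℕ → ℝ → ℝ := fun n s => √s / (s + δ n)
  have hden : ∀ n, ∀ s ∈ quasispectrum ℝ h, s + δ n ≠ 0 := fun n s hs =>
    (add_pos_of_nonneg_of_pos (hspec s hs) (hδ n)).ne'
  have hρ : ∀ n, ContinuousOn (ρ n) (quasispectrum ℝ h) := fun n =>
    Real.continuous_sqrt.continuousOn.div (by fun_prop) (hden n)
  have hρ0 : ∀ n, ρ n 0 = 0 := fun n => by simp [ρ]
  let z : ℕ → A := fun n => y * cfcₙ (ρ n) h * x
  have hbd : ∀ n, ∀ s ∈ quasispectrum ℝ h, |s * ρ n s - √s| ≤ √(δ n) := by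
    intro n s hs
    have h0 := hspec s hs
    have h1 := hδ n
    have : s * ρ n s - √s = -(√s * δ n / (s + δ n)) := by
      simp only [ρ]; have := hden n s hs; field_simp; ring
    rw [this, abs_neg, abs_of_nonneg (by positivity), div_le_iff₀ (by positivity)]
    nlinarith [Real.mul_self_sqrt h0, Real.mul_self_sqrt h1.le, Real.sqrt_nonneg s,
      Real.sqrt_nonneg (δ n), sq_nonneg (√s - √(δ n)),
      mul_nonneg (Real.sqrt_nonneg (δ n)) (sq_nonneg (√s - √(δ n))),
      mul_nonneg (Real.sqrt_nonneg s) (sq_nonneg (√(δ n))),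
      mul_nonneg (Real.sqrt_nonneg (δ n)) h0, mul_nonneg (Real.sqrt_nonneg (δ n)) h1.le]
  have hδanti : ∀ N n, N ≤ n → √(δ n) ≤ √(δ N) := fun N n hNn =>
    Real.sqrt_le_sqrt (one_div_le_one_div_of_le (by positivity) (by gcongr))
  have hδlim : Filter.Tendsto (fun n => √(δ n)) Filter.atTop (𝓝 0) := by
    have := (Real.continuous_sqrt.tendsto 0).comp (tendsto_one_div_add_atTop_nhds_zero_nat (𝕜 := ℝ))
    rw [Real.sqrt_zero] at this
    exact this
  have hcau : CauchySeq z := by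
    refine cauchySeq_of_le_tendsto_0 (fun N => 2 * √(δ N)) (fun n m N hn hm => ?_) ?_
    · rw [dist_eq_norm]
      have : z n - z m = y * cfcₙ (fun s => ρ n s - ρ m s) h * x := by
        rw [cfcₙ_sub _ _ h (hρ n) (hρ0 n) (hρ m) (hρ0 m)]
        simp only [z, mul_sub, sub_mul]
      rw [this]
      refine norm_mul_cfcn_mul_le hx hxq hle ((hρ n).sub (hρ m)) (by simp [hρ0]) fun s hs => ?_
      have h1 := hbd n s hs
      have h2 := hbd m s hs
      have h3 := hδanti N n hn
      have h4 := hδanti N m hm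
      rw [abs_le] at *
      simp only [Pi.sub_apply]
      constructor <;> nlinarith
    · simpa using hδlim.const_mul 2
  obtain ⟨z₀, hz₀⟩ := cauchySeq_tendsto_of_complete hcau
  refine ⟨z₀, ?_, fun l hl => ?_⟩
  · let e : ℕ → A := fun n => cfcₙ (fun s => s / (s + δ n)) h
    have hEc : ∀ n, ContinuousOn (fun s => s / (s + δ n)) (quasispectrum ℝ h) := fun n =>
      continuousOn_id.div (by fun_prop) (hden n)
    have he : ∀ n, star (z n) * z n = star (e n * x) * (e n * x) := by
      intro n
      have h1 : star (cfcₙ (ρ n) h) = cfcₙ (ρ n) h := IsSelfAdjoint.cfcₙ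
      have h2 : star (e n) = e n := IsSelfAdjoint.cfcₙ
      simp only [z, star_mul, hx.star_eq, h1, h2]
      have h3 : cfcₙ (ρ n) h * h * cfcₙ (ρ n) h = e n * e n := by
        rw [cfcn_mul_self_mul_eq hpos (hρ n) (hρ n) (hρ0 n) (hρ0 n) fun s _ => rfl]
        refine (cfcn_mul_eq (hEc n) (hEc n) (by simp) (by simp) fun s hs => ?_).symm
        have := Real.mul_self_sqrt (hspec s hs)
        have h4 := hden n s hs
        simp only [ρ]
        field_simp
        rw [sq, sq, this]
      calc x * (cfcₙ (ρ n) h * star y) * (y * cfcₙ (ρ n) h * x)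
          = x * (cfcₙ (ρ n) h * (star y * y) * cfcₙ (ρ n) h) * x := by simp only [mul_assoc]
        _ = x * e n * (e n * x) := by rw [← hh, h3]; simp only [mul_assoc]
    have hlim : Filter.Tendsto (fun n => e n * x) Filter.atTop (𝓝 x) := by
      rw [tendsto_iff_norm_sub_tendsto_zero]
      refine squeeze_zero (fun _ => norm_nonneg _) (fun n => ?_) hδlim
      rw [norm_sub_rev]
      refine norm_sub_cfcn_mul_le hx hxq hpos hle (hEc n) (by simp) (Real.sqrt_nonneg _)
        fun s hs => ?_
      have h0 := hspec s hs
      have h1 := hδ n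
      rw [Real.sq_sqrt h1.le, abs_of_nonneg (by positivity)]
      have : s * (1 - s / (s + δ n)) ^ 2 = s * δ n ^ 2 / (s + δ n) ^ 2 := by
        have := hden n s hs; field_simp; ring
      rw [this, div_le_iff₀ (by positivity)]
      nlinarith [mul_nonneg h0 h0, mul_nonneg h0 h1.le, mul_pos h1 h1,
        mul_nonneg (mul_nonneg h0 h0) h1.le, mul_nonneg h0 (mul_pos h1 h1).le, pow_pos h1 3]
    have h1 : Filter.Tendsto (fun n => star (z n) * z n) Filter.atTop (𝓝 (star z₀ * z₀)) :=
      (hz₀.star).mul hz₀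
    have h2 : Filter.Tendsto (fun n => star (z n) * z n) Filter.atTop (𝓝 (star x * x)) := by
      simp_rw [he]
      exact hlim.star.mul hlim
    rw [tendsto_nhds_unique h1 h2, hx.star_eq, hxq]
  · refine tendsto_nhds_unique (hz₀.const_mul l) ?_
    convert hz₀ using 2 with n
    simp only [z, ← mul_assoc, hl]

end Comparison

/-- A contractive quasitrace, as a function of which only the values at positive elements matter. -/
structure IsPosQuasitrace {A : Type*} [NonUnitalCStarAlgebra A] [PartialOrder A]
    (t : A → ℝ) : Prop where
  nonneg : ∀ a, 0 ≤ a → 0 ≤ t a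
  tracial : ∀ x, t (star x * x) = t (x * star x)
  add : ∀ a b, 0 ≤ a → 0 ≤ b → Commute a b → t (a + b) = t a + t b
  smul : ∀ (r : ℝ) (a : A), 0 ≤ r → 0 ≤ a → t (r • a) = r * t a
  le_norm : ∀ a, 0 ≤ a → t a ≤ ‖a‖

theorem IsPosQuasitrace.map_zero {A : Type*} [NonUnitalCStarAlgebra A] [PartialOrder A]
    {t : A → ℝ} (ht : IsPosQuasitrace t) : t 0 = 0 := by
  simpa using ht.smul 0 0 le_rfl le_rfl

/-- The piecewise linear function that is `0` up to `k`, `1` from `k + 1` on. -/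
def ramp (k : ℕ) (x : ℝ) : ℝ := max 0 (min 1 (x - k))

theorem ramp_nonneg (k : ℕ) (x : ℝ) : 0 ≤ ramp k x := le_max_left _ _

theorem ramp_le_one (k : ℕ) (x : ℝ) : ramp k x ≤ 1 := by simp [ramp]

theorem ramp_zero (k : ℕ) : ramp k 0 = 0 := by simp [ramp]

theorem ramp_eq_one {k : ℕ} {x : ℝ} (h : (k : ℝ) + 1 ≤ x) : ramp k x = 1 := by
  rw [ramp, min_eq_left (by linarith), max_eq_right zero_le_one]

theorem ramp_eq_zero {k : ℕ} {x : ℝ} (h : x ≤ k) : ramp k x = 0 := by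
  rw [ramp, max_eq_left]
  exact (min_le_right _ _).trans (by linarith)

@[fun_prop]
theorem continuous_ramp (k : ℕ) : Continuous (ramp k) := by unfold ramp; fun_prop

theorem sum_ramp (N : ℕ) {x : ℝ} (hx : 0 ≤ x) :
    ∑ k ∈ Finset.range N, ramp k x = min x N := by
  induction N with
  | zero => simp [hx]
  | succ N ih =>
    rw [Finset.sum_range_succ, ih, ramp]
    push_cast
    rcases le_total x N with h | h
    · rw [max_eq_left ((min_le_right _ _).trans (by linarith)), add_zero, min_eq_left h,
        min_eq_left (by linarith)]
    · rw [min_eq_right h]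
      rcases le_total x (N + 1) with h' | h'
      · rw [min_eq_left h', min_eq_right (by linarith), max_eq_right (by linarith)]; ring
      · rw [min_eq_right h', min_eq_left (by linarith), max_eq_right zero_le_one]

/-! ### Monotonicity and Lipschitz continuity of quasitraces -/

section Continuity

variable {A : Type*} [NonUnitalCStarAlgebra A] [PartialOrder A] [StarOrderedRing A] {t : A → ℝ}

/-- Write q = z⋆z with l z = z. The trace identity moves q to p = z z⋆, which commutes with l² and
satisfies p ≤ ‖q‖ l². For commuting elements additivity already implies monotonicity. -/
theorem IsPosQuasitrace.le_of_le_star_mul_self (ht : IsPosQuasitrace t) {q y l : A} (hq : 0 ≤ q)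
    (hqy : q ≤ star y * y) (hl : IsSelfAdjoint l) (hly : l * y = y) :
    t q ≤ ‖q‖ * t (l * l) := by
  obtain ⟨z, hz, hlz⟩ := exists_star_mul_self_eq_of_le hq hqy
  have h1 : l * z = z := hlz l hly
  set p := z * star z with hp
  have hp0 : 0 ≤ p := mul_star_self_nonneg z
  have hlp : l * p = p := by rw [hp, ← mul_assoc, h1]
  have hpl : p * l = p := by
    have := congrArg star hlp
    rwa [star_mul, hl.star_eq, hp0.isSelfAdjoint.star_eq] at this
  have hnorm : ‖p‖ = ‖q‖ := by
    rw [hp, ← hz, CStarRing.norm_self_mul_star, CStarRing.norm_star_mul_self]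
  have hll : 0 ≤ l * l := by nth_rw 1 [← hl.star_eq]; exact star_mul_self_nonneg l
  have hle : p ≤ ‖q‖ • (l * l) := by
    have := CStarAlgebra.star_left_conjugate_le_norm_smul (a := l) (b := p) hp0.isSelfAdjoint
    rwa [hl.star_eq, hlp, hpl, hnorm] at this
  have h2 : t (‖q‖ • (l * l)) = t (‖q‖ • (l * l) - p) + t p := by
    rw [← ht.add _ _ (sub_nonneg.2 hle) hp0, sub_add_cancel]
    have : Commute (l * l) p := by
      show l * l * p = p * (l * l)
      rw [mul_assoc, hlp, hlp, ← mul_assoc, hpl, hpl]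
    exact (this.smul_left _).sub_left (Commute.refl p)
  rw [ht.smul _ _ (norm_nonneg _) hll] at h2
  have h3 := ht.nonneg _ (sub_nonneg.2 hle)
  rw [← hz, ht.tracial, hz]
  linarith

-- The hypothesis `H` expresses c ≤ b + ε without a unit. It compares the layers of c with those of
-- b two steps lower: one step leaves the gap η - ε > 0, the other makes room for a local unit of
-- the cut-down of b.
set_option maxHeartbeats 1000000 in
theorem IsPosQuasitrace.ramp_le_ramp (ht : IsPosQuasitrace t) {b c : A} (hb : 0 ≤ b) (hc : 0 ≤ c)
    {ε η : ℝ} (hη : 0 < η) (hεη : ε < η)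
    (H : ∀ g : A, IsSelfAdjoint g → g * c * g ≤ g * b * g + ε • (g * g)) (k : ℕ) :
    t (cfcₙ (fun s => ramp (k + 2) (s / η)) c) ≤ t (cfcₙ (fun s => ramp k (s / η)) b) := by
  have hspec : ∀ s ∈ quasispectrum ℝ c, 0 ≤ s := quasispectrum_nonneg_of_nonneg c hc
  have hspecb : ∀ s ∈ quasispectrum ℝ b, 0 ≤ s := quasispectrum_nonneg_of_nonneg b hb
  set G : ℝ → ℝ := fun s => √(ramp (k + 2) (s / η)) with hG
  have hGc : Continuous G := by fun_prop
  have hG0 : G 0 = 0 := by simp [G, ramp_zero]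
  set g := cfcₙ G c with hg
  have hgs : IsSelfAdjoint g := IsSelfAdjoint.cfcₙ
  have hGG : ∀ s, G s * G s = ramp (k + 2) (s / η) := fun s =>
    Real.mul_self_sqrt (ramp_nonneg _ _)
  have hgg : g * g = cfcₙ (fun s => ramp (k + 2) (s / η)) c :=
    cfcn_mul_eq hGc.continuousOn hGc.continuousOn hG0 hG0 fun s _ => hGG s
  have hgg0 : 0 ≤ g * g := by nth_rw 1 [← hgs.star_eq]; exact star_mul_self_nonneg g
  have h1 : ((k + 2) * η) • (g * g) ≤ g * c * g := by
    rw [hgg, cfcn_mul_self_mul_eq (K := fun s => ramp (k + 2) (s / η) * s) hc hGc.continuousOn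
      hGc.continuousOn hG0 hG0 (fun s _ => by rw [← hGG]; ring),
      ← cfcₙ_const_mul _ _ c (by fun_prop) (by simp [ramp_zero])]
    refine cfcₙ_mono (fun s hs => ?_) (by fun_prop) (by fun_prop) (by simp [ramp_zero]) (by simp)
    rw [mul_comm]
    rcases le_total s ((k + 2) * η) with h | h
    · rw [ramp_eq_zero]
      · simp
      · push_cast; rwa [div_le_iff₀ hη]
    · exact mul_le_mul_of_nonneg_left h (ramp_nonneg _ _)
  -- β is the part of b above (k+1)η. Since g lives where c ≥ (k+2)η, the hypothesis leaves (η - ε)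
  -- g² ≤ gβg.
  set B : ℝ → ℝ := fun s => max 0 (s - (k + 1) * η) with hB
  have hk : (0 : ℝ) ≤ (k + 1) * η := by positivity
  have hB0 : B 0 = 0 := by simp [B, hk]
  have hBc : Continuous B := by fun_prop
  set β := cfcₙ B b with hβ
  set m := cfcₙ (fun s => s - B s) b with hm
  have hmβ : m = b - β := by
    rw [hm, cfcₙ_sub _ _ b (by fun_prop) rfl hBc.continuousOn hB0, cfcₙ_id' ℝ b]
  have hmn : ‖m‖ ≤ (k + 1) * η := by
    refine norm_cfcₙ_le fun s hs => ?_
    have := hspecb s hs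
    rw [Real.norm_eq_abs, abs_le]
    simp only [B]
    rcases le_total s ((k + 1) * η) with h | h
    · rw [max_eq_left (by linarith)]; constructor <;> linarith
    · rw [max_eq_right (by linarith)]; constructor <;> linarith
  have h2 : g * b * g ≤ ((k + 1) * η) • (g * g) + g * β * g := by
    have h3 := CStarAlgebra.star_left_conjugate_le_norm_smul (a := g) (b := m) IsSelfAdjoint.cfcₙ
    rw [hgs.star_eq] at h3
    have h4 : ‖m‖ • (g * g) ≤ ((k + 1) * η) • (g * g) := smul_le_smul_of_nonneg_right hmn hgg0
    have h5 : g * b * g = g * m * g + g * β * g := by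
      rw [hmβ]; simp only [mul_sub, sub_mul, sub_add_cancel]
    rw [h5]
    exact add_le_add_left (h3.trans h4) _
  have h6 : (η - ε) • (g * g) ≤ g * β * g := by
    have h7 := h1.trans ((H g hgs).trans (add_le_add_left h2 _))
    rw [← sub_nonneg] at h7 ⊢
    convert h7 using 1
    module
  have hβ0 : 0 ≤ β := cfcₙ_nonneg fun s _ => le_max_left _ _
  set r := cfcₙ (fun s => √(B s)) b with hr
  have hrr : r * r = β := cfcn_mul_eq (by fun_prop) (by fun_prop) (by simp [hB0]) (by simp [hB0])
    fun s _ => Real.mul_self_sqrt (le_max_left _ _)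
  have hrs : star r = r := IsSelfAdjoint.cfcₙ
  have hd : 0 < η - ε := sub_pos.2 hεη
  set y := (√(η - ε))⁻¹ • (r * g) with hy
  have hyy : g * g ≤ star y * y := by
    have : star y * y = (η - ε)⁻¹ • (g * β * g) := by
      rw [hy, star_smul, star_mul, hrs, hgs.star_eq, smul_mul_smul_comm, ← hrr]
      congr 1
      · rw [star_trivial, ← mul_inv, Real.mul_self_sqrt hd.le]
      · simp only [mul_assoc]
    rw [this]
    have := smul_le_smul_of_nonneg_left h6 (inv_nonneg.2 hd.le)
    rwa [smul_smul, inv_mul_cancel₀ hd.ne', one_smul] at this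
  set l := cfcₙ (fun s => √(ramp k (s / η))) b with hl
  have hll : l * l = cfcₙ (fun s => ramp k (s / η)) b :=
    cfcn_mul_eq (by fun_prop) (by fun_prop) (by simp [ramp_zero]) (by simp [ramp_zero])
      fun s _ => Real.mul_self_sqrt (ramp_nonneg _ _)
  -- `ramp k` is already 1 from (k+1)η on, which is where β begins.
  have hlr : l * r = r := by
    refine cfcn_mul_eq (by fun_prop) (by fun_prop) (by simp [ramp_zero]) (by simp [hB0])
      fun s _ => ?_
    rcases le_total s ((k + 1) * η) with h | h
    · have : B s = 0 := max_eq_left (by linarith)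
      simp [this]
    · rw [ramp_eq_one (by rwa [le_div_iff₀ hη])]
      simp
  have hly : l * y = y := by rw [hy, mul_smul_comm, ← mul_assoc, hlr]
  have := ht.le_of_le_star_mul_self hgg0 hyy IsSelfAdjoint.cfcₙ hly
  rw [← hgg, ← hll]
  refine this.trans ?_
  have hn : ‖g * g‖ ≤ 1 := by
    rw [hgg]
    refine norm_cfcₙ_le fun s _ => ?_
    rw [Real.norm_eq_abs, abs_of_nonneg (ramp_nonneg _ _)]
    exact ramp_le_one _ _
  have hl0 : 0 ≤ t (l * l) := ht.nonneg _ (by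
    rw [hll]; exact cfcₙ_nonneg fun s _ => ramp_nonneg _ _)
  nlinarith

theorem IsPosQuasitrace.cfcn_sum_range (ht : IsPosQuasitrace t) (a : A) (F : ℕ → ℝ → ℝ)
    (hF : ∀ k, Continuous (F k)) (hF0 : ∀ k, F k 0 = 0) (hFn : ∀ k s, 0 ≤ F k s) (N : ℕ) :
    t (cfcₙ (fun s => ∑ k ∈ Finset.range N, F k s) a) =
      ∑ k ∈ Finset.range N, t (cfcₙ (F k) a) := by
  induction N with
  | zero => simp [ht.map_zero, cfcₙ_const_zero]
  | succ N ih =>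
    simp_rw [Finset.sum_range_succ]
    rw [cfcₙ_add _ _ a (by fun_prop) (by simp [hF0]) (hF N).continuousOn (hF0 N), ht.add, ih]
    · exact cfcₙ_nonneg fun s _ => Finset.sum_nonneg fun k _ => hFn k s
    · exact cfcₙ_nonneg fun s _ => hFn N s
    · exact cfcₙ_commute_cfcₙ _ _ _

/-- Layer-cake decomposition of a into commuting slices of height η. -/
theorem IsPosQuasitrace.eq_sum_ramp (ht : IsPosQuasitrace t) {a : A} (ha : 0 ≤ a) {η : ℝ}
    (hη : 0 < η) {N : ℕ} (hN : ‖a‖ ≤ N * η) :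
    t a = η * ∑ k ∈ Finset.range N, t (cfcₙ (fun s => ramp k (s / η)) a) := by
  rw [← ht.cfcn_sum_range a (fun k s => ramp k (s / η)) (fun k => by fun_prop)
    (fun k => by simp [ramp_zero]) (fun k s => ramp_nonneg _ _), ← ht.smul _ _ hη.le]
  · congr 1
    rw [← cfcₙ_const_mul _ _ a (by fun_prop) (by simp [ramp_zero])]
    conv_lhs => rw [← cfcₙ_id ℝ a]
    refine cfcₙ_congr fun s hs => ?_
    have h0 : 0 ≤ s := quasispectrum_nonneg_of_nonneg a ha s hs
    have h1 : s ≤ ‖a‖ := (le_abs_self s).trans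
      (NonUnitalIsometricContinuousFunctionalCalculus.norm_quasispectrum_le a hs)
    simp only [id]
    rw [sum_ramp _ (by positivity), min_eq_left, mul_div_cancel₀ _ hη.ne']
    rw [div_le_iff₀ hη]
    linarith
  · exact cfcₙ_nonneg fun s _ => Finset.sum_nonneg fun k _ => ramp_nonneg _ _

theorem IsPosQuasitrace.le_add_of_conjugate_le (ht : IsPosQuasitrace t) {b c : A} (hb : 0 ≤ b)
    (hc : 0 ≤ c) {ε : ℝ} (hε : 0 ≤ ε)
    (H : ∀ g : A, IsSelfAdjoint g → g * c * g ≤ g * b * g + ε • (g * g)) :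
    t c ≤ t b + 2 * ε := by
  refine le_of_forall_pos_le_add fun δ hδ => ?_
  -- Slices slightly thicker than ε. The two lowest slices of c have no counterpart in b and cost at
  -- most η each, in total 2ε + δ.
  set η := ε + δ / 2
  have hη : 0 < η := by positivity
  have hεη : ε < η := by simp [η, hδ]
  obtain ⟨N, hN⟩ := exists_nat_ge ((‖b‖ + ‖c‖) / η)
  rw [div_le_iff₀ hη] at hN
  have hNb : ‖b‖ ≤ N * η := by linarith [norm_nonneg c]
  have hNc : ‖c‖ ≤ (N + 2 : ℕ) * η := by push_cast; linarith [norm_nonneg b]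
  have hle : ∀ k, t (cfcₙ (fun s => ramp k (s / η)) c) ≤ 1 := fun k => by
    refine (ht.le_norm _ (cfcₙ_nonneg fun s _ => ramp_nonneg _ _)).trans
      (norm_cfcₙ_le fun s _ => ?_)
    rw [Real.norm_eq_abs, abs_of_nonneg (ramp_nonneg _ _)]
    exact ramp_le_one _ _
  have h1 := ht.eq_sum_ramp hc hη hNc
  rw [Finset.sum_range_succ', Finset.sum_range_succ'] at h1
  have h2 := ht.eq_sum_ramp hb hη hNb
  have h3 : ∑ k ∈ Finset.range N, t (cfcₙ (fun s => ramp (k + 1 + 1) (s / η)) c) ≤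
      ∑ k ∈ Finset.range N, t (cfcₙ (fun s => ramp k (s / η)) b) :=
    Finset.sum_le_sum fun k _ => ht.ramp_le_ramp hb hc hη hεη H k
  have h4 := hle 0
  have h5 := hle (0 + 1)
  rw [h1, h2]
  have : 2 * ε + δ = 2 * η := by simp only [η]; ring
  nlinarith

theorem IsPosQuasitrace.mono (ht : IsPosQuasitrace t) {b c : A} (hc : 0 ≤ c) (h : c ≤ b) :
    t c ≤ t b := by
  simpa using ht.le_add_of_conjugate_le (hc.trans h) hc le_rfl fun g hg => by
    simpa [hg.star_eq] using star_left_conjugate_le_conjugate h g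

/-- Quasitraces are Lipschitz continuous on the positive cone. -/
theorem IsPosQuasitrace.abs_sub_le (ht : IsPosQuasitrace t) {b c : A} (hb : 0 ≤ b) (hc : 0 ≤ c) :
    |t c - t b| ≤ 2 * ‖c - b‖ := by
  have key : ∀ b c : A, 0 ≤ b → 0 ≤ c → t c ≤ t b + 2 * ‖c - b‖ := fun b c hb hc =>
    ht.le_add_of_conjugate_le hb hc (norm_nonneg _) fun g hg => by
      have := CStarAlgebra.star_left_conjugate_le_norm_smul (a := g) (b := c - b)
        (hc.isSelfAdjoint.sub hb.isSelfAdjoint)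
      rw [hg.star_eq, mul_sub, sub_mul, sub_le_iff_le_add'] at this
      exact this
  rw [abs_le]
  have h1 := key b c hb hc
  have h2 := key c b hc hb
  rw [norm_sub_rev] at h2
  constructor <;> linarith

end Continuity

/-! ### Additivity on finite dimensional algebras -/

section FiniteDimensional

theorem spectrum_finite_of_finiteDimensional {K R : Type*} [Field K] [Ring R] [Algebra K R]
    [FiniteDimensional K R] (a : R) : (spectrum K a).Finite := by
  rcases subsingleton_or_nontrivial R with h | h
  · simp [spectrum.of_subsingleton]
  have hp : minpoly K a ≠ 0 := minpoly.ne_zero (Algebra.IsIntegral.isIntegral a)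
  refine ((minpoly K a).rootSet_finite K).subset fun r hr => ?_
  have := spectrum.subset_polynomial_aeval a (minpoly K a) ⟨r, hr, rfl⟩
  rw [minpoly.aeval, spectrum.zero_eq, Set.mem_singleton_iff] at this
  rw [Polynomial.mem_rootSet]
  exact ⟨hp, by simpa using this⟩

theorem quasispectrum_finite_of_finiteDimensional {E : Type*} [NonUnitalCStarAlgebra E]
    [FiniteDimensional ℂ E] (a : E) : (quasispectrum ℝ a).Finite := by
  have : FiniteDimensional ℝ E := FiniteDimensional.complexToReal E
  rw [Unitization.quasispectrum_eq_spectrum_inr ℝ a]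
  have : FiniteDimensional ℝ (Unitization ℝ E) :=
    Module.Finite.equiv (Unitization.linearEquiv ℝ ℝ E).symm
  exact spectrum_finite_of_finiteDimensional _

theorem apply_sum_of_orthogonal {ι : Type*} {E : Type*} [NonUnitalCStarAlgebra E]
    [PartialOrder E] [StarOrderedRing E] {T : E → ℝ} (hT0 : T 0 = 0)
    (hadd : ∀ a b, 0 ≤ a → 0 ≤ b → a * b = 0 → T (a + b) = T a + T b)
    (s : Finset ι) (a : ι → E) (ha : ∀ i ∈ s, 0 ≤ a i)
    (horth : ∀ i ∈ s, ∀ j ∈ s, i ≠ j → a i * a j = 0) :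
    T (∑ i ∈ s, a i) = ∑ i ∈ s, T (a i) := by
  classical
  induction s using Finset.induction_on with
  | empty => simp [hT0]
  | insert i s hi ih =>
    rw [Finset.sum_insert hi, Finset.sum_insert hi, hadd, ih]
    · exact fun j hj => ha j (Finset.mem_insert_of_mem hj)
    · exact fun j hj k hk => horth j (Finset.mem_insert_of_mem hj) k (Finset.mem_insert_of_mem hk)
    · exact ha i (Finset.mem_insert_self _ _)
    · exact Finset.sum_nonneg fun j hj => ha j (Finset.mem_insert_of_mem hj)
    · rw [Finset.mul_sum]
      exact Finset.sum_eq_zero fun j hj => horth i (Finset.mem_insert_self _ _) j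
        (Finset.mem_insert_of_mem hj) (by rintro rfl; exact hi hj)

variable {E : Type*} [NonUnitalCStarAlgebra E]

/-- The spectral projection of `y` for an isolated nonzero point of the spectrum. -/
def spectralProj (y : E) (r : ℝ) : E := cfcₙ (fun s : ℝ => if s = r then 1 else 0) y

/-- A projection whose corner is one-dimensional. -/
structure IsMinProj (p : E) : Prop where
  isStarProjection : IsStarProjection p
  ne_zero : p ≠ 0
  corner : ∀ x : E, IsSelfAdjoint x → ∃ r : ℝ, p * x * p = r • p

/-- The coefficient `r` in `p x p = r p`. -/
def cornerCoeff (p x : E) : ℝ := by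
  classical exact if h : ∃ r : ℝ, p * x * p = r • p then h.choose else 0

theorem IsMinProj.corner_eq {p x : E} (hp : IsMinProj p) (hx : IsSelfAdjoint x) :
    p * x * p = cornerCoeff p x • p := by
  have h := hp.corner x hx
  rw [cornerCoeff, dif_pos h]
  exact h.choose_spec

theorem IsMinProj.coeff_eq {p x : E} (hp : IsMinProj p) (hx : IsSelfAdjoint x) {r : ℝ}
    (h : p * x * p = r • p) : cornerCoeff p x = r := by
  rw [hp.corner_eq hx] at h
  exact smul_left_injective ℝ hp.ne_zero h

theorem IsMinProj.coeff_add {p x y : E} (hp : IsMinProj p) (hx : IsSelfAdjoint x)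
    (hy : IsSelfAdjoint y) : cornerCoeff p (x + y) = cornerCoeff p x + cornerCoeff p y := by
  apply hp.coeff_eq (hx.add hy)
  rw [mul_add, add_mul, hp.corner_eq hx, hp.corner_eq hy, add_smul]

theorem IsMinProj.coeff_smul {p x : E} (hp : IsMinProj p) (hx : IsSelfAdjoint x) (c : ℝ) :
    cornerCoeff p (c • x) = c * cornerCoeff p x := by
  apply hp.coeff_eq ((IsSelfAdjoint.all c).smul hx)
  rw [mul_smul_comm, smul_mul_assoc, hp.corner_eq hx, smul_smul]

/-- If pq ≠ 0, the product pqpq is a multiple of pq with either coefficient, depending on the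
bracketing. -/
theorem IsMinProj.coeff_comm {p q : E} (hp : IsMinProj p) (hq : IsMinProj q) :
    cornerCoeff p q = cornerCoeff q p := by
  have h1 := hp.corner_eq hq.isStarProjection.isSelfAdjoint
  have h2 := hq.corner_eq hp.isStarProjection.isSelfAdjoint
  by_cases h : p * q = 0
  · have h' : q * p = 0 := by
      have := congrArg star h
      rwa [star_mul, star_zero, hp.isStarProjection.isSelfAdjoint.star_eq,
        hq.isStarProjection.isSelfAdjoint.star_eq] at this
    rw [hp.coeff_eq (r := 0) hq.isStarProjection.isSelfAdjoint (by simp [h]),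
      hq.coeff_eq (r := 0) hp.isStarProjection.isSelfAdjoint (by simp [h'])]
  · have h3 : p * q * p * q = cornerCoeff p q • (p * q) := by rw [h1, smul_mul_assoc]
    have h4 : p * q * p * q = cornerCoeff q p • (p * q) := by
      rw [mul_assoc p q p, mul_assoc p, h2, mul_smul_comm]
    exact smul_left_injective ℝ h (h3.symm.trans h4)

/-- The corner `f E f`. -/
def cornerSubmodule (f : E) : Submodule ℂ E :=
  LinearMap.range ((LinearMap.mulLeft ℂ f).comp (LinearMap.mulRight ℂ f))

theorem mem_cornerSubmodule {f x : E} : x ∈ cornerSubmodule f ↔ ∃ y, f * (y * f) = x := by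
  simp [cornerSubmodule]

variable [FiniteDimensional ℂ E]

theorem continuousOn_quasispectrum (f : ℝ → ℝ) (y : E) : ContinuousOn f (quasispectrum ℝ y) :=
  (quasispectrum_finite_of_finiteDimensional y).continuousOn f

theorem spectralProj_isStarProjection (y : E) {r : ℝ} (hr : r ≠ 0) :
    IsStarProjection (spectralProj y r) where
  isIdempotentElem := cfcn_mul_eq (continuousOn_quasispectrum _ y)
    (continuousOn_quasispectrum _ y) (by simp [hr.symm]) (by simp [hr.symm]) (by simp)
  isSelfAdjoint := IsSelfAdjoint.cfcₙ

theorem spectralProj_mul_spectralProj (y : E) {r s : ℝ} (hr : r ≠ 0) (hs : s ≠ 0) (hrs : r ≠ s) :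
    spectralProj y r * spectralProj y s = 0 := by
  rw [spectralProj, spectralProj, cfcn_mul_eq (K := fun _ => 0) (continuousOn_quasispectrum _ y)
    (continuousOn_quasispectrum _ y) (by simp [hr.symm]) (by simp [hs.symm]), cfcₙ_const_zero]
  intro u _
  by_cases h : u = r <;> simp [h, hrs]

theorem mul_spectralProj {y : E} (hy : IsSelfAdjoint y) {r : ℝ} (hr : r ≠ 0) :
    y * spectralProj y r = r • spectralProj y r := by
  have hc := continuousOn_quasispectrum (fun s : ℝ => if s = r then (1 : ℝ) else 0) y
  rw [spectralProj, ← cfcₙ_const_mul _ _ y hc (by simp [hr.symm])]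
  conv_lhs => enter [1]; rw [← cfcₙ_id ℝ y]
  refine cfcn_mul_eq continuousOn_id hc rfl (by simp [hr.symm]) fun s _ => ?_
  by_cases h : s = r <;> simp [h]

theorem eq_sum_spectralProj {y : E} (hy : IsSelfAdjoint y) :
    y = ∑ r ∈ (quasispectrum_finite_of_finiteDimensional y).toFinset.erase 0,
      r • spectralProj y r := by
  have h1 : ∀ r ∈ (quasispectrum_finite_of_finiteDimensional y).toFinset.erase 0,
      r • spectralProj y r = cfcₙ (fun s : ℝ => r * if s = r then 1 else 0) y := fun r hr => by
    rw [spectralProj, cfcₙ_const_mul _ _ y (continuousOn_quasispectrum _ y)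
      (by simp [(Finset.ne_of_mem_erase hr).symm])]
  rw [Finset.sum_congr rfl h1, ← cfcₙ_sum _ y _ (fun _ _ => continuousOn_quasispectrum _ y)
    (fun r hr => by simp [(Finset.ne_of_mem_erase hr).symm])]
  · conv_lhs => rw [← cfcₙ_id ℝ y]
    refine cfcₙ_congr fun s hs => ?_
    simp only [id, Finset.sum_apply, mul_ite, mul_one, mul_zero]
    rw [Finset.sum_ite_eq]
    by_cases h : s = 0 <;> simp [h, hs]

theorem finrank_corner_lt {f g : E} (hf : IsStarProjection f) (hfg : f * g = g) (hgf : g * f = g)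
    (hne : g ≠ f) (hg : IsStarProjection g) : Module.finrank ℂ (cornerSubmodule g) <
      Module.finrank ℂ (cornerSubmodule f) := by
  apply Submodule.finrank_lt_finrank_of_lt
  refine lt_of_le_of_ne ?_ fun h => ?_
  · intro x hx
    obtain ⟨y, rfl⟩ := mem_cornerSubmodule.1 hx
    refine mem_cornerSubmodule.2 ⟨g * (y * g), ?_⟩
    calc f * (g * (y * g) * f) = f * g * y * (g * f) := by simp only [mul_assoc]
      _ = g * (y * g) := by rw [hfg, hgf, mul_assoc]
  · have : f ∈ cornerSubmodule g := by
      rw [h]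
      exact mem_cornerSubmodule.2 ⟨f, by rw [hf.isIdempotentElem.eq, hf.isIdempotentElem.eq]⟩
    obtain ⟨y, hy⟩ := mem_cornerSubmodule.1 this
    apply hne
    rw [← hgf, ← hy, ← mul_assoc g g, hg.isIdempotentElem.eq]

variable [PartialOrder E] [StarOrderedRing E]

/-- Induction on the dimension of the corner f E f: if some fxf is not a multiple of f, one of its
spectral projections splits f into two projections with strictly smaller corners. -/
theorem exists_list_isMinProj {T : E → ℝ} (hT0 : T 0 = 0)
    (hadd : ∀ a b, 0 ≤ a → 0 ≤ b → a * b = 0 → T (a + b) = T a + T b)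
    (n : ℕ) (f : E) (hf : IsStarProjection f) (hn : Module.finrank ℂ (cornerSubmodule f) = n) :
    ∃ l : List E, (∀ p ∈ l, IsMinProj p) ∧ l.sum = f ∧ (l.map T).sum = T f := by
  induction n using Nat.strong_induction_on generalizing f with
  | _ n ih =>
  by_cases hf0 : f = 0
  · exact ⟨[], by simp, by simp [hf0], by simp [hf0, hT0]⟩
  by_cases hmin : ∀ x : E, IsSelfAdjoint x → ∃ r : ℝ, f * x * f = r • f
  · exact ⟨[f], by simpa using ⟨hf, hf0, hmin⟩, by simp, by simp⟩
  push Not at hmin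
  obtain ⟨x, hx, hne⟩ := hmin
  set y := f * x * f with hy
  have hys : IsSelfAdjoint y := by
    rw [IsSelfAdjoint, hy, star_mul, star_mul, hf.isSelfAdjoint.star_eq, hx.star_eq, mul_assoc]
  have hfy : f * y = y := by
    rw [hy, ← mul_assoc, ← mul_assoc, hf.isIdempotentElem.eq]
  obtain ⟨r, hr, h0, h1⟩ : ∃ r : ℝ, r ≠ 0 ∧ spectralProj y r ≠ 0 ∧ spectralProj y r ≠ f := by
    by_contra! hcon
    classical
    refine hne (∑ r ∈ (quasispectrum_finite_of_finiteDimensional y).toFinset.erase 0,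
      if spectralProj y r = 0 then 0 else r) ?_
    conv_lhs => rw [eq_sum_spectralProj hys]
    rw [Finset.sum_smul]
    refine Finset.sum_congr rfl fun r hr => ?_
    by_cases h : spectralProj y r = 0
    · simp [h]
    · rw [if_neg h, hcon r (Finset.ne_of_mem_erase hr) h]
  set g := spectralProj y r with hg
  have hgp : IsStarProjection g := spectralProj_isStarProjection y hr
  have hfg : f * g = g := by
    have : g = r⁻¹ • (y * g) := by
      rw [mul_spectralProj hys hr, smul_smul, inv_mul_cancel₀ hr, one_smul]
    rw [this, mul_smul_comm, ← mul_assoc, hfy]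
  have hgf : g * f = g := by
    have := congrArg star hfg
    rwa [star_mul, hf.isSelfAdjoint.star_eq, hgp.isSelfAdjoint.star_eq] at this
  have hkp : IsStarProjection (f - g) :=
    ⟨by rw [IsIdempotentElem, sub_mul, mul_sub, mul_sub, hf.isIdempotentElem.eq, hfg, hgf,
      hgp.isIdempotentElem.eq, sub_self, sub_zero], hf.isSelfAdjoint.sub hgp.isSelfAdjoint⟩
  have hlt1 := finrank_corner_lt hf hfg hgf h1 hgp
  have hlt2 := finrank_corner_lt (g := f - g) hf
    (by rw [mul_sub, hf.isIdempotentElem.eq, hfg]) (by rw [sub_mul, hf.isIdempotentElem.eq, hgf])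
    (by simpa using h0) hkp
  obtain ⟨l₁, hl₁, hs₁, ht₁⟩ := ih _ (hn ▸ hlt1) g hgp rfl
  obtain ⟨l₂, hl₂, hs₂, ht₂⟩ := ih _ (hn ▸ hlt2) (f - g) hkp rfl
  refine ⟨l₁ ++ l₂, ?_, ?_, ?_⟩
  · intro p hp
    rcases List.mem_append.1 hp with h | h
    exacts [hl₁ p h, hl₂ p h]
  · rw [List.sum_append, hs₁, hs₂, add_sub_cancel]
  · rw [List.map_append, List.sum_append, ht₁, ht₂, ← hadd _ _ hgp.nonneg hkp.nonneg,
      add_sub_cancel]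
    rw [mul_sub, hgf, hgp.isIdempotentElem.eq, sub_self]

/-- The unit ball is compact, so an approximate unit has a cluster point. -/
theorem exists_unit_of_finiteDimensional : ∃ e : E, ∀ x : E, e * x = x := by
  have : ProperSpace E := FiniteDimensional.proper ℂ E
  have hl := CStarAlgebra.increasingApproximateUnit E
  obtain ⟨e, -, he⟩ := (isCompact_closedBall (0 : E) 1).exists_clusterPt
    (Filter.le_principal_iff.2 hl.closedBall_mem)
  refine ⟨e, fun x => ?_⟩
  have h1 : MapClusterPt (e * x) (CStarAlgebra.approximateUnit E) (· * x) :=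
    MapClusterPt.continuousAt_comp (u := id) (F := CStarAlgebra.approximateUnit E)
      (f := (· * x)) (by fun_prop) (by simpa [MapClusterPt] using he)
  have h2 : Filter.Tendsto (· * x) (CStarAlgebra.approximateUnit E) (𝓝 x) := hl.tendsto_mul_right x
  by_contra hne
  exact (ClusterPt.mono h1 h2).ne (disjoint_nhds_nhds.2 hne).eq_bot

theorem exists_isStarProjection_unit :
    ∃ e : E, IsStarProjection e ∧ ∀ x : E, e * x = x := by
  obtain ⟨e, he⟩ := exists_unit_of_finiteDimensional (E := E)
  have hs : star e = e := by
    have h1 : star (e * star e) = star (star e) := by rw [he]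
    rw [star_mul, star_star, he] at h1
    exact h1
  exact ⟨e, ⟨he e, hs⟩, he⟩

/-- A tracial function on a finite dimensional C⋆-algebra that is additive on orthogonal positive
elements is additive on positive elements. -/
theorem add_of_finiteDimensional {T : E → ℝ}
    (htr : ∀ x, T (star x * x) = T (x * star x))
    (hadd : ∀ a b, 0 ≤ a → 0 ≤ b → a * b = 0 → T (a + b) = T a + T b)
    (hsmul : ∀ (r : ℝ) (a : E), 0 ≤ r → 0 ≤ a → T (r • a) = r * T a)
    {a b : E} (ha : 0 ≤ a) (hb : 0 ≤ b) : T (a + b) = T a + T b := by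
  have hT0 : T 0 = 0 := by simpa using hsmul 0 0 le_rfl le_rfl
  obtain ⟨e, hep, he⟩ := exists_isStarProjection_unit (E := E)
  obtain ⟨l, hl, hle, -⟩ := exists_list_isMinProj hT0 hadd _ e hep rfl
  -- The linear candidate: T weighted over a decomposition of the unit into minimal projections. The
  -- rest shows T = L on minimal projections, then on projections, then on positive elements.
  let L : E → ℝ := fun x => (l.map fun p => T p * cornerCoeff p x).sum
  have hLadd : ∀ x y, IsSelfAdjoint x → IsSelfAdjoint y → L (x + y) = L x + L y := by
    intro x y hx hy
    simp only [L]
    rw [← List.sum_map_add]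
    congr 1
    refine List.map_congr_left fun p hp => ?_
    rw [(hl p hp).coeff_add hx hy, mul_add]
  have hLsmul : ∀ (r : ℝ) x, IsSelfAdjoint x → L (r • x) = r * L x := by
    intro r x hx
    simp only [L]
    rw [← List.sum_map_mul_left]
    congr 1
    refine List.map_congr_left fun p hp => ?_
    rw [(hl p hp).coeff_smul hx, mul_left_comm]
  have hL0 : L 0 = 0 := by simpa using hLsmul 0 0 (IsSelfAdjoint.zero E)
  have hLmin : ∀ q, IsMinProj q → T q = L q := by
    intro q hq
    have hqs := hq.isStarProjection.isSelfAdjoint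
    -- Minimal projections with pq ≠ 0 are equivalent up to scaling through qp, so T p = T q.
    -- Summing over l gives L q = T q, because the coefficients at q of the p in l add up to that of
    -- the unit, which is 1.
    have h1 : ∀ p ∈ l, T p * cornerCoeff p q = T q * cornerCoeff q p := by
      intro p hp
      have hpm := hl p hp
      have hps := hpm.isStarProjection.isSelfAdjoint
      rw [← hpm.coeff_comm hq]
      by_cases h0 : cornerCoeff p q = 0
      · simp [h0]
      congr 1
      have e1 : star (q * p) * (q * p) = cornerCoeff p q • p := by
        rw [star_mul, hps.star_eq, hqs.star_eq, ← hpm.corner_eq hqs]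
        rw [mul_assoc p q, ← mul_assoc q q, hq.isStarProjection.isIdempotentElem.eq, mul_assoc]
      have e2 : (q * p) * star (q * p) = cornerCoeff p q • q := by
        rw [star_mul, hps.star_eq, hqs.star_eq, hpm.coeff_comm hq, ← hq.corner_eq hps]
        rw [mul_assoc q p, ← mul_assoc p p, hpm.isStarProjection.isIdempotentElem.eq, mul_assoc]
      have hpos : 0 ≤ cornerCoeff p q := by
        by_contra hneg
        push Not at hneg
        have h2 : 0 ≤ cornerCoeff p q • p := e1 ▸ star_mul_self_nonneg _
        have h3 : cornerCoeff p q • p ≤ 0 :=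
          smul_nonpos_of_nonpos_of_nonneg hneg.le hpm.isStarProjection.nonneg
        exact (smul_ne_zero h0 hpm.ne_zero) (le_antisymm h3 h2)
      have h4 := htr (q * p)
      rw [e1, e2, hsmul _ _ hpos hpm.isStarProjection.nonneg,
        hsmul _ _ hpos hq.isStarProjection.nonneg] at h4
      exact mul_left_cancel₀ h0 h4
    have h2 : cornerCoeff q e = 1 := by
      apply hq.coeff_eq hep.isSelfAdjoint
      rw [mul_assoc, he, hq.isStarProjection.isIdempotentElem.eq, one_smul]
    have h3 : ∀ l' : List E, (∀ p ∈ l', IsMinProj p) → IsSelfAdjoint l'.sum ∧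
        cornerCoeff q l'.sum = (l'.map (cornerCoeff q)).sum := by
      intro l' hl'
      induction l' with
      | nil =>
        refine ⟨by simp, ?_⟩
        rw [List.sum_nil, List.map_nil, List.sum_nil]
        exact hq.coeff_eq (IsSelfAdjoint.zero E) (by simp)
      | cons p l' ih =>
        obtain ⟨i1, i2⟩ := ih fun x hx => hl' x (List.mem_cons_of_mem _ hx)
        have hp := (hl' p List.mem_cons_self).isStarProjection.isSelfAdjoint
        rw [List.sum_cons, List.map_cons, List.sum_cons, ← i2]
        exact ⟨hp.add i1, hq.coeff_add hp i1⟩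
    have h4 := (h3 l hl).2
    rw [hle, h2] at h4
    simp only [L]
    rw [List.map_congr_left h1, List.sum_map_mul_left, ← h4, mul_one]
  have hLproj : ∀ f, IsStarProjection f → T f = L f := by
    intro f hf
    obtain ⟨l', hl', hs, ht⟩ := exists_list_isMinProj hT0 hadd _ f hf rfl
    have : ∀ l' : List E, (∀ p ∈ l', IsMinProj p) → IsSelfAdjoint l'.sum ∧
        L l'.sum = (l'.map T).sum := by
      intro l' hl'
      induction l' with
      | nil => simp [hL0]
      | cons p l' ih =>
        obtain ⟨i1, i2⟩ := ih fun x hx => hl' x (List.mem_cons_of_mem _ hx)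
        have hp := hl' p List.mem_cons_self
        rw [List.sum_cons, List.map_cons, List.sum_cons, ← i2, hLmin p hp]
        exact ⟨hp.isStarProjection.isSelfAdjoint.add i1,
          hLadd _ _ hp.isStarProjection.isSelfAdjoint i1⟩
    rw [← ht, ← hs, (this l' hl').2]
  have hLpos : ∀ x, 0 ≤ x → T x = L x := by
    intro x hx
    have hx' := eq_sum_spectralProj hx.isSelfAdjoint
    set S := (quasispectrum_finite_of_finiteDimensional x).toFinset.erase 0 with hS
    have hS0 : ∀ r ∈ S, r ≠ 0 := fun r hr => Finset.ne_of_mem_erase hr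
    have hSpos : ∀ r ∈ S, 0 ≤ r := fun r hr =>
      quasispectrum_nonneg_of_nonneg x hx r (by simpa using Finset.mem_of_mem_erase hr)
    have hP : ∀ r ∈ S, IsStarProjection (spectralProj x r) := fun r hr =>
      spectralProj_isStarProjection x (hS0 r hr)
    have hLsum : ∀ S' ⊆ S, IsSelfAdjoint (∑ r ∈ S', r • spectralProj x r) ∧
        L (∑ r ∈ S', r • spectralProj x r) = ∑ r ∈ S', r * T (spectralProj x r) := by
      intro S' hS'
      induction S' using Finset.induction_on with
      | empty => simp [hL0]
      | insert i s hi ih =>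
        obtain ⟨i1, i2⟩ := ih fun j hj => hS' (Finset.mem_insert_of_mem hj)
        have hPi := hP i (hS' (Finset.mem_insert_self _ _))
        have hsi : IsSelfAdjoint (i • spectralProj x i) :=
          (IsSelfAdjoint.all i).smul hPi.isSelfAdjoint
        rw [Finset.sum_insert hi, Finset.sum_insert hi, hLadd _ _ hsi i1, i2,
          hLsmul _ _ hPi.isSelfAdjoint, hLproj _ hPi]
        exact ⟨hsi.add i1, rfl⟩
    rw [hx', (hLsum S subset_rfl).2, apply_sum_of_orthogonal hT0 hadd]
    · exact Finset.sum_congr rfl fun r hr => hsmul _ _ (hSpos r hr) (hP r hr).nonneg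
    · exact fun r hr => smul_nonneg (hSpos r hr) (hP r hr).nonneg
    · intro r hr s hs hrs
      rw [smul_mul_smul_comm, spectralProj_mul_spectralProj x (hS0 r hr) (hS0 s hs) hrs, smul_zero]
  rw [hLpos _ ha, hLpos _ hb, hLpos _ (add_nonneg ha hb),
    hLadd _ _ ha.isSelfAdjoint hb.isSelfAdjoint]

end FiniteDimensional

/-! ### Central multipliers -/

section CentralContraction

variable {B : Type*} [NonUnitalCStarAlgebra B]

/-- Multiplication by a central multiplier between `0` and `1`. -/
structure IsCentralContraction (m : B →ₗ[ℝ] B) : Prop where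
  mul_left : ∀ x y, m (x * y) = m x * y
  mul_right : ∀ x y, m (x * y) = x * m y
  sq : ∃ r : B → B, ∀ x, m (star x * x) = star (r x) * r x ∧ m (x * star x) = r x * star (r x)
  sq_compl : ∃ r : B → B, ∀ x, star x * x - m (star x * x) = star (r x) * r x ∧
    x * star x - m (x * star x) = r x * star (r x)

variable {m : B →ₗ[ℝ] B}

theorem IsCentralContraction.compl (hm : IsCentralContraction m) :
    IsCentralContraction (LinearMap.id - m) where
  mul_left x y := by simp [sub_mul, hm.mul_left]
  mul_right x y := by simp [mul_sub, hm.mul_right]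
  sq := hm.sq_compl
  sq_compl := by simpa using hm.sq

theorem IsCentralContraction.commute (hm : IsCentralContraction m) {x y : B} (h : Commute x y) :
    Commute (m x) (m y) := by
  rw [commute_iff_eq, ← hm.mul_left, ← hm.mul_left, ← hm.mul_right, ← hm.mul_right, h.eq]

theorem IsCentralContraction.commute_self (hm : IsCentralContraction m) {x y : B}
    (h : Commute x y) : Commute (m x) y := by
  rw [commute_iff_eq, ← hm.mul_left, ← hm.mul_right, h.eq]

end CentralContraction

/-! ### Extreme points of the compact convex set of contractive quasitraces -/

section Extreme

variable (B : Type*) [NonUnitalCStarAlgebra B] [PartialOrder B]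

/-- The contractive quasitraces, normalized to vanish off the positive cone. -/
def posQuasitraces : Set (B → ℝ) := {t | IsPosQuasitrace t ∧ ∀ x, ¬ 0 ≤ x → t x = 0}

theorem convex_posQuasitraces : Convex ℝ (posQuasitraces B) := by
  rintro s ⟨hs, hs'⟩ t ⟨ht, ht'⟩ a b ha hb hab
  refine ⟨⟨fun x hx => ?_, fun x => ?_, fun x y hx hy hxy => ?_, fun r x hr hx => ?_,
    fun x hx => ?_⟩, fun x hx => ?_⟩ <;> simp only [Pi.add_apply, Pi.smul_apply, smul_eq_mul]
  · have := hs.nonneg x hx; have := ht.nonneg x hx; positivity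
  · rw [hs.tracial, ht.tracial]
  · rw [hs.add x y hx hy hxy, ht.add x y hx hy hxy]; ring
  · rw [hs.smul r x hr hx, ht.smul r x hr hx]; ring
  · have h1 := mul_le_mul_of_nonneg_left (hs.le_norm x hx) ha
    have h2 := mul_le_mul_of_nonneg_left (ht.le_norm x hx) hb
    calc a * s x + b * t x ≤ a * ‖x‖ + b * ‖x‖ := add_le_add h1 h2
      _ = ‖x‖ := by rw [← add_mul, hab, one_mul]
  · rw [hs' x hx, ht' x hx]; simp

theorem isCompact_posQuasitraces : IsCompact (posQuasitraces B) := by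
  have hsub : posQuasitraces B ⊆ Set.univ.pi fun x : B => Set.Icc 0 ‖x‖ := by
    rintro t ⟨ht, ht'⟩ x -
    by_cases hx : 0 ≤ x
    · exact ⟨ht.nonneg x hx, ht.le_norm x hx⟩
    · rw [ht' x hx]; exact ⟨le_rfl, norm_nonneg x⟩
  refine (isCompact_univ_pi fun x => isCompact_Icc).of_isClosed_subset ?_ hsub
  have : posQuasitraces B = {t | ∀ a, 0 ≤ a → 0 ≤ t a} ∩
      {t | ∀ x, t (star x * x) = t (x * star x)} ∩
      {t | ∀ a b, 0 ≤ a → 0 ≤ b → Commute a b → t (a + b) = t a + t b} ∩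
      {t | ∀ (r : ℝ) (a : B), 0 ≤ r → 0 ≤ a → t (r • a) = r * t a} ∩
      {t | ∀ a, 0 ≤ a → t a ≤ ‖a‖} ∩ {t | ∀ x, ¬ 0 ≤ x → t x = 0} := by
    ext t
    exact ⟨fun ⟨h, h'⟩ => ⟨⟨⟨⟨⟨h.1, h.2⟩, h.3⟩, h.4⟩, h.5⟩, h'⟩,
      fun ⟨⟨⟨⟨⟨h1, h2⟩, h3⟩, h4⟩, h5⟩, h'⟩ => ⟨⟨h1, h2, h3, h4, h5⟩, h'⟩⟩
  rw [this]
  simp only [Set.ofPred_forall]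
  refine ((((IsClosed.inter ?_ ?_).inter ?_).inter ?_).inter ?_).inter ?_ <;>
    repeat' refine isClosed_iInter fun _ => ?_
  · exact isClosed_le continuous_const (continuous_apply _)
  · exact isClosed_eq (continuous_apply _) (continuous_apply _)
  · exact isClosed_eq (continuous_apply _) (by fun_prop)
  · exact isClosed_eq (continuous_apply _) (continuous_const.mul (continuous_apply _))
  · exact isClosed_le (continuous_apply _) continuous_const
  · exact isClosed_eq (continuous_apply _) continuous_const

variable {B} {m : B →ₗ[ℝ] B}

/-- The quasitrace `x ↦ t (m x)`. -/
def scaled (m : B →ₗ[ℝ] B) (t : B → ℝ) (x : B) : ℝ := by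
  classical exact if 0 ≤ x then t (m x) else 0

theorem scaled_of_nonneg {t : B → ℝ} {x : B} (hx : 0 ≤ x) : scaled m t x = t (m x) := if_pos hx

/-- The norm of a quasitrace. -/
def qnorm (t : B → ℝ) : ℝ := sSup {r | ∃ x, 0 ≤ x ∧ ‖x‖ ≤ 1 ∧ r = t x}

theorem IsPosQuasitrace.bddAbove {t : B → ℝ} (ht : IsPosQuasitrace t) :
    BddAbove {r | ∃ x, 0 ≤ x ∧ ‖x‖ ≤ 1 ∧ r = t x} := by
  refine ⟨1, ?_⟩
  rintro _ ⟨x, hx, hx1, rfl⟩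
  exact (ht.le_norm x hx).trans hx1

theorem IsPosQuasitrace.qnorm_nonneg {t : B → ℝ} (ht : IsPosQuasitrace t) : 0 ≤ qnorm t :=
  le_csSup ht.bddAbove ⟨0, le_rfl, by simp, ht.map_zero.symm⟩

variable [StarOrderedRing B]

theorem IsCentralContraction.nonneg (hm : IsCentralContraction m) {x : B} (hx : 0 ≤ x) :
    0 ≤ m x := by
  obtain ⟨y, rfl⟩ := CStarAlgebra.nonneg_iff_eq_star_mul_self.1 hx
  obtain ⟨r, hr⟩ := hm.sq
  rw [(hr y).1]
  exact star_mul_self_nonneg _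

theorem IsCentralContraction.le_self (hm : IsCentralContraction m) {x : B} (hx : 0 ≤ x) :
    m x ≤ x := by
  have := hm.compl.nonneg hx
  simpa using this

theorem scaled_mem (hm : IsCentralContraction m) {t : B → ℝ} (ht : t ∈ posQuasitraces B) :
    scaled m t ∈ posQuasitraces B := by
  obtain ⟨ht, -⟩ := ht
  refine ⟨⟨fun x hx => ?_, fun x => ?_, fun x y hx hy hxy => ?_, fun r x hr hx => ?_,
    fun x hx => ?_⟩, fun x hx => if_neg hx⟩
  · rw [scaled_of_nonneg hx]; exact ht.nonneg _ (hm.nonneg hx)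
  · rw [scaled_of_nonneg (star_mul_self_nonneg x), scaled_of_nonneg (mul_star_self_nonneg x)]
    obtain ⟨r, hr⟩ := hm.sq
    rw [(hr x).1, (hr x).2, ht.tracial]
  · rw [scaled_of_nonneg hx, scaled_of_nonneg hy, scaled_of_nonneg (add_nonneg hx hy), map_add,
      ht.add _ _ (hm.nonneg hx) (hm.nonneg hy) (hm.commute hxy)]
  · rw [scaled_of_nonneg hx, scaled_of_nonneg (smul_nonneg hr hx), map_smul,
      ht.smul _ _ hr (hm.nonneg hx)]
  · rw [scaled_of_nonneg hx]
    exact (ht.le_norm _ (hm.nonneg hx)).trans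
      (CStarAlgebra.norm_le_norm_of_nonneg_of_le (hm.nonneg hx) (hm.le_self hx))

theorem scaled_add_scaled_compl (hm : IsCentralContraction m) {t : B → ℝ}
    (ht : t ∈ posQuasitraces B) : scaled m t + scaled (LinearMap.id - m) t = t := by
  ext x
  by_cases hx : 0 ≤ x
  · rw [Pi.add_apply, scaled_of_nonneg hx, scaled_of_nonneg hx,
      ← ht.1.add _ _ (hm.nonneg hx) (hm.compl.nonneg hx)]
    · simp
    · have := hm.commute_self (Commute.refl x)
      simpa using this.sub_right (Commute.refl (m x))
  · simp [scaled, hx, ht.2 x hx]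

theorem mul_self_le_self {u : B} (hu : 0 ≤ u) (hu1 : ‖u‖ ≤ 1) : u * u ≤ u := by
  set w := cfcₙ Real.sqrt u
  have hw : w * w = u := cfcn_sqrt_mul_self hu
  have hws : star w = w := IsSelfAdjoint.cfcₙ
  have h1 := CStarAlgebra.star_left_conjugate_le_norm_smul (a := w) (b := u) hu.isSelfAdjoint
  rw [hws, hw] at h1
  have h2 : w * u * w = u * u := by
    nth_rw 1 [← hw]; rw [← mul_assoc, mul_assoc (w * w), hw]
  rw [h2] at h1
  refine h1.trans ?_
  simpa using smul_le_smul_of_nonneg_right hu1 hu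

/-- The conjugates uxu tend to x and lie below u² ≤ u; continuity and monotonicity of t finish. So
the norm of t is approached along the approximate unit. -/
theorem IsPosQuasitrace.eventually_le {t : B → ℝ} (ht : IsPosQuasitrace t) {x : B} (hx : 0 ≤ x)
    (hx1 : ‖x‖ ≤ 1) {ε : ℝ} (hε : 0 < ε) :
    ∀ᶠ u in CStarAlgebra.approximateUnit B, t x ≤ t u + ε := by
  have hl := CStarAlgebra.increasingApproximateUnit B
  have hlim : Filter.Tendsto (fun u => star u * x * u) (CStarAlgebra.approximateUnit B) (𝓝 x) := by
    have hbd : Filter.Tendsto (fun u => x * u - x) (CStarAlgebra.approximateUnit B) (𝓝 0) := by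
      simpa using (hl.tendsto_mul_left x).sub_const x
    have h2 : Filter.Tendsto (fun u => u * (x * u - x)) (CStarAlgebra.approximateUnit B)
        (𝓝 0) := by
      rw [tendsto_zero_iff_norm_tendsto_zero] at hbd ⊢
      refine squeeze_zero' (Filter.Eventually.of_forall fun _ => norm_nonneg _) ?_ hbd
      filter_upwards [hl.eventually_norm] with u hu
      exact (norm_mul_le _ _).trans (by nlinarith [norm_nonneg (x * u - x)])
    have h3 := h2.add (hl.tendsto_mul_right x)
    rw [zero_add] at h3
    refine h3.congr' ?_
    filter_upwards [hl.eventually_star_eq] with u hu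
    rw [hu, mul_sub, mul_assoc, sub_add_cancel]
  rw [Metric.tendsto_nhds] at hlim
  filter_upwards [hlim (ε / 2) (by positivity), hl.eventually_nonneg, hl.eventually_norm]
    with u hu hu0 hu1
  have h0 : 0 ≤ star u * x * u := star_left_conjugate_nonneg hx u
  have h1 := ht.abs_sub_le h0 hx
  rw [dist_eq_norm, norm_sub_rev] at hu
  have h2 : star u * x * u ≤ u := by
    refine (CStarAlgebra.star_left_conjugate_le_norm_smul hx.isSelfAdjoint).trans ?_
    rw [hu0.isSelfAdjoint.star_eq]
    refine le_trans ?_ (mul_self_le_self hu0 hu1)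
    have : 0 ≤ u * u := by
      nth_rw 1 [← hu0.isSelfAdjoint.star_eq]; exact star_mul_self_nonneg u
    simpa using smul_le_smul_of_nonneg_right hx1 this
  have h3 := ht.mono h0 h2
  have := le_abs_self (t x - t (star u * x * u))
  linarith

theorem IsPosQuasitrace.le_qnorm_mul {t : B → ℝ} (ht : IsPosQuasitrace t) {x : B} (hx : 0 ≤ x) :
    t x ≤ qnorm t * ‖x‖ := by
  rcases (norm_nonneg x).eq_or_lt with h | h
  · have : x = 0 := norm_eq_zero.1 h.symm
    simp [this, ht.map_zero]
  · have h1 : t (‖x‖⁻¹ • x) ≤ qnorm t := le_csSup ht.bddAbove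
      ⟨_, smul_nonneg (by positivity) hx, by rw [norm_smul]; simp [h.ne'], rfl⟩
    rw [ht.smul _ _ (by positivity) hx, inv_mul_le_iff₀ h] at h1
    linarith

/-- A single member u of the approximate unit nearly attains both norms, and (s + t)(u) ≤ 1. -/
theorem qnorm_add_le {s t : B → ℝ} (hs : IsPosQuasitrace s) (ht : IsPosQuasitrace t)
    (hst : IsPosQuasitrace (s + t)) : qnorm s + qnorm t ≤ 1 := by
  have key : ∀ x y : B, 0 ≤ x → ‖x‖ ≤ 1 → 0 ≤ y → ‖y‖ ≤ 1 → s x + t y ≤ 1 := by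
    intro x y hx hx1 hy hy1
    refine le_of_forall_pos_le_add fun ε hε => ?_
    have hl := CStarAlgebra.increasingApproximateUnit B
    obtain ⟨u, h1, h2, h3, h4⟩ := ((hs.eventually_le hx hx1 (half_pos hε)).and
      ((ht.eventually_le hy hy1 (half_pos hε)).and
        (hl.eventually_nonneg.and hl.eventually_norm))).exists
    have := (hst.le_norm u h3).trans h4
    rw [Pi.add_apply] at this
    linarith
  have h1 : ∀ y : B, 0 ≤ y → ‖y‖ ≤ 1 → qnorm s ≤ 1 - t y := fun y hy hy1 =>
    csSup_le ⟨_, 0, le_rfl, by simp, rfl⟩ (by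
      rintro _ ⟨x, hx, hx1, rfl⟩
      linarith [key x y hx hx1 hy hy1])
  have h2 : qnorm t ≤ 1 - qnorm s := csSup_le ⟨_, 0, le_rfl, by simp, rfl⟩ (by
      rintro _ ⟨x, hx, hx1, rfl⟩
      linarith [h1 x hx hx1])
  linarith

theorem smul_mem_posQuasitraces {t : B → ℝ} (ht : t ∈ posQuasitraces B) {c : ℝ} (hc : 0 < c)
    (hcn : qnorm t ≤ c) : c⁻¹ • t ∈ posQuasitraces B := by
  obtain ⟨ht, ht'⟩ := ht
  refine ⟨⟨fun x hx => ?_, fun x => ?_, fun x y hx hy hxy => ?_, fun r x hr hx => ?_,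
    fun x hx => ?_⟩, fun x hx => ?_⟩ <;> simp only [Pi.smul_apply, smul_eq_mul]
  · have := ht.nonneg x hx; positivity
  · rw [ht.tracial]
  · rw [ht.add x y hx hy hxy]; ring
  · rw [ht.smul r x hr hx]; ring
  · rw [inv_mul_le_iff₀ hc]
    exact (ht.le_qnorm_mul hx).trans (by gcongr)
  · rw [ht' x hx, mul_zero]

/-- Central multipliers act on an extreme quasitrace by scalars. -/
theorem exists_eq_mul_of_extreme {t : B → ℝ} (ht : t ∈ (posQuasitraces B).extremePoints ℝ)
    (hm : IsCentralContraction m) :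
    ∃ χ : ℝ, 0 ≤ χ ∧ χ ≤ 1 ∧ ∀ x, 0 ≤ x → t (m x) = χ * t x := by
  rw [mem_extremePoints_iff_left] at ht
  obtain ⟨htK, hext⟩ := ht
  have h1 := scaled_mem hm htK
  have h2 := scaled_mem hm.compl htK
  have h12 := scaled_add_scaled_compl hm htK
  have hsum := qnorm_add_le h1.1 h2.1 (by rw [h12]; exact htK.1)
  set α := qnorm (scaled m t) with hα
  set β := qnorm (scaled (LinearMap.id - m) t) with hβ
  have hα0 : 0 ≤ α := h1.1.qnorm_nonneg
  have hβ0 : 0 ≤ β := h2.1.qnorm_nonneg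
  rcases hα0.eq_or_lt with h | h
  · refine ⟨0, le_rfl, zero_le_one, fun x hx => ?_⟩
    have h3 := h1.1.le_qnorm_mul hx
    have h4 := h1.1.nonneg x hx
    rw [← hα, ← h, zero_mul, scaled_of_nonneg hx] at h3
    rw [scaled_of_nonneg hx] at h4
    linarith
  rcases lt_or_ge α 1 with h' | h'
  · have h3 : 0 < 1 - α := by linarith
    -- Normalizing x ↦ t(m x) and x ↦ t(x - m x) by α and 1 - α writes t as a proper convex
    -- combination of contractive quasitraces. Extremality identifies the first of these with t, so
    -- the scalar is α. In the boundary cases α = 0 and α ≥ 1 one of the two summands vanishes.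
    have := hext _ (smul_mem_posQuasitraces h1 h le_rfl) _
      (smul_mem_posQuasitraces h2 h3 (by linarith)) ⟨α, 1 - α, h, h3, by ring, by
        rw [smul_inv_smul₀ h.ne', smul_inv_smul₀ h3.ne', h12]⟩
    refine ⟨α, h.le, h'.le, fun x hx => ?_⟩
    have h4 := congrFun this x
    rw [Pi.smul_apply, scaled_of_nonneg hx, smul_eq_mul] at h4
    rw [← h4, mul_inv_cancel_left₀ h.ne']
  · refine ⟨1, zero_le_one, le_rfl, fun x hx => ?_⟩
    have h3 := h2.1.le_qnorm_mul hx
    have h4 := h2.1.nonneg x hx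
    have h5 : β = 0 := by linarith
    rw [← hβ, h5, zero_mul] at h3
    have h6 := congrFun h12 x
    rw [Pi.add_apply, scaled_of_nonneg hx] at h6
    linarith

end Extreme

/-! ### Localizing extreme quasitraces over the interval -/

section Loop

variable {F₁ F₂ : Type*} [NonUnitalCStarAlgebra F₁] [NonUnitalCStarAlgebra F₂]

/-- The action of a function on the interval, with equal values at the end points, on
`C([0,1], F₂) ⊕ F₁`. -/
def actBy (k : C(unitInterval, ℝ)) (p : C(unitInterval, F₂) × F₁) : C(unitInterval, F₂) × F₁ :=
  (k • p.1, k 0 • p.2)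

/-- A `[0,1]`-valued function on the interval with equal values at the end points. -/
structure IsUnitLoop (k : C(unitInterval, ℝ)) : Prop where
  nonneg : ∀ s, 0 ≤ k s
  le_one : ∀ s, k s ≤ 1
  closed : k 0 = k 1

theorem actBy_add (k : C(unitInterval, ℝ)) (p q : C(unitInterval, F₂) × F₁) :
    actBy k (p + q) = actBy k p + actBy k q := by
  simp [actBy]

theorem actBy_smul (k : C(unitInterval, ℝ)) (r : ℝ) (p : C(unitInterval, F₂) × F₁) :
    actBy k (r • p) = r • actBy k p := by
  refine Prod.ext (ContinuousMap.ext fun s => ?_) ?_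
  · exact smul_comm (k s) r (p.1 s)
  · exact smul_comm (k 0) r p.2

theorem actBy_mul_left (k : C(unitInterval, ℝ)) (p q : C(unitInterval, F₂) × F₁) :
    actBy k (p * q) = actBy k p * q := by
  refine Prod.ext (ContinuousMap.ext fun s => ?_) ?_ <;> simp [actBy, smul_mul_assoc]

theorem actBy_mul_right (k : C(unitInterval, ℝ)) (p q : C(unitInterval, F₂) × F₁) :
    actBy k (p * q) = p * actBy k q := by
  refine Prod.ext (ContinuousMap.ext fun s => ?_) ?_ <;> simp [actBy, mul_smul_comm]

theorem actBy_star (k : C(unitInterval, ℝ)) (p : C(unitInterval, F₂) × F₁) :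
    actBy k (star p) = star (actBy k p) := by
  refine Prod.ext (ContinuousMap.ext fun s => ?_) ?_ <;> simp [actBy]

theorem actBy_actBy (k l : C(unitInterval, ℝ)) (p : C(unitInterval, F₂) × F₁) :
    actBy k (actBy l p) = actBy (k * l) p := by
  refine Prod.ext (ContinuousMap.ext fun s => ?_) ?_ <;> simp [actBy, smul_smul]

theorem add_actBy (k l : C(unitInterval, ℝ)) (p : C(unitInterval, F₂) × F₁) :
    actBy (k + l) p = actBy k p + actBy l p := by
  refine Prod.ext (ContinuousMap.ext fun s => ?_) ?_ <;> simp [actBy, add_smul]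

theorem one_actBy (p : C(unitInterval, F₂) × F₁) : actBy 1 p = p := by
  refine Prod.ext (ContinuousMap.ext fun s => ?_) ?_ <;> simp [actBy]

theorem smul_actBy (r : ℝ) (k : C(unitInterval, ℝ)) (p : C(unitInterval, F₂) × F₁) :
    actBy (r • k) p = r • actBy k p := by
  refine Prod.ext (ContinuousMap.ext fun s => ?_) ?_ <;> simp [actBy, smul_smul]

variable {B : Type*} [NonUnitalCStarAlgebra B]

/-- The range of `j` is invariant under the action of `[0,1]`-valued loops. -/
def LoopInvariant (j : B →⋆ₙₐ[ℂ] C(unitInterval, F₂) × F₁) : Prop :=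
  ∀ k : C(unitInterval, ℝ), IsUnitLoop k → ∀ x, ∃ y, j y = actBy k (j x)

theorem map_real_smul' (j : B →⋆ₙₐ[ℂ] C(unitInterval, F₂) × F₁) (r : ℝ) (x : B) :
    j (r • x) = r • j x := by
  rw [← Complex.coe_smul, ← Complex.coe_smul, map_smul]

variable {j : B →⋆ₙₐ[ℂ] C(unitInterval, F₂) × F₁}

theorem LoopInvariant.exists_linearMap (hinv : LoopInvariant j) (hj : Function.Injective j)
    {k : C(unitInterval, ℝ)} (hk : IsUnitLoop k) :
    ∃ m : B →ₗ[ℝ] B, ∀ x, j (m x) = actBy k (j x) := by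
  choose f hf using hinv k hk
  exact ⟨{ toFun := f
           map_add' := fun x y => hj (by rw [map_add, hf, hf, hf, map_add, actBy_add])
           map_smul' := fun r x => hj (by
            rw [RingHom.id_apply, map_real_smul', hf, hf, map_real_smul', actBy_smul]) }, hf⟩

theorem LoopInvariant.exists_sq (hinv : LoopInvariant j) (hj : Function.Injective j)
    {k : C(unitInterval, ℝ)} (hk : IsUnitLoop k) {m : B →ₗ[ℝ] B}
    (hm : ∀ x, j (m x) = actBy k (j x)) :
    ∃ r : B → B, ∀ x, m (star x * x) = star (r x) * r x ∧ m (x * star x) = r x * star (r x) := by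
  let l : C(unitInterval, ℝ) := ⟨fun s => √(k s), by fun_prop⟩
  have hl : IsUnitLoop l := ⟨fun s => Real.sqrt_nonneg _,
    fun s => Real.sqrt_le_one.2 (hk.le_one s), by simp [l, hk.closed]⟩
  have hll : l * l = k := by
    ext s
    exact Real.mul_self_sqrt (hk.nonneg s)
  choose r hr using hinv l hl
  refine ⟨r, fun x => ⟨hj ?_, hj ?_⟩⟩
  · rw [hm, map_mul, map_mul, map_star, map_star, hr, ← actBy_star, ← actBy_mul_left,
      ← actBy_mul_right, actBy_actBy, hll]
  · rw [hm, map_mul, map_mul, map_star, map_star, hr, ← actBy_star, ← actBy_mul_left,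
      ← actBy_mul_right, actBy_actBy, hll]

theorem IsUnitLoop.compl {k : C(unitInterval, ℝ)} (hk : IsUnitLoop k) : IsUnitLoop (1 - k) :=
  ⟨fun s => by simpa using hk.le_one s, fun s => by simpa using hk.nonneg s,
    by simp [hk.closed]⟩

theorem LoopInvariant.isCentralContraction (hinv : LoopInvariant j) (hj : Function.Injective j)
    {k : C(unitInterval, ℝ)} (hk : IsUnitLoop k) {m : B →ₗ[ℝ] B}
    (hm : ∀ x, j (m x) = actBy k (j x)) : IsCentralContraction m where
  mul_left x y := hj (by rw [hm, map_mul, map_mul, hm, actBy_mul_left])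
  mul_right x y := hj (by rw [hm, map_mul, map_mul, hm, actBy_mul_right])
  sq := hinv.exists_sq hj hk hm
  sq_compl := by
    have h : ∀ x, j ((LinearMap.id - m : B →ₗ[ℝ] B) x) = actBy (1 - k) (j x) := fun x => by
      rw [LinearMap.sub_apply, LinearMap.id_apply, map_sub, hm, sub_eq_iff_eq_add, ← add_actBy,
        sub_add_cancel, one_actBy]
    simpa using hinv.exists_sq hj hk.compl h

/-- The loop `s ↦ |2s - 1|`. -/
def tentLoop : C(unitInterval, ℝ) := ⟨fun s => |2 * (s : ℝ) - 1|, by fun_prop⟩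

theorem isUnitLoop_tentLoop : IsUnitLoop tentLoop :=
  ⟨fun s => abs_nonneg _, fun s => by
    have h1 := s.2.1
    have h2 := s.2.2
    simp only [tentLoop, ContinuousMap.coe_mk, abs_le]
    constructor <;> linarith, by norm_num [tentLoop]⟩

variable [PartialOrder B] [StarOrderedRing B]

theorem exists_pow_linearMap {t : B → ℝ} (hinv : LoopInvariant j) (hj : Function.Injective j)
    {k : C(unitInterval, ℝ)} (hk : IsUnitLoop k) {m : B →ₗ[ℝ] B}
    (hm : ∀ x, j (m x) = actBy k (j x)) (htm : ∀ x, 0 ≤ x → t (m x) = t x) (N : ℕ) :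
    ∃ m' : B →ₗ[ℝ] B, (∀ x, j (m' x) = actBy (k ^ N) (j x)) ∧
      ∀ x, 0 ≤ x → 0 ≤ m' x ∧ t (m' x) = t x := by
  induction N with
  | zero => exact ⟨LinearMap.id, fun x => by simp [one_actBy], fun x hx => ⟨hx, rfl⟩⟩
  | succ N ih =>
    obtain ⟨m', h1, h2⟩ := ih
    refine ⟨m.comp m', fun x => ?_, fun x hx => ⟨?_, ?_⟩⟩
    · rw [LinearMap.comp_apply, hm, h1, actBy_actBy, pow_succ']
    · exact (hinv.isCentralContraction hj hk hm).nonneg (h2 x hx).1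
    · rw [LinearMap.comp_apply, htm _ (h2 x hx).1, (h2 x hx).2]

/-- On the compact set where ‖f‖ ≥ ε the function k stays below some constant < 1, so its powers
decay uniformly there; elsewhere they are bounded by 1. -/
theorem exists_pow_mul_norm_le {k : C(unitInterval, ℝ)} (hk : IsUnitLoop k)
    (f : C(unitInterval, F₂)) (hf : ∀ s, k s = 1 → f s = 0) {ε : ℝ} (hε : 0 < ε) :
    ∃ N : ℕ, ‖k ^ N • f‖ ≤ ε := by
  have hS : IsCompact {s | ε ≤ ‖f s‖} :=
    (isClosed_le continuous_const (by fun_prop)).isCompact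
  have hle : ∀ N : ℕ, ∀ s, k s ^ N ≤ 1 := fun N s => pow_le_one₀ (hk.nonneg s) (hk.le_one s)
  have hnorm : ∀ (N : ℕ) s, ‖(k ^ N • f) s‖ = k s ^ N * ‖f s‖ := fun N s => by
    simp [norm_smul, abs_of_nonneg (hk.nonneg s)]
  rcases Set.eq_empty_or_nonempty {s | ε ≤ ‖f s‖} with hempty | hne
  · refine ⟨0, (ContinuousMap.norm_le _ hε.le).2 fun s => ?_⟩
    have : s ∉ {s | ε ≤ ‖f s‖} := by simp [hempty]
    rw [hnorm]
    simpa using (not_le.1 this).le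
  · obtain ⟨s₀, hs₀, hmax⟩ := hS.exists_isMaxOn hne k.continuous.continuousOn
    have h1 : k s₀ < 1 := by
      refine lt_of_le_of_ne (hk.le_one _) fun h => ?_
      have := hf s₀ h
      rw [Set.mem_ofPred_eq, this, norm_zero] at hs₀
      linarith
    have hlim : Filter.Tendsto (fun N : ℕ => k s₀ ^ N * ‖f‖) Filter.atTop (𝓝 0) := by
      simpa using (tendsto_pow_atTop_nhds_zero_of_lt_one (hk.nonneg _) h1).mul_const ‖f‖
    obtain ⟨N, hN⟩ := (hlim.eventually (ge_mem_nhds hε)).exists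
    refine ⟨N, (ContinuousMap.norm_le _ hε.le).2 fun s => ?_⟩
    rw [hnorm]
    by_cases hs : ε ≤ ‖f s‖
    · refine le_trans ?_ hN
      exact mul_le_mul (pow_le_pow_left₀ (hk.nonneg s) (hmax hs) N) (f.norm_coe_le_norm s)
        (norm_nonneg _) (pow_nonneg (hk.nonneg _) _)
    · nlinarith [hle N s, norm_nonneg (f s), not_le.1 hs, pow_nonneg (hk.nonneg s) N]

/-- An extreme quasitrace is determined by the values at finitely many points. -/
theorem exists_eq_of_extreme (hinv : LoopInvariant j) (hj : Function.Injective j) {t : B → ℝ}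
    (ht : t ∈ (posQuasitraces B).extremePoints ℝ) :
    ∃ s₁ s₂ : unitInterval, ∀ x y : B, 0 ≤ x → 0 ≤ y → (j x).1 s₁ = (j y).1 s₁ →
      (j x).1 s₂ = (j y).1 s₂ → (j x).2 = (j y).2 → t x = t y := by
  have htK := ht.1
  obtain ⟨m, hm⟩ := hinv.exists_linearMap hj isUnitLoop_tentLoop
  have hmc := hinv.isCentralContraction hj isUnitLoop_tentLoop hm
  obtain ⟨χ, hχ0, hχ1, hχ⟩ := exists_eq_mul_of_extreme ht hmc
  -- The tent acts on t as χ, so multiplication by d² is annihilated by t and multiplication by 1 -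
  -- d² preserves t.
  let d : C(unitInterval, ℝ) := tentLoop - χ • 1
  have hd : IsUnitLoop (d * d) := by
    refine ⟨fun s => mul_self_nonneg _, fun s => ?_, ?_⟩
    · have h1 := isUnitLoop_tentLoop.nonneg s
      have h2 := isUnitLoop_tentLoop.le_one s
      simp only [d, ContinuousMap.mul_apply, ContinuousMap.sub_apply, ContinuousMap.smul_apply,
        ContinuousMap.one_apply, smul_eq_mul, mul_one]
      nlinarith
    · simp [d, isUnitLoop_tentLoop.closed]
  obtain ⟨m₂, hm₂⟩ := hinv.exists_linearMap hj hd
  have hmc₂ := hinv.isCentralContraction hj hd hm₂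
  have hzero : ∀ x, 0 ≤ x → t (m₂ x) = 0 := by
    intro x hx
    -- The expansion of d² is rearranged so that only sums of commuting positive elements occur.
    have h1 : m₂ x + (2 * χ) • m x = m (m x) + (χ ^ 2) • x := by
      apply hj
      rw [map_add, map_add, map_real_smul', map_real_smul', hm (m x), hm, hm₂, actBy_actBy,
        ← smul_actBy]
      have h2 : (χ ^ 2) • j x = actBy ((χ ^ 2) • 1) (j x) := by rw [smul_actBy, one_actBy]
      rw [h2, ← add_actBy, ← add_actBy]
      congr 1
      ext s
      simp only [d, ContinuousMap.mul_apply, ContinuousMap.sub_apply, ContinuousMap.smul_apply,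
        ContinuousMap.one_apply, smul_eq_mul, mul_one, ContinuousMap.add_apply]
      ring
    have hmx := hmc.nonneg hx
    have hc1 : Commute (m₂ x) (m x) :=
      hmc₂.commute_self ((hmc.commute_self (Commute.refl x)).symm)
    have hc2 : Commute (m (m x)) x := hmc.commute_self (hmc.commute_self (Commute.refl x))
    have h3 := congrArg t h1
    rw [htK.1.add _ _ (hmc₂.nonneg hx) (smul_nonneg (by positivity) hmx) (hc1.smul_right _),
      htK.1.add _ _ (hmc.nonneg hmx) (smul_nonneg (by positivity) hx) (hc2.smul_right _),
      htK.1.smul _ _ (by positivity) hmx, htK.1.smul _ _ (by positivity) hx, hχ _ hmx,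
      hχ x hx] at h3
    nlinarith
  have hκ := hd.compl
  obtain ⟨κ, hκm⟩ := hinv.exists_linearMap hj hκ
  have hκc := hinv.isCentralContraction hj hκ hκm
  have hκt : ∀ x, 0 ≤ x → t (κ x) = t x := by
    intro x hx
    have h1 : κ x + m₂ x = x := by
      apply hj
      rw [map_add, hκm, hm₂, ← add_actBy, sub_add_cancel, one_actBy]
    have hc : Commute (κ x) (m₂ x) := hκc.commute_self (hmc₂.commute_self (Commute.refl x)).symm
    have h2 := htK.1.add _ _ (hκc.nonneg hx) (hmc₂.nonneg hx) hc
    rw [h1, hzero x hx] at h2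
    linarith
  -- These are the solutions of |2s - 1| = χ, the only points where 1 - d² equals 1.
  refine ⟨⟨(1 - χ) / 2, by constructor <;> linarith⟩, ⟨(1 + χ) / 2, by constructor <;> linarith⟩,
    fun x y hx hy h1 h2 h3 => ?_⟩
  have hf : ∀ s, (1 - d * d) s = 1 → ((j x).1 - (j y).1) s = 0 := by
    intro s hs
    have h4 : tentLoop s = χ := by
      simp only [d, ContinuousMap.mul_apply, ContinuousMap.sub_apply, ContinuousMap.smul_apply,
        ContinuousMap.one_apply, smul_eq_mul, mul_one] at hs
      have : (tentLoop s - χ) * (tentLoop s - χ) = 0 := by linarith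
      linarith [mul_self_eq_zero.1 this]
    rw [ContinuousMap.sub_apply, sub_eq_zero]
    rcases abs_choice (2 * (s : ℝ) - 1) with h | h
    · have : s = ⟨(1 + χ) / 2, by constructor <;> linarith⟩ := by
        apply Subtype.ext
        simp only [tentLoop, ContinuousMap.coe_mk] at h4
        show (s : ℝ) = (1 + χ) / 2
        linarith
      rw [this, h2]
    · have : s = ⟨(1 - χ) / 2, by constructor <;> linarith⟩ := by
        apply Subtype.ext
        simp only [tentLoop, ContinuousMap.coe_mk] at h4
        show (s : ℝ) = (1 - χ) / 2
        linarith
      rw [this, h1]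
  -- Multiplying by (1 - d²)^N leaves t x and t y unchanged while the difference of x and y becomes
  -- uniformly small; Lipschitz continuity of t concludes.
  refine eq_of_forall_dist_le fun ε hε => ?_
  obtain ⟨N, hN⟩ := exists_pow_mul_norm_le hκ _ hf (half_pos hε)
  obtain ⟨m', hm', hm't⟩ := exists_pow_linearMap hinv hj hκ hκm hκt N
  rw [Real.dist_eq, ← (hm't x hx).2, ← (hm't y hy).2]
  refine (htK.1.abs_sub_le (hm't y hy).1 (hm't x hx).1).trans ?_
  have h5 : ‖m' x - m' y‖ ≤ ε / 2 := by
    rw [← NonUnitalStarAlgHom.norm_map j hj, map_sub, hm', hm']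
    have : actBy ((1 - d * d) ^ N) (j x) - actBy ((1 - d * d) ^ N) (j y) =
        ((1 - d * d) ^ N • ((j x).1 - (j y).1), 0) := by
      simp only [actBy, h3, Prod.mk_sub_mk, sub_self, smul_sub]
    rw [this, Prod.norm_mk, norm_zero]
    exact max_le hN (half_pos hε).le
  linarith

end Loop

/-! ### Quasitraces through finite dimensional quotients, and Krein–Milman -/

section Factor

variable {B : Type*} [NonUnitalCStarAlgebra B] [PartialOrder B] [StarOrderedRing B]

/-- A quasitrace that factors through a surjection onto a finite dimensional algebra is additive. -/
theorem IsPosQuasitrace.add_of_surjective {E : Type*} [NonUnitalCStarAlgebra E]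
    [FiniteDimensional ℂ E] {t : B → ℝ} (ht : IsPosQuasitrace t) (π : B →⋆ₙₐ[ℂ] E)
    (hπ : Function.Surjective π) (h : ∀ x y : B, 0 ≤ x → 0 ≤ y → π x = π y → t x = t y)
    {x y : B} (hx : 0 ≤ x) (hy : 0 ≤ y) : t (x + y) = t x + t y := by
  let _ : PartialOrder E := CStarAlgebra.spectralOrder E
  have : StarOrderedRing E := CStarAlgebra.spectralOrderedRing E
  have hcont : Continuous π := by fun_prop
  classical
  let T : E → ℝ := fun e => if h : ∃ x : B, 0 ≤ x ∧ π x = e then t h.choose else 0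
  have hT : ∀ x : B, 0 ≤ x → T (π x) = t x := by
    intro x hx
    have h' : ∃ y : B, 0 ≤ y ∧ π y = π x := ⟨x, hx, rfl⟩
    simp only [T, dif_pos h']
    exact h _ _ h'.choose_spec.1 hx h'.choose_spec.2
  have hlift : ∀ e : E, 0 ≤ e → ∃ x : B, 0 ≤ x ∧ π x = e := by
    intro e he
    obtain ⟨z, rfl⟩ := CStarAlgebra.nonneg_iff_eq_star_mul_self.1 he
    obtain ⟨w, rfl⟩ := hπ z
    exact ⟨star w * w, star_mul_self_nonneg w, by rw [map_mul, map_star]⟩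
  have hsmulR : ∀ (r : ℝ) (x : B), π (r • x) = r • π x := fun r x => by
    rw [← Complex.coe_smul, ← Complex.coe_smul, map_smul]
  have hπpos : ∀ x : B, 0 ≤ x → 0 ≤ π x := by
    intro x hx
    obtain ⟨z, rfl⟩ := CStarAlgebra.nonneg_iff_eq_star_mul_self.1 hx
    rw [map_mul, map_star]
    exact star_mul_self_nonneg _
  rw [← hT x hx, ← hT y hy, ← hT _ (add_nonneg hx hy), map_add]
  refine add_of_finiteDimensional (fun e => ?_) (fun a b ha hb hab => ?_)
    (fun r a hr ha => ?_) (hπpos x hx) (hπpos y hy)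
  · obtain ⟨w, rfl⟩ := hπ e
    rw [← map_star, ← map_mul, ← map_mul, hT _ (star_mul_self_nonneg w),
      hT _ (mul_star_self_nonneg w), ht.tracial]
  -- Arbitrary positive lifts of a and b need not commute. The positive and negative parts of a
  -- self-adjoint lift of a - b are orthogonal lifts of them.
  · obtain ⟨w, hw⟩ := hπ (a - b)
    set z : B := (2⁻¹ : ℝ) • (w + star w) with hz
    have hzs : IsSelfAdjoint z :=
      (IsSelfAdjoint.all (2⁻¹ : ℝ)).smul (IsSelfAdjoint.add_star_self w)
    have hπz : π z = a - b := by
      rw [hz, hsmulR, map_add, map_star, hw, star_sub, ha.isSelfAdjoint.star_eq,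
        hb.isSelfAdjoint.star_eq, ← two_smul ℝ, smul_smul]
      norm_num
    obtain ⟨u1, u2⟩ := CFC.posPart_negPart_unique hπz hab ha hb
    have hp : π (z⁺) = a := by
      rw [← u1, CFC.posPart_def, CFC.posPart_def]
      exact π.map_cfcₙ _ z (by fun_prop) (by simp) hcont hzs (hzs.map π)
    have hn : π (z⁻) = b := by
      rw [← u2, CFC.negPart_def, CFC.negPart_def]
      exact π.map_cfcₙ _ z (by fun_prop) (by simp) hcont hzs (hzs.map π)
    have h1 := CFC.posPart_nonneg z
    have h2 := CFC.negPart_nonneg z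
    rw [← hp, ← hn, ← map_add, hT _ h1, hT _ h2, hT _ (add_nonneg h1 h2), ht.add _ _ h1 h2]
    rw [commute_iff_eq, CFC.posPart_mul_negPart, CFC.negPart_mul_posPart]
  · obtain ⟨w, hw, rfl⟩ := hlift a ha
    rw [← hsmulR, hT w hw, hT _ (smul_nonneg hr hw), ht.smul r w hr hw]

theorem IsPosQuasitrace.add_of_finiteDimensional_codomain {F : Type*} [NonUnitalCStarAlgebra F]
    [FiniteDimensional ℂ F] {t : B → ℝ} (ht : IsPosQuasitrace t) (π : B →⋆ₙₐ[ℂ] F)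
    (h : ∀ x y : B, 0 ≤ x → 0 ≤ y → π x = π y → t x = t y)
    {x y : B} (hx : 0 ≤ x) (hy : 0 ≤ y) : t (x + y) = t x + t y := by
  let R := NonUnitalStarAlgHom.range π
  have : IsClosed (R : Set F) := R.toSubmodule.closed_of_finiteDimensional
  have : FiniteDimensional ℂ R := inferInstanceAs (FiniteDimensional ℂ R.toSubmodule)
  refine ht.add_of_surjective (E := R) (NonUnitalStarAlgHom.rangeRestrict π)
    ?_ (fun x y hx hy hxy => h x y hx hy (congrArg Subtype.val hxy)) hx hy
  rintro ⟨_, w, rfl⟩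
  exact ⟨w, rfl⟩

/-- Quasitraces on algebras of functions with values in finite dimensional algebras are additive. -/
theorem IsPosQuasitrace.add_of_loopInvariant {F₁ F₂ : Type*} [NonUnitalCStarAlgebra F₁]
    [NonUnitalCStarAlgebra F₂] [FiniteDimensional ℂ F₁] [FiniteDimensional ℂ F₂]
    {j : B →⋆ₙₐ[ℂ] C(unitInterval, F₂) × F₁} (hinv : LoopInvariant j)
    (hj : Function.Injective j) {t : B → ℝ} (ht : t ∈ posQuasitraces B) {x y : B}
    (hx : 0 ≤ x) (hy : 0 ≤ y) : t (x + y) = t x + t y := by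
  -- Additivity at a fixed pair is a closed convex condition on t, so extreme points suffice.
  rw [← closure_convexHull_extremePoints (isCompact_posQuasitraces B)
    (convex_posQuasitraces B)] at ht
  let S : Set (B → ℝ) := {t | t (x + y) = t x + t y}
  have hS : IsClosed S := isClosed_eq (continuous_apply _) (by fun_prop)
  have hSc : Convex ℝ S := by
    intro s hs t ht a b _ _ _
    have hs' : s (x + y) = s x + s y := hs
    have ht' : t (x + y) = t x + t y := ht
    show (a • s + b • t) (x + y) = (a • s + b • t) x + (a • s + b • t) y
    simp only [Pi.add_apply, Pi.smul_apply, smul_eq_mul, hs', ht']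
    ring
  refine closure_minimal (convexHull_min ?_ hSc) hS ht
  intro t ht
  obtain ⟨s₁, s₂, h⟩ := exists_eq_of_extreme hinv hj ht
  let ev : unitInterval → C(unitInterval, F₂) →⋆ₙₐ[ℂ] F₂ := fun s =>
    { toFun := fun f => f s
      map_smul' := fun _ _ => rfl
      map_zero' := rfl
      map_add' := fun _ _ => rfl
      map_mul' := fun _ _ => rfl
      map_star' := fun _ => rfl }
  let π : B →⋆ₙₐ[ℂ] (F₂ × F₂) × F₁ :=
    NonUnitalStarAlgHom.prod (NonUnitalStarAlgHom.prod
      ((ev s₁).comp ((NonUnitalStarAlgHom.fst ℂ _ _).comp j))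
      ((ev s₂).comp ((NonUnitalStarAlgHom.fst ℂ _ _).comp j)))
      ((NonUnitalStarAlgHom.snd ℂ _ _).comp j)
  refine ht.1.1.add_of_finiteDimensional_codomain π
    (fun x y hx hy hxy => h x y hx hy ?_ ?_ ?_) hx hy
  · exact congrArg (fun p => p.1.1) hxy
  · exact congrArg (fun p => p.1.2) hxy
  · exact congrArg (fun p => p.2) hxy

end Factor

/-! ### A faithful trace on a finite dimensional algebra -/

section RegularTrace

variable {F : Type*} [NonUnitalCStarAlgebra F]

variable (F) in
/-- The trace of left multiplication. -/
def regularTrace : F →ₗ[ℂ] ℂ := (LinearMap.trace ℂ F).comp (LinearMap.mul ℂ F)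

theorem regularTrace_mul_comm (x y : F) : regularTrace F (x * y) = regularTrace F (y * x) := by
  have h : ∀ a b : F, LinearMap.mul ℂ F (a * b) = LinearMap.mul ℂ F a * LinearMap.mul ℂ F b :=
    fun a b => by ext z; simp [mul_assoc]
  simp only [regularTrace, LinearMap.comp_apply, h]
  exact LinearMap.trace_mul_comm ℂ _ _

variable [FiniteDimensional ℂ F]

/-- Left multiplication by p is idempotent, so its trace is its rank. -/
theorem regularTrace_proj {p : F} (hp : IsStarProjection p) :
    0 ≤ regularTrace F p ∧ (regularTrace F p = 0 → p = 0) := by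
  have hi : IsIdempotentElem (LinearMap.mul ℂ F p) := by
    rw [IsIdempotentElem]
    ext z
    simp [← mul_assoc, hp.isIdempotentElem.eq]
  refine ⟨?_, fun h => ?_⟩
  · rw [regularTrace, LinearMap.comp_apply, (LinearMap.IsIdempotentElem.isProj_range _ hi).trace]
    positivity
  · have := LinearMap.IsIdempotentElem.eq_zero_of_trace_eq_zero hi h
    have h2 := LinearMap.congr_fun this p
    simpa [hp.isIdempotentElem.eq] using h2

theorem regularTrace_star_mul_self_pos {x : F} (hx : x ≠ 0) : 0 < regularTrace F (star x * x) := by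
  let _ : PartialOrder F := CStarAlgebra.spectralOrder F
  have : StarOrderedRing F := CStarAlgebra.spectralOrderedRing F
  set a := star x * x with ha
  have ha0 : 0 ≤ a := star_mul_self_nonneg x
  have hane : a ≠ 0 := fun h => hx (CStarRing.star_mul_self_eq_zero_iff x |>.1 h)
  have hsum := eq_sum_spectralProj ha0.isSelfAdjoint
  set S := (quasispectrum_finite_of_finiteDimensional a).toFinset.erase 0 with hS
  have hP : ∀ r ∈ S, IsStarProjection (spectralProj a r) := fun r hr =>
    spectralProj_isStarProjection a (Finset.ne_of_mem_erase hr)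
  have hpos : ∀ r ∈ S, 0 < r := fun r hr => lt_of_le_of_ne
    (quasispectrum_nonneg_of_nonneg a ha0 r (by simpa using Finset.mem_of_mem_erase hr))
    (Finset.ne_of_mem_erase hr).symm
  have hmap : regularTrace F a = ∑ r ∈ S, (r : ℂ) * regularTrace F (spectralProj a r) := by
    conv_lhs => rw [hsum]
    rw [map_sum]
    refine Finset.sum_congr rfl fun r _ => ?_
    rw [← Complex.coe_smul, map_smul, smul_eq_mul]
  have hterm : ∀ r ∈ S, 0 ≤ (r : ℂ) * regularTrace F (spectralProj a r) := fun r hr =>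
    mul_nonneg (by exact_mod_cast (hpos r hr).le) (regularTrace_proj (hP r hr)).1
  rw [hmap]
  refine lt_of_le_of_ne (Finset.sum_nonneg hterm) fun h => hane ?_
  have h0 := (Finset.sum_eq_zero_iff_of_nonneg hterm).1 h.symm
  rw [hsum]
  refine Finset.sum_eq_zero fun r hr => ?_
  have h1 : (r : ℂ) ≠ 0 := by exact_mod_cast (hpos r hr).ne'
  rw [(regularTrace_proj (hP r hr)).2 ((mul_eq_zero.1 (h0 r hr)).resolve_left h1), smul_zero]

end RegularTrace

/-! ### Traces as invariants of K₀ -/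

section K0

variable {C : Type u} [NonUnitalCStarAlgebra C]

/-- The invariant of `K₀` of the unitization that a trace on `C` induces. -/
def traceClass (τ : C →ₗ[ℂ] ℂ) : FreeAbelianGroup (Σ n : ℕ, MatProj (Unitization ℂ C) n) →+ ℂ :=
  FreeAbelianGroup.lift fun p => ∑ i, τ (p.2.1 i i).snd

theorem traceClass_of (τ : C →ₗ[ℂ] ℂ) {n : ℕ} (p : MatProj (Unitization ℂ C) n) :
    traceClass τ (.of ⟨n, p⟩) = ∑ i, τ (p.1 i i).snd := by
  simp [traceClass]

/-- Extending τ by 0 on scalars gives a tracial functional on the unitization, and a trace summed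
over the diagonal respects block sums and Murray–von Neumann equivalence. -/
theorem K0Rel_le_ker {τ : C →ₗ[ℂ] ℂ} (hτ : ∀ x y, τ (x * y) = τ (y * x)) :
    K0Rel (Unitization ℂ C) ≤ (traceClass τ).ker := by
  refine (AddSubgroup.closure_le _).2 ?_
  rintro x (⟨m, n, p, q, rfl⟩ | ⟨m, n, p, q, ⟨w, hp, hq⟩, rfl⟩)
  · rw [SetLike.mem_coe, AddMonoidHom.mem_ker, map_sub, map_add, traceClass_of, traceClass_of,
      traceClass_of, Fin.sum_univ_add]
    simp [MatProj.sum, blockSum]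
  · rw [SetLike.mem_coe, AddMonoidHom.mem_ker, map_sub, traceClass_of, traceClass_of, sub_eq_zero,
      ← hp, ← hq]
    have hcomm : ∀ u v : Unitization ℂ C, τ (u * v).snd = τ (v * u).snd := by
      intro u v
      simp only [Unitization.snd_mul, map_add, map_smul, hτ u.snd v.snd]
      ring
    have hsum : ∀ {ι : Type} [Fintype ι] (f : ι → Unitization ℂ C),
        (∑ i, f i).snd = ∑ i, (f i).snd := fun f => map_sum (Unitization.sndHom ℂ ℂ C) f _
    simp only [Matrix.mul_apply, Matrix.conjTranspose_apply, hsum, map_sum]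
    rw [Finset.sum_comm]
    exact Finset.sum_congr rfl fun i _ => Finset.sum_congr rfl fun k _ => hcomm _ _

theorem trace_projection_eq_zero (hK : K0Pos C = {0}) {τ : C →ₗ[ℂ] ℂ}
    (hτ : ∀ x y, τ (x * y) = τ (y * x)) {p : C} (hp : IsStarProjection p) : τ p = 0 := by
  let P : MatProj C 1 := ⟨Matrix.of fun _ _ => p, by
    constructor
    · ext i k
      simp [Matrix.mul_apply, hp.isIdempotentElem.eq]
    · ext i k
      simp [Matrix.star_apply, hp.isSelfAdjoint.star_eq]⟩
  have h1 : K0.mk P.inr ∈ K0Pos C := ⟨1, P, rfl⟩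
  rw [hK, Set.mem_singleton_iff, K0.mk, QuotientAddGroup.eq_zero_iff] at h1
  have h2 := K0Rel_le_ker hτ h1
  rw [AddMonoidHom.mem_ker, traceClass_of] at h2
  simpa [MatProj.inr, P] using h2

end K0

/-! ### Blocks have enough traces and no projections -/

section BuildingBlock

theorem exists_embedding_of_inClassC {C : Type u} [NonUnitalCStarAlgebra C] (hC : InClassC C) :
    ∃ (F₁ F₂ : Type) (_ : NonUnitalCStarAlgebra F₁) (_ : NonUnitalCStarAlgebra F₂)
      (_ : FiniteDimensional ℂ F₁) (_ : FiniteDimensional ℂ F₂)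
      (j : C →⋆ₙₐ[ℂ] C(unitInterval, F₂) × F₁), Function.Injective j ∧ LoopInvariant j := by
  obtain ⟨F₁, F₂, i₁, i₂, φ₀, φ₁, h₁, h₂, ⟨e⟩⟩ := hC
  let j : C →⋆ₙₐ[ℂ] C(unitInterval, F₂) × F₁ :=
    (NonUnitalStarSubalgebraClass.subtype (mappingTorus φ₀ φ₁)).comp
      (e : C →⋆ₙₐ[ℂ] mappingTorus φ₀ φ₁)
  refine ⟨F₁, F₂, i₁, i₂, h₁, h₂, j, fun x y h => e.injective (Subtype.ext h), fun k hk x => ?_⟩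
  have hmem : actBy k (j x) ∈ mappingTorus φ₀ φ₁ := by
    have hx : j x ∈ mappingTorus φ₀ φ₁ := (e x).2
    obtain ⟨h0, h1⟩ := hx
    have hr : ∀ (φ : F₁ →⋆ₙₐ[ℂ] F₂) (r : ℝ) (z : F₁), φ (r • z) = r • φ z := fun φ r z => by
      rw [← Complex.coe_smul, ← Complex.coe_smul, map_smul]
    constructor
    · show k 0 • (j x).1 0 = φ₀ (k 0 • (j x).2)
      rw [h0, hr]
    · show k 1 • (j x).1 1 = φ₁ (k 0 • (j x).2)
      rw [h1, hr, hk.closed]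
  exact ⟨e.symm ⟨_, hmem⟩, congrArg Subtype.val (e.apply_symm_apply ⟨_, hmem⟩)⟩

theorem exists_trace_of_map_ne_zero {C F : Type*} [NonUnitalCStarAlgebra C]
    [NonUnitalCStarAlgebra F] [FiniteDimensional ℂ F] (π : C →⋆ₙₐ[ℂ] F) {x : C} (hx : π x ≠ 0) :
    ∃ τ : C →L[ℂ] ℂ, (∀ y, 0 ≤ τ (star y * y)) ∧ (∀ y z, τ (y * z) = τ (z * y)) ∧
      τ (star x * x) ≠ 0 := by
  have hπ : Continuous π := map_continuous π
  refine ⟨⟨(regularTrace F).comp (π : C →ₗ[ℂ] F), ?_⟩, fun y => ?_, fun y z => ?_, ?_⟩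
  · exact (LinearMap.continuous_of_finiteDimensional (regularTrace F)).comp hπ
  · show 0 ≤ regularTrace F (π (star y * y))
    rw [map_mul, map_star]
    by_cases h : π y = 0
    · simp [h]
    · exact (regularTrace_star_mul_self_pos h).le
  · show regularTrace F (π (y * z)) = regularTrace F (π (z * y))
    rw [map_mul π, map_mul π, regularTrace_mul_comm]
  · show regularTrace F (π (star x * x)) ≠ 0
    rw [map_mul, map_star]
    exact (regularTrace_star_mul_self_pos hx).ne'

/-- A nonzero element survives either in the F₁ component or at some point of the interval; the
regular trace is pulled back from there. -/
theorem exists_trace_ne_zero {C F₁ F₂ : Type*} [NonUnitalCStarAlgebra C]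
    [NonUnitalCStarAlgebra F₁] [NonUnitalCStarAlgebra F₂] [FiniteDimensional ℂ F₁]
    [FiniteDimensional ℂ F₂] {j : C →⋆ₙₐ[ℂ] C(unitInterval, F₂) × F₁}
    (hj : Function.Injective j) {x : C} (hx : x ≠ 0) :
    ∃ τ : C →L[ℂ] ℂ, (∀ y, 0 ≤ τ (star y * y)) ∧ (∀ y z, τ (y * z) = τ (z * y)) ∧
      τ (star x * x) ≠ 0 := by
  by_cases h2 : (j x).2 = 0
  · have h1 : (j x).1 ≠ 0 := fun h1 => hx (hj (by rw [map_zero]; exact Prod.ext h1 h2))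
    obtain ⟨s, hs⟩ : ∃ s, (j x).1 s ≠ 0 := by
      by_contra! h
      exact h1 (ContinuousMap.ext h)
    let ev : C(unitInterval, F₂) →⋆ₙₐ[ℂ] F₂ :=
      { toFun := fun f => f s
        map_smul' := fun _ _ => rfl
        map_zero' := rfl
        map_add' := fun _ _ => rfl
        map_mul' := fun _ _ => rfl
        map_star' := fun _ => rfl }
    exact exists_trace_of_map_ne_zero (ev.comp ((NonUnitalStarAlgHom.fst ℂ _ _).comp j)) hs
  · exact exists_trace_of_map_ne_zero ((NonUnitalStarAlgHom.snd ℂ _ _).comp j) h2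

/-- The condition on K₀ makes every trace vanish on a projection, while some trace detects it if it
is nonzero. -/
theorem InClassC0.eq_zero_of_isStarProjection {C : Type u} [NonUnitalCStarAlgebra C]
    (hC : InClassC0 C) {p : C} (hp : IsStarProjection p) : p = 0 := by
  by_contra hne
  obtain ⟨F₁, F₂, _, _, _, _, j, hj, -⟩ := exists_embedding_of_inClassC hC.inClassC
  obtain ⟨τ, -, hτ, hτp⟩ := exists_trace_ne_zero hj hne
  rw [hp.isSelfAdjoint.star_eq, hp.isIdempotentElem.eq] at hτp
  exact hτp (trace_projection_eq_zero hC.k0 (τ := τ) hτ hp)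

end BuildingBlock

/-! ### Passing to full hereditary subalgebras -/

section HereditaryBlock

theorem actBy_complex_smul {F₁ F₂ : Type*} [NonUnitalCStarAlgebra F₁] [NonUnitalCStarAlgebra F₂]
    (k : C(unitInterval, ℝ)) (c : ℂ) (p : C(unitInterval, F₂) × F₁) :
    actBy k (c • p) = c • actBy k p := by
  refine Prod.ext (ContinuousMap.ext fun s => ?_) ?_
  · exact smul_comm (k s) c (p.1 s)
  · exact smul_comm (k 0) c p.2

/-- For positive h in B, the products of h with k and with 1 - k are positive and add up to h, so
heredity keeps k·h in B. Positive elements span. -/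
theorem IsHereditary.loopInvariant {C F₁ F₂ D : Type*} [NonUnitalCStarAlgebra C]
    [NonUnitalCStarAlgebra F₁] [NonUnitalCStarAlgebra F₂] [NonUnitalCStarAlgebra D]
    {B : NonUnitalStarSubalgebra ℂ C} (hB : IsHereditary B)
    {j : C →⋆ₙₐ[ℂ] C(unitInterval, F₂) × F₁} (hinv : LoopInvariant j) (hj : Function.Injective j)
    (e : D ≃⋆ₐ[ℂ] B) {i : D →⋆ₙₐ[ℂ] C} (hi : ∀ d, i d = e d) : LoopInvariant (j.comp i) := by
  let _ : PartialOrder D := CStarAlgebra.spectralOrder D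
  have : StarOrderedRing D := CStarAlgebra.spectralOrderedRing D
  intro k hk x
  let S : Submodule ℂ D :=
    { carrier := {x | ∃ y, j.comp i y = actBy k (j.comp i x)}
      add_mem' := by
        rintro x x' ⟨y, hy⟩ ⟨y', hy'⟩
        exact ⟨y + y', by rw [map_add, map_add, hy, hy', actBy_add]⟩
      zero_mem' := ⟨0, by simp only [map_zero]; simp [actBy]; rfl⟩
      smul_mem' := by
        rintro c x ⟨y, hy⟩
        exact ⟨c • y, by rw [map_smul, map_smul, hy, actBy_complex_smul]⟩ }
  suffices h : Submodule.span ℂ {a : D | 0 ≤ a} ≤ S by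
    rw [CStarAlgebra.span_nonneg] at h
    exact h Submodule.mem_top
  refine Submodule.span_le.2 fun d hd => ?_
  obtain ⟨u, rfl⟩ := CStarAlgebra.nonneg_iff_eq_star_mul_self.1
    (show (0 : D) ≤ d from hd)
  obtain ⟨m, hm⟩ := hinv.exists_linearMap hj hk
  obtain ⟨m', hm'⟩ := hinv.exists_linearMap hj hk.compl
  obtain ⟨r, hr⟩ := hinv.exists_sq hj hk hm
  obtain ⟨r', hr'⟩ := hinv.exists_sq hj hk.compl hm'
  have hsum : ∀ z, m z + m' z = z := fun z => hj (by
    rw [map_add, hm, hm', ← add_actBy, add_sub_cancel, one_actBy])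
  have hmem : star (r (i u)) * r (i u) ∈ B := by
    refine hB _ (r' (i u)) ?_
    rw [← (hr _).1, ← (hr' _).1, hsum, ← map_star, ← map_mul, hi]
    exact (e _).2
  refine ⟨e.symm ⟨_, hmem⟩, ?_⟩
  have h1 : i (e.symm ⟨_, hmem⟩) = star (r (i u)) * r (i u) := by
    rw [hi, e.apply_symm_apply]
  show j (i _) = actBy k (j (i _))
  rw [h1, ← (hr _).1, hm, map_mul i, map_star i]

variable {D : Type u} [NonUnitalCStarAlgebra D]

theorem InClassC0'.exists_embedding (hD : InClassC0' D) :
    ∃ (F₁ F₂ : Type) (_ : NonUnitalCStarAlgebra F₁) (_ : NonUnitalCStarAlgebra F₂)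
      (_ : FiniteDimensional ℂ F₁) (_ : FiniteDimensional ℂ F₂)
      (j : D →⋆ₙₐ[ℂ] C(unitInterval, F₂) × F₁), Function.Injective j ∧ LoopInvariant j := by
  obtain ⟨C, _, B, hC, -, hB, -, ⟨e⟩⟩ := hD
  obtain ⟨F₁, F₂, i₁, i₂, h₁, h₂, j, hj, hinv⟩ := exists_embedding_of_inClassC hC.inClassC
  let i : D →⋆ₙₐ[ℂ] C := (NonUnitalStarSubalgebraClass.subtype B).comp (e : D →⋆ₙₐ[ℂ] B)
  exact ⟨F₁, F₂, i₁, i₂, h₁, h₂, j.comp i, hj.comp (Subtype.val_injective.comp e.injective),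
    hB.loopInvariant hinv hj e fun _ => rfl⟩

theorem InClassC0'.eq_zero_of_isStarProjection (hD : InClassC0' D) {p : D}
    (hp : IsStarProjection p) : p = 0 := by
  obtain ⟨C, _, B, hC, -, -, -, ⟨e⟩⟩ := hD
  let i : D →⋆ₙₐ[ℂ] C := (NonUnitalStarSubalgebraClass.subtype B).comp (e : D →⋆ₙₐ[ℂ] B)
  have hi : Function.Injective i := Subtype.val_injective.comp e.injective
  refine hi ?_
  rw [map_zero]
  exact hC.eq_zero_of_isStarProjection (hp.map i)

/-- Here fullness enters: a zero subalgebra generates the zero ideal, which is not all of C. -/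
theorem InClassC0'.nontrivial (hD : InClassC0' D) : Nontrivial D := by
  obtain ⟨C, _, B, hC, -, -, hB, ⟨e⟩⟩ := hD
  by_contra h
  rw [not_nontrivial_iff_subsingleton] at h
  have h1 : (⊥ : TwoSidedIdeal C) = ⊤ := by
    refine hB ⊥ (by simp [TwoSidedIdeal.mem_bot]) fun x hx => ?_
    have h2 : (⟨x, hx⟩ : B) = 0 := by
      rw [← e.apply_symm_apply ⟨x, hx⟩, Subsingleton.elim (e.symm ⟨x, hx⟩) 0, map_zero]
    rw [TwoSidedIdeal.mem_bot]
    exact congrArg Subtype.val h2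
  have := hC.nontrivial
  obtain ⟨x, hx⟩ := exists_ne (0 : C)
  refine hx ?_
  rw [← TwoSidedIdeal.mem_bot, h1]
  trivial

theorem inv_norm_smul_mem_tracialStates {τ : D →L[ℂ] ℂ} (hpos : ∀ x, 0 ≤ τ (star x * x))
    (htr : ∀ x y, τ (x * y) = τ (y * x)) (hτ : τ ≠ 0) :
    StrongDual.toWeakDual (((‖τ‖⁻¹ : ℝ) : ℂ) • τ) ∈ tracialStates D := by
  refine ⟨fun y => ?_, fun y z => ?_, ?_⟩
  · show 0 ≤ ((‖τ‖⁻¹ : ℝ) : ℂ) * τ (star y * y)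
    exact mul_nonneg (by exact_mod_cast inv_nonneg.2 (norm_nonneg τ)) (hpos y)
  · show ((‖τ‖⁻¹ : ℝ) : ℂ) * τ (y * z) = ((‖τ‖⁻¹ : ℝ) : ℂ) * τ (z * y)
    rw [htr]
  · show ‖((‖τ‖⁻¹ : ℝ) : ℂ) • τ‖ = 1
    rw [norm_smul, Complex.norm_real, norm_inv, norm_norm, inv_mul_cancel₀ (norm_ne_zero_iff.2 hτ)]

theorem InClassC0'.tracialStates_nonempty (hD : InClassC0' D) : (tracialStates D).Nonempty := by
  have := hD.nontrivial
  obtain ⟨x, hx⟩ := exists_ne (0 : D)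
  obtain ⟨F₁, F₂, _, _, _, _, j, hj, -⟩ := hD.exists_embedding
  obtain ⟨τ, hpos, htr, hne⟩ := exists_trace_ne_zero hj hx
  have hτ : τ ≠ 0 := fun h => hne (by rw [h]; rfl)
  exact ⟨_, inv_norm_smul_mem_tracialStates hpos htr hτ⟩

end HereditaryBlock

/-! ### Additivity of quasitraces on the blocks inside `A` -/

section Restriction

/-- By uniqueness of positive and negative parts, π carries x⁻ to the negative part of π x, which is
0. -/
theorem nonneg_of_map_nonneg {A B : Type*} [NonUnitalCStarAlgebra A] [PartialOrder A]
    [StarOrderedRing A] [NonUnitalCStarAlgebra B] [PartialOrder B] [StarOrderedRing B]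
    {π : B →⋆ₙₐ[ℂ] A} (hπ : Function.Injective π) {x : B} (hx : 0 ≤ π x) : 0 ≤ x := by
  have hsa : IsSelfAdjoint x := hπ (by rw [map_star, hx.isSelfAdjoint.star_eq])
  have hmono : ∀ z : B, 0 ≤ z → 0 ≤ π z := fun z hz => map_nonneg π hz
  have h := CFC.posPart_negPart_unique (a := π x) (b := π x⁺) (c := π x⁻)
    (by rw [← map_sub, CFC.posPart_sub_negPart x hsa])
    (by rw [← map_mul, CFC.posPart_mul_negPart, map_zero])
    (hmono _ (CFC.posPart_nonneg x)) (hmono _ (CFC.negPart_nonneg x))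
  have h0 : π x⁻ = 0 := by rw [← h.2, (CFC.negPart_eq_zero_iff _).2 hx]
  have h1 : x⁻ = 0 := hπ (by rw [h0, map_zero])
  rw [CFC.negPart_eq_zero_iff x] at h1
  exact h1

variable {A : Type u} [NonUnitalCStarAlgebra A] [PartialOrder A] [StarOrderedRing A]

theorem IsPosQuasitrace.add_of_embedding {t : A → ℝ} (ht : IsPosQuasitrace t) {D : Type u}
    [NonUnitalCStarAlgebra D] (hD : InClassC0' D) {π : D →⋆ₙₐ[ℂ] A} (hπ : Function.Injective π)
    {x y : D} (hx0 : 0 ≤ π x) (hy0 : 0 ≤ π y) : t (π (x + y)) = t (π x) + t (π y) := by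
  let _ : PartialOrder D := CStarAlgebra.spectralOrder D
  have : StarOrderedRing D := CStarAlgebra.spectralOrderedRing D
  classical
  have hpos : ∀ z : D, 0 ≤ z → 0 ≤ π z := fun z hz => map_nonneg π hz
  let s : D → ℝ := fun z => if 0 ≤ z then t (π z) else 0
  have hs : ∀ z, 0 ≤ z → s z = t (π z) := fun z hz => if_pos hz
  have hmem : s ∈ posQuasitraces D := by
    refine ⟨⟨fun a ha => ?_, fun z => ?_, fun a b ha hb hab => ?_, fun r a hr ha => ?_,
      fun a ha => ?_⟩, fun z hz => if_neg hz⟩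
    · rw [hs a ha]; exact ht.nonneg _ (hpos a ha)
    · rw [hs _ (star_mul_self_nonneg z), hs _ (mul_star_self_nonneg z), map_mul, map_mul, map_star,
        ht.tracial]
    · rw [hs _ (add_nonneg ha hb), hs _ ha, hs _ hb, map_add,
        ht.add _ _ (hpos a ha) (hpos b hb) (hab.map π)]
    · rw [hs _ (smul_nonneg hr ha), hs _ ha, ← Complex.coe_smul, map_smul, Complex.coe_smul,
        ht.smul r _ hr (hpos a ha)]
    · rw [hs _ ha, ← NonUnitalStarAlgHom.norm_map π hπ a]
      exact ht.le_norm _ (hpos a ha)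
  obtain ⟨F₁, F₂, _, _, _, _, j, hj, hinv⟩ := hD.exists_embedding
  have hx' : 0 ≤ x := nonneg_of_map_nonneg hπ hx0
  have hy' : 0 ≤ y := nonneg_of_map_nonneg hπ hy0
  have h := IsPosQuasitrace.add_of_loopInvariant hinv hj hmem hx' hy'
  rwa [hs _ (add_nonneg hx' hy'), hs _ hx', hs _ hy'] at h

theorem IsPosQuasitrace.add_of_mem {t : A → ℝ} (ht : IsPosQuasitrace t)
    {D : NonUnitalStarSubalgebra ℂ A} [IsClosed (D : Set A)] (hD : InClassC0' D) {x y : A}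
    (hx : x ∈ D) (hy : y ∈ D) (hx0 : 0 ≤ x) (hy0 : 0 ≤ y) : t (x + y) = t x + t y :=
  ht.add_of_embedding hD (π := NonUnitalStarSubalgebraClass.subtype D) Subtype.val_injective
    (x := ⟨x, hx⟩) (y := ⟨y, hy⟩) hx0 hy0

end Restriction

/-! ### Elementary properties of the cutoff functions -/

section Cutoff

theorem cutoff_eq {ε : ℝ} (hε : 0 < ε) : cutoff ε = fun s => max 0 (min 1 (s / (ε / 2) - 1)) := by
  funext s
  have h2 : 0 < ε / 2 := by positivity
  unfold cutoff
  split_ifs with h h'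
  · have : s / (ε / 2) ≤ 1 := (div_le_one h2).2 h
    rw [max_eq_left]
    exact (min_le_right _ _).trans (by linarith)
  · have h3 : 1 < s / (ε / 2) := (one_lt_div h2).2 (not_le.1 h)
    have h4 : s / (ε / 2) ≤ 2 := (div_le_iff₀ h2).2 (by linarith)
    rw [min_eq_right (by linarith), max_eq_right (by linarith), sub_div, div_self h2.ne']
  · have h4 : 2 ≤ s / (ε / 2) := (le_div_iff₀ h2).2 (by linarith)
    rw [min_eq_left (by linarith), max_eq_right zero_le_one]

theorem continuous_cutoff {ε : ℝ} (hε : 0 < ε) : Continuous (cutoff ε) := by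
  rw [cutoff_eq hε]
  fun_prop

theorem cutoff_nonneg {ε : ℝ} (hε : 0 < ε) (s : ℝ) : 0 ≤ cutoff ε s := by
  rw [cutoff_eq hε]
  exact le_max_left _ _

theorem cutoff_le_one {ε : ℝ} (hε : 0 < ε) (s : ℝ) : cutoff ε s ≤ 1 := by
  rw [cutoff_eq hε]
  simp

theorem cutoff_zero {ε : ℝ} (hε : 0 < ε) : cutoff ε 0 = 0 := by
  rw [cutoff_eq hε]
  simp

theorem cutoff_eq_one {ε s : ℝ} (hε : 0 < ε) (h : ε ≤ s) : cutoff ε s = 1 := by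
  have h4 : 2 ≤ s / (ε / 2) := (le_div_iff₀ (by positivity)).2 (by linarith)
  rw [cutoff_eq hε]
  show max 0 (min 1 (s / (ε / 2) - 1)) = 1
  rw [min_eq_left (by linarith), max_eq_right zero_le_one]

theorem cutoff_le {ε s : ℝ} (hε : 0 < ε) (hs : 0 ≤ s) : cutoff ε s ≤ 2 / ε * s := by
  have h : s / (ε / 2) = 2 / ε * s := by field_simp
  rw [cutoff_eq hε]
  show max 0 (min 1 (s / (ε / 2) - 1)) ≤ _
  rw [h]
  exact max_le (by positivity) ((min_le_right _ _).trans (by linarith))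

end Cutoff

/-! ### Nonzero elements of small dimension -/

section Dimension

/-- On a finite spectrum the indicator of the nonzero points is continuous, so c would have a
support projection in D. That projection must be 0. -/
theorem InClassC0'.infinite_quasispectrum {A : Type u}
    [NonUnitalCStarAlgebra A] {D : NonUnitalStarSubalgebra ℂ A}
    [IsClosed (D : Set A)] (hD : InClassC0' D) {c : A} (hcD : c ∈ D)
    (hc : IsSelfAdjoint c) (hne : c ≠ 0) :
    (quasispectrum ℝ c).Infinite := by
  intro hfin
  let f : ℝ → ℝ := fun s => if s = 0 then 0 else 1
  have hf : ContinuousOn f (quasispectrum ℝ c) := by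
    have := hfin.to_subtype
    rw [continuousOn_iff_continuous_domRestrict]
    exact continuous_of_discreteTopology
  have hf0 : f 0 = 0 := if_pos rfl
  have hp : IsStarProjection (cfcₙ f c) := by
    refine ⟨?_, IsSelfAdjoint.cfcₙ⟩
    exact cfcn_mul_eq hf hf hf0 hf0 fun s _ => by by_cases h : s = 0 <;> simp [f, h]
  have hmem : cfcₙ f c ∈ D := cfcₙ_mem (𝕜' := ℂ) f hcD
  have h0 : cfcₙ f c = 0 := by
    refine congrArg Subtype.val (hD.eq_zero_of_isStarProjection (p := ⟨_, hmem⟩) ⟨?_, ?_⟩)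
    · exact Subtype.ext hp.isIdempotentElem
    · exact Subtype.ext hp.isSelfAdjoint
  refine hne ?_
  rw [← cfcₙ_id ℝ c, ← cfcₙ_zero ℝ c]
  refine cfcₙ_congr fun s hs => ?_
  have h1 := norm_apply_le_norm_cfcₙ f c hs hf hf0 hc
  rw [h0, norm_zero, norm_le_zero_iff] at h1
  by_contra hs0
  simp [f] at h1
  exact hs0 h1

variable {A : Type u} [NonUnitalCStarAlgebra A] [PartialOrder A] [StarOrderedRing A]

/-- The dimension function of `t` is at most `δ` at `b`. -/
def DimLE (t : A → ℝ) (δ : ℝ) (b : A) : Prop := ∀ ε : ℝ, 0 < ε → t (cfcₙ (cutoff ε) b) ≤ δ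

variable {t : A → ℝ}

/-- With y = b^(1/2) x the trace identity replaces y⋆y by yy⋆, which is nearly supported under a
cutoff g of b: g yy⋆ g ≤ ‖y‖² g, and t(g) ≤ δ. -/
theorem IsPosQuasitrace.conjugate_le (ht : IsPosQuasitrace t) {b : A} (hb : 0 ≤ b) {δ : ℝ}
    (hδ : DimLE t δ b) (x : A) : t (star x * b * x) ≤ ‖star x * b * x‖ * δ := by
  set s := cfcₙ Real.sqrt b
  have hs : IsSelfAdjoint s := IsSelfAdjoint.cfcₙ
  have hss : s * s = b := cfcn_sqrt_mul_self hb
  set y := s * x with hy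
  have hyy : star x * b * x = star y * y := by
    rw [hy, star_mul, hs.star_eq, ← hss]
    simp only [mul_assoc]
  have hnorm : ‖star y * y‖ = ‖y‖ * ‖y‖ := CStarRing.norm_star_mul_self
  rw [hyy, hnorm, ht.tracial]
  have hspec : ∀ r ∈ quasispectrum ℝ b, 0 ≤ r := quasispectrum_nonneg_of_nonneg b hb
  have key : ∀ n : ℕ, t (y * star y) ≤
      ‖y‖ * ‖y‖ * δ + 2 * (2 * ‖y‖ * ‖x‖) * (1 / ((n : ℝ) + 1)) := by
    intro n
    set η : ℝ := 1 / ((n : ℝ) + 1)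
    have hη : 0 < η := by positivity
    have hη2 : 0 < η ^ 2 := by positivity
    -- The level is η² because the error is measured at b^(1/2): what is cut off there has norm at
    -- most η.
    set g := cfcₙ (cutoff (η ^ 2)) b
    have hg : IsSelfAdjoint g := IsSelfAdjoint.cfcₙ
    have hg0 : 0 ≤ g := cfcₙ_nonneg fun s _ => cutoff_nonneg hη2 s
    have hg1 : ‖g‖ ≤ 1 := norm_cfcₙ_le fun s _ => by
      rw [Real.norm_of_nonneg (cutoff_nonneg hη2 s)]
      exact cutoff_le_one hη2 s
    have h1 : ‖s - g * s‖ ≤ η := by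
      refine norm_sub_cfcn_mul_le hs hss hb le_rfl (continuous_cutoff hη2).continuousOn
        (cutoff_zero hη2) hη.le fun r hr => ?_
      have hr0 := hspec r hr
      have hc0 := cutoff_nonneg hη2 r
      have hc1 := cutoff_le_one hη2 r
      rw [abs_of_nonneg (by positivity)]
      rcases le_total (η ^ 2) r with h | h
      · rw [cutoff_eq_one hη2 h]; simp; positivity
      · have : (1 - cutoff (η ^ 2) r) ^ 2 ≤ 1 := by nlinarith
        nlinarith
    have h2 : ‖y - g * y‖ ≤ η * ‖x‖ := by
      have : y - g * y = (s - g * s) * x := by rw [hy, sub_mul, mul_assoc]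
      rw [this]
      exact (norm_mul_le _ _).trans (by gcongr)
    have h3 : ‖g * y‖ ≤ ‖y‖ := (norm_mul_le _ _).trans (by nlinarith [norm_nonneg y])
    have h4 : ‖y * star y - (g * y) * star (g * y)‖ ≤ 2 * ‖y‖ * ‖x‖ * η := by
      have : y * star y - (g * y) * star (g * y) =
          (y - g * y) * star y + (g * y) * star (y - g * y) := by
        rw [star_sub]; noncomm_ring
      rw [this]
      refine (norm_add_le _ _).trans ?_
      have ha := norm_mul_le (y - g * y) (star y)
      have hb := norm_mul_le (g * y) (star (y - g * y))
      rw [norm_star] at ha hb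
      nlinarith [norm_nonneg y, norm_nonneg (y - g * y), norm_nonneg (g * y)]
    have h5 : t ((g * y) * star (g * y)) ≤ ‖y‖ * ‖y‖ * δ := by
      have hle : (g * y) * star (g * y) ≤ (‖y‖ * ‖y‖) • g := by
        have h6 := CStarAlgebra.star_left_conjugate_le_norm_smul (a := g) (b := y * star y)
          (IsSelfAdjoint.mul_star_self y)
        rw [CStarRing.norm_self_mul_star, hg.star_eq] at h6
        calc (g * y) * star (g * y) = g * (y * star y) * g := by
              rw [star_mul, hg.star_eq]; simp only [mul_assoc]
          _ ≤ (‖y‖ * ‖y‖) • (g * g) := h6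
          _ ≤ (‖y‖ * ‖y‖) • g :=
            smul_le_smul_of_nonneg_left (mul_self_le_self hg0 hg1) (by positivity)
      refine (ht.mono (mul_star_self_nonneg _) hle).trans ?_
      rw [ht.smul _ _ (by positivity) hg0]
      exact mul_le_mul_of_nonneg_left (hδ _ hη2) (by positivity)
    have h6 := ht.abs_sub_le (mul_star_self_nonneg (g * y)) (mul_star_self_nonneg y)
    have h7 := (abs_le.1 h6).2
    nlinarith
  have hlim : Filter.Tendsto
      (fun n : ℕ => ‖y‖ * ‖y‖ * δ + 2 * (2 * ‖y‖ * ‖x‖) * (1 / ((n : ℝ) + 1)))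
      Filter.atTop (𝓝 (‖y‖ * ‖y‖ * δ + 2 * (2 * ‖y‖ * ‖x‖) * 0)) :=
    (tendsto_one_div_add_atTop_nhds_zero_nat.const_mul _).const_add _
  simpa using ge_of_tendsto' hlim key

theorem CuntzLE.le_of_dimLE {p b : A} (h : CuntzLE p b) (ht : IsPosQuasitrace t) (hp : 0 ≤ p)
    (hb : 0 ≤ b) {δ : ℝ} (hδ : DimLE t δ b) : t p ≤ ‖p‖ * δ := by
  obtain ⟨x, hx⟩ := h
  have hlim : Filter.Tendsto (fun n => ‖star (x n) * b * x n‖ * δ + 2 * ‖p - star (x n) * b * x n‖)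
      Filter.atTop (𝓝 (‖p‖ * δ + 2 * ‖p - p‖)) :=
    (hx.norm.mul_const _).add ((hx.const_sub p).norm.const_mul 2)
  rw [sub_self, norm_zero, mul_zero, add_zero] at hlim
  refine ge_of_tendsto' hlim fun n => ?_
  have h1 := ht.conjugate_le hb hδ (x n)
  have h2 := (abs_le.1 (ht.abs_sub_le (star_left_conjugate_nonneg hb (x n)) hp)).2
  linarith

theorem IsPosQuasitrace.exists_dimLE (ht : IsPosQuasitrace t) {c : A} (hc : IsSelfAdjoint c)
    (hinf : (quasispectrum ℝ c).Infinite) {δ : ℝ} (hδ : 0 < δ) :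
    ∃ b : A, 0 ≤ b ∧ b ≠ 0 ∧ DimLE t δ b := by
  -- N disjoint bumps around nonzero spectral points give orthogonal nonzero elements. If each had a
  -- cutoff with t above δ, the sum of these cutoffs, of norm at most 1, would have t at least Nδ >
  -- 1.
  obtain ⟨N, hN⟩ := exists_nat_gt (1 / δ)
  have hinf' : (quasispectrum ℝ c \ {0}).Infinite := hinf.sdiff (Set.finite_singleton 0)
  let s : ℕ → ℝ := fun k => Set.Infinite.natEmbedding _ hinf' k
  have hs : ∀ k, s k ∈ quasispectrum ℝ c ∧ s k ≠ 0 := fun k =>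
    (Set.Infinite.natEmbedding _ hinf' k).2
  have hsinj : ∀ k l, k ≠ l → s k ≠ s l := fun k l h h' =>
    h ((Set.Infinite.natEmbedding _ hinf').injective (Subtype.ext h'))
  have hev : ∀ x : ℝ, 0 < x → ∀ᶠ r in 𝓝[>] (0 : ℝ), 2 * r ≤ x := fun x hx => by
    filter_upwards [Ioo_mem_nhdsGT (show 0 < x / 2 by positivity)] with r hr
    linarith [hr.2]
  obtain ⟨r, ⟨hr1, hr2⟩, hr0⟩ : ∃ r : ℝ, ((∀ k ∈ Finset.range N, 2 * r ≤ |s k|) ∧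
      ∀ k ∈ Finset.range N, ∀ l ∈ Finset.range N, k ≠ l → 2 * r ≤ |s k - s l|) ∧ 0 < r := by
    refine Filter.Eventually.exists (f := 𝓝[>] (0 : ℝ)) ((Filter.Eventually.and ?_ ?_).and
      self_mem_nhdsWithin)
    · exact (Finset.eventually_all _).2 fun k _ => hev _ (abs_pos.2 (hs k).2)
    · refine (Finset.eventually_all _).2 fun k _ => (Finset.eventually_all _).2 fun l _ => ?_
      by_cases hkl : k = l
      · exact Filter.Eventually.of_forall fun r h => absurd hkl h
      · filter_upwards [hev _ (abs_pos.2 (sub_ne_zero.2 (hsinj k l hkl)))] with r hr _ using hr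
  -- The value 0 for k ≥ N makes continuity and vanishing at 0 hold for all k, as `cfcn_sum_range`
  -- requires.
  let F : ℕ → ℝ → ℝ := fun k x => if k ∈ Finset.range N then max 0 (1 - |x - s k| / r) else 0
  have hFc : ∀ k, Continuous (F k) := fun k => by
    by_cases hk : k ∈ Finset.range N <;> simp only [F, hk, if_true, if_false] <;> fun_prop
  have hFz : ∀ k x, r ≤ |x - s k| → F k x = 0 := fun k x h => by
    by_cases hk : k ∈ Finset.range N <;> simp only [F, hk, if_true, if_false]
    rw [max_eq_left]
    have := (one_le_div hr0).2 h
    linarith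
  have hF0 : ∀ k, F k 0 = 0 := fun k => by
    by_cases hk : k ∈ Finset.range N
    · refine hFz k 0 ?_
      have := hr1 k hk
      rw [zero_sub, abs_neg]
      linarith
    · simp only [F, hk, if_false]
  have hFn : ∀ k x, 0 ≤ F k x := fun k x => by
    by_cases hk : k ∈ Finset.range N <;> simp only [F, hk, if_true, if_false, le_refl, le_max_left]
  have hF1 : ∀ k ∈ Finset.range N, F k (s k) = 1 := fun k hk => by
    simp only [F, hk, if_true]
    simp
  by_contra! hcon
  have hex : ∀ k ∈ Finset.range N, ∃ ε : ℝ, 0 < ε ∧ δ < t (cfcₙ (cutoff ε) (cfcₙ (F k) c)) := by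
    intro k hk
    have hne : cfcₙ (F k) c ≠ 0 := fun h0 => by
      have h1 := norm_apply_le_norm_cfcₙ (F k) c (hs k).1 (hFc k).continuousOn (hF0 k) hc
      rw [h0, hF1 k hk] at h1
      norm_num at h1
    have h2 := hcon _ (cfcₙ_nonneg fun x _ => hFn k x) hne
    simpa [DimLE] using h2
  choose! ε hε hlt using hex
  have hε' : ∀ k, 0 < (fun k => if k ∈ Finset.range N then ε k else 1) k := fun k => by
    by_cases hk : k ∈ Finset.range N
    · simpa only [hk, if_true] using hε k hk
    · simp only [hk, if_false, zero_lt_one]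
  set ε' : ℕ → ℝ := fun k => if k ∈ Finset.range N then ε k else 1 with hεdef
  have hGc : ∀ k, Continuous fun x => cutoff (ε' k) (F k x) := fun k =>
    (continuous_cutoff (hε' k)).comp (hFc k)
  have hG0 : ∀ k, cutoff (ε' k) (F k 0) = 0 := fun k => by rw [hF0, cutoff_zero (hε' k)]
  have hsum := ht.cfcn_sum_range c (fun k x => cutoff (ε' k) (F k x)) hGc hG0
    (fun k x => cutoff_nonneg (hε' k) _) N
  have hle : t (cfcₙ (fun x => ∑ k ∈ Finset.range N, cutoff (ε' k) (F k x)) c) ≤ 1 := by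
    have hn : ∀ x, 0 ≤ ∑ k ∈ Finset.range N, cutoff (ε' k) (F k x) := fun x =>
      Finset.sum_nonneg fun k _ => cutoff_nonneg (hε' k) _
    refine (ht.le_norm _ (cfcₙ_nonneg fun x _ => hn x)).trans (norm_cfcₙ_le fun x _ => ?_)
    rw [Real.norm_of_nonneg (hn x)]
    by_cases h : ∃ k ∈ Finset.range N, |x - s k| < r
    · obtain ⟨k, hk, hkr⟩ := h
      rw [Finset.sum_eq_single_of_mem k hk]
      · exact cutoff_le_one (hε' k) _
      · intro l hl hlk
        have h1 := hr2 k hk l hl hlk.symm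
        have h2 : |s k - s l| ≤ |x - s l| + |x - s k| := by
          rw [abs_sub_comm x (s k), add_comm]
          exact _root_.abs_sub_le _ _ _
        rw [hFz l x (by linarith), cutoff_zero (hε' l)]
    · push Not at h
      rw [Finset.sum_eq_zero fun k hk => by rw [hFz k x (h k hk), cutoff_zero (hε' k)]]
      exact zero_le_one
  rw [hsum] at hle
  have hge : ∑ _k ∈ Finset.range N, δ ≤
      ∑ k ∈ Finset.range N, t (cfcₙ (fun x => cutoff (ε' k) (F k x)) c) := by
    refine Finset.sum_le_sum fun k hk => ?_
    rw [cfcₙ_comp' (cutoff (ε' k)) (F k) c (continuous_cutoff (hε' k)).continuousOn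
      (cutoff_zero (hε' k)) (hFc k).continuousOn (hF0 k) hc]
    have : ε' k = ε k := by simp only [hεdef, hk, if_true]
    rw [this]
    exact (hlt k hk).le
  rw [Finset.sum_const, Finset.card_range, nsmul_eq_mul] at hge
  rw [div_lt_iff₀ hδ] at hN
  linarith

end Dimension

/-! ### From the quasitrace axioms to values on the positive cone -/

section OfQuasitrace

variable {A : Type u} [NonUnitalCStarAlgebra A] {τ : A → ℂ}

theorem exists_commutative_of_commute {a b : A} (ha : IsSelfAdjoint a) (hb : IsSelfAdjoint b)
    (hab : Commute a b) : ∃ S : NonUnitalStarSubalgebra ℂ A, (∀ x ∈ S, ∀ y ∈ S, x * y = y * x) ∧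
      a ∈ S ∧ b ∈ S := by
  have : IsMulCommutative (NonUnitalStarAlgebra.adjoin ℂ {a, b}) := by
    refine NonUnitalStarAlgebra.isMulCommutative_adjoin ℂ ?_ ?_
    · rintro x (rfl | rfl) y (rfl | rfl)
      exacts [rfl, hab.eq, hab.eq.symm, rfl]
    · rintro x (rfl | rfl) y (rfl | rfl) <;> simp only [ha.star_eq, hb.star_eq]
      exacts [hab.eq, hab.eq.symm]
  refine ⟨NonUnitalStarAlgebra.adjoin ℂ {a, b}, fun x hx y hy => ?_,
    NonUnitalStarAlgebra.subset_adjoin ℂ _ (by simp),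
    NonUnitalStarAlgebra.subset_adjoin ℂ _ (by simp)⟩
  exact congrArg Subtype.val (IsMulCommutative.is_comm.comm
    (⟨x, hx⟩ : NonUnitalStarAlgebra.adjoin ℂ {a, b}) ⟨y, hy⟩)

theorem IsOneQuasitrace.map_add (hτ : IsOneQuasitrace τ) {a b : A} (ha : IsSelfAdjoint a)
    (hb : IsSelfAdjoint b) (hab : Commute a b) : τ (a + b) = τ a + τ b := by
  obtain ⟨S, hS, haS, hbS⟩ := exists_commutative_of_commute ha hb hab
  exact hτ.add_of_comm S hS a haS b hbS

theorem IsOneQuasitrace.map_smul (hτ : IsOneQuasitrace τ) {a : A} (ha : IsSelfAdjoint a) (c : ℂ) :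
    τ (c • a) = c * τ a := by
  obtain ⟨S, hS, haS, -⟩ := exists_commutative_of_commute ha ha (Commute.refl a)
  exact hτ.smul_of_comm S hS a haS c

variable [PartialOrder A] [StarOrderedRing A]

theorem IsOneQuasitrace.map_nonneg (hτ : IsOneQuasitrace τ) {a : A} (ha : 0 ≤ a) : 0 ≤ τ a := by
  obtain ⟨x, rfl⟩ := CStarAlgebra.nonneg_iff_eq_star_mul_self.1 ha
  exact hτ.nonneg x

theorem isPosQuasitrace_re (hτ : τ ∈ normalizedQuasitraces A) :
    IsPosQuasitrace fun x => (τ x).re := by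
  obtain ⟨⟨hτ, -⟩, hlub⟩ := hτ
  have hsmul : ∀ (r : ℝ) (a : A), 0 ≤ r → 0 ≤ a → (τ (r • a)).re = r * (τ a).re := by
    intro r a hr ha
    rw [← Complex.coe_smul, hτ.map_smul ha.isSelfAdjoint, Complex.re_ofReal_mul]
  refine ⟨fun a ha => (Complex.nonneg_iff.1 (hτ.map_nonneg ha)).1, fun x => by rw [hτ.tracial],
    fun a b ha hb hab => ?_, hsmul, fun a ha => ?_⟩
  · rw [hτ.map_add ha.isSelfAdjoint hb.isSelfAdjoint hab, Complex.add_re]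
  · rcases eq_or_ne a 0 with rfl | hne
    · have := hsmul 0 0 le_rfl le_rfl
      simp at this
      simp [this]
    · have hn : 0 < ‖a‖ := norm_pos_iff.2 hne
      have h0 : 0 ≤ ‖a‖⁻¹ • a := smul_nonneg (by positivity) ha
      obtain ⟨x, hx⟩ := CStarAlgebra.nonneg_iff_eq_star_mul_self.1 h0
      have h1 : (τ (‖a‖⁻¹ • a)).re ≤ 1 := hlub.1 ⟨x, by
        rw [← hx, norm_smul, norm_inv, norm_norm, inv_mul_cancel₀ hn.ne'], by rw [hx]⟩
      rw [hsmul _ _ (by positivity) ha, inv_mul_le_iff₀ hn, mul_one] at h1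
      exact h1

end OfQuasitrace

/-! ### Additivity of quasitraces on algebras in 𝒟 -/

section Approximation

variable {A : Type u} [NonUnitalCStarAlgebra A] [PartialOrder A] [StarOrderedRing A]

/-- Approximate x^(1/2) by some awa; then (awa)(awa)⋆ is at most a multiple of a², hence of a. -/
theorem IsStrictlyPos.exists_le_smul {a : A} (ha : IsStrictlyPos a) (ha1 : ‖a‖ ≤ 1) {x : A}
    (hx : 0 ≤ x) {η : ℝ} (hη : 0 < η) :
    ∃ (y : A) (K : ℝ), 0 ≤ y ∧ 0 ≤ K ∧ ‖x - y‖ < η ∧ y ≤ K • a := by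
  set s := cfcₙ Real.sqrt x
  have hs : IsSelfAdjoint s := IsSelfAdjoint.cfcₙ
  have hss : s * s = x := cfcn_sqrt_mul_self hx
  let U : Set A := {z | ‖x - z * star z‖ < η}
  have hU : IsOpen U := isOpen_lt (by fun_prop) continuous_const
  obtain ⟨_, hz, w, rfl⟩ := ha.2.inter_open_nonempty U hU
    ⟨s, by simpa [U, hs.star_eq, hss] using hη⟩
  refine ⟨(a * w * a) * star (a * w * a), ‖w * a * star (w * a)‖, mul_star_self_nonneg _,
    norm_nonneg _, hz, ?_⟩
  have h1 := CStarAlgebra.star_left_conjugate_le_norm_smul (a := a) (b := w * a * star (w * a))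
    (IsSelfAdjoint.mul_star_self _)
  rw [ha.1.isSelfAdjoint.star_eq] at h1
  calc (a * w * a) * star (a * w * a) = a * (w * a * star (w * a)) * a := by
        simp only [star_mul, ha.1.isSelfAdjoint.star_eq, mul_assoc]
    _ ≤ ‖w * a * star (w * a)‖ • (a * a) := h1
    _ ≤ ‖w * a * star (w * a)‖ • a :=
      smul_le_smul_of_nonneg_left (mul_self_le_self ha.1 ha1) (norm_nonneg _)

/-- The approximations in the definition of the class `𝒟` exist for `a` and the constant `f`. -/
def ApproxProperty (a : A) (f : ℝ) : Prop :=
  ∀ ε : ℝ, 0 < ε → ∀ (F : Finset A) (b : A), 0 ≤ b → b ≠ 0 → HasApprox a f ε F b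

variable {a : A} {f : ℝ} {t : A → ℝ}

/-- Any one approximation supplies a nonzero projectionless subalgebra, hence a self-adjoint element
with infinite spectrum. -/
theorem ApproxProperty.exists_dimLE (h : ApproxProperty a f) (ha : 0 ≤ a) (ha0 : a ≠ 0)
    (ht : IsPosQuasitrace t) {δ : ℝ} (hδ : 0 < δ) : ∃ b : A, 0 ≤ b ∧ b ≠ 0 ∧ DimLE t δ b := by
  obtain ⟨D, hDc, -, -, -, -, -, -, -, -, -, -, hD, -⟩ := h 1 one_pos ∅ a ha ha0
  have := hD.nontrivial
  obtain ⟨⟨x, hx⟩, hne⟩ := exists_ne (0 : D)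
  have hx0 : x ≠ 0 := fun h => hne (Subtype.ext h)
  have hsa : IsSelfAdjoint (star x * x) := IsSelfAdjoint.star_mul_self x
  exact ht.exists_dimLE hsa (hD.infinite_quasispectrum (mul_mem (star_mem hx) hx) hsa
    fun h => hx0 (CStarRing.star_mul_self_eq_zero_iff x |>.1 h)) hδ

theorem ApproxProperty.exists_abs_sub_le (h : ApproxProperty a f) (ha : IsStrictlyPos a)
    (ha1 : ‖a‖ = 1) (ht : IsPosQuasitrace t) (F : Finset A) {η : ℝ} (hη : 0 < η) :
    ∃ (D : NonUnitalStarSubalgebra ℂ A) (_ : IsClosed (D : Set A)) (ψ : A →CP A)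
      (hψ : ∀ x, ψ x ∈ D), InClassC0' D ∧ (∀ x, ‖ψ x‖ ≤ ‖x‖) ∧
      (∀ s ∈ tracialStates D, f ≤ (s (cfcₙ (cutoff (1 / 4)) (⟨ψ a, hψ a⟩ : D))).re) ∧
      ∀ x ∈ F, 0 ≤ x → |t x - t (ψ x)| ≤ η := by
  have ha0 : a ≠ 0 := fun h0 => by simp [h0] at ha1
  have hη8 : 0 < η / 8 := by positivity
  have hdom : ∀ x : A, ∃ (y : A) (K : ℝ), 0 ≤ x → 0 ≤ y ∧ 0 ≤ K ∧ ‖x - y‖ < η / 8 ∧ y ≤ K • a := by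
    intro x
    by_cases hx : 0 ≤ x
    · obtain ⟨y, K, hy⟩ := ha.exists_le_smul ha1.le hx hη8
      exact ⟨y, K, fun _ => hy⟩
    · exact ⟨0, 0, fun h => absurd h hx⟩
  choose y K hyK using hdom
  obtain ⟨M, hM⟩ : ∃ M : ℝ, ∀ x ∈ F, K x ≤ M := by
    obtain ⟨M, hM⟩ := (F.finite_toSet.image K).bddAbove
    exact ⟨M, fun x hx => hM ⟨x, hx, rfl⟩⟩
  -- The order of choices matters: M bounds the multiples of a that dominate the approximants of F,
  -- and b is chosen afterwards so small that M · t(φ a) is negligible.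
  obtain ⟨b, hb, hb0, hbδ⟩ := h.exists_dimLE ha.1 ha0 ht
    (show 0 < η / 8 / (|M| + 1) by positivity)
  obtain ⟨D, hDc, φ, ψ, hψ, hφn, hψn, -, -, hφD, hF, -, hD, hcuntz, hf⟩ := h _ hη8 F b hb hb0
  refine ⟨D, hDc, ψ, hψ, hD, hψn, hf, fun x hx hx0 => ?_⟩
  obtain ⟨hy0, hK0, hxy, hya⟩ := hyK x hx0
  have hφx : 0 ≤ φ x := map_nonneg φ hx0
  have hψx : 0 ≤ ψ x := map_nonneg ψ hx0
  have hφa : 0 ≤ φ a := map_nonneg φ ha.1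
  have h1 : t (φ a) ≤ η / 8 / (|M| + 1) := by
    refine (hcuntz.le_of_dimLE ht hφa hb hbδ).trans ?_
    have : ‖φ a‖ ≤ 1 := ha1 ▸ hφn a
    exact mul_le_of_le_one_left (by positivity) this
  have h2 : t (φ (y x)) ≤ η / 8 := by
    have hle : φ (y x) ≤ K x • φ a := by
      have := OrderHomClass.mono φ hya
      rwa [← Complex.coe_smul, map_smul, Complex.coe_smul] at this
    refine (ht.mono (map_nonneg φ hy0) hle).trans ?_
    rw [ht.smul _ _ hK0 hφa]
    have hKM : K x ≤ |M| + 1 := (hM x hx).trans ((le_abs_self M).trans (by linarith))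
    calc K x * t (φ a) ≤ (|M| + 1) * (η / 8 / (|M| + 1)) :=
          mul_le_mul hKM h1 (ht.nonneg _ hφa) (by positivity)
      _ = η / 8 := by field_simp
  have h3 : t (φ x) ≤ η / 8 + 2 * (η / 8) := by
    have h4 := (abs_le.1 (ht.abs_sub_le (map_nonneg φ hy0) hφx)).2
    have h5 : ‖φ x - φ (y x)‖ ≤ ‖x - y x‖ := by rw [← map_sub]; exact hφn _
    linarith
  -- The two summands are orthogonal, since φ(A) annihilates D.
  have h4 : t (φ x + ψ x) = t (φ x) + t (ψ x) := by
    refine ht.add _ _ hφx hψx ?_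
    have h5 : φ x * ψ x = 0 := hφD x _ (hψ x)
    have h6 : ψ x * φ x = 0 := by
      have := congrArg star h5
      rwa [star_mul, hφx.isSelfAdjoint.star_eq, hψx.isSelfAdjoint.star_eq, star_zero] at this
    rw [commute_iff_eq, h5, h6]
  have h5 := ht.abs_sub_le (add_nonneg hφx hψx) hx0
  have h6 := hF x hx
  have h7 := ht.nonneg _ hφx
  rw [abs_le] at h5 ⊢
  constructor <;> linarith

/-- On algebras in the class `𝒟`, quasitraces are additive. -/
theorem ApproxProperty.add (h : ApproxProperty a f) (ha : IsStrictlyPos a) (ha1 : ‖a‖ = 1)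
    (ht : IsPosQuasitrace t) {x y : A} (hx : 0 ≤ x) (hy : 0 ≤ y) : t (x + y) = t x + t y := by
  classical
  refine eq_of_forall_dist_le fun η hη => ?_
  obtain ⟨D, hDc, ψ, hψ, hD, -, -, hF⟩ := h.exists_abs_sub_le ha ha1 ht {x, y, x + y}
    (show 0 < η / 3 by positivity)
  have h1 := abs_le.1 (hF x (by simp) hx)
  have h2 := abs_le.1 (hF y (by simp) hy)
  have h3 := abs_le.1 (hF (x + y) (by simp) (add_nonneg hx hy))
  rw [map_add, ht.add_of_mem hD (hψ x) (hψ y) (map_nonneg ψ hx) (map_nonneg ψ hy)] at h3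
  rw [Real.dist_eq, abs_le]
  constructor <;> linarith

end Approximation

/-! ### Positive functionals: trace identity and norm -/

section PositiveFunctional

variable {A : Type u} [NonUnitalCStarAlgebra A]

/-- Polarization with x + y and x + iy. -/
theorem map_mul_comm_of_star {σ : A →ₗ[ℂ] ℂ} (h : ∀ x, σ (star x * x) = σ (x * star x)) (x y : A) :
    σ (x * y) = σ (y * x) := by
  have key : ∀ x y : A, σ (star x * y) = σ (y * star x) := by
    intro x y
    have h1 := h (x + y)
    have h2 := h (x + Complex.I • y)
    simp only [star_add, star_smul, add_mul, mul_add, smul_mul_assoc, mul_smul_comm, map_add,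
      map_smul, smul_eq_mul, Complex.star_def, Complex.conj_I, h x, h y] at h1 h2
    have h3 : σ (star x * y) + σ (star y * x) = σ (y * star x) + σ (x * star y) := by
      linear_combination h1
    have h4 : σ (star x * y) - σ (star y * x) = σ (y * star x) - σ (x * star y) := by
      have := Complex.I_ne_zero
      refine mul_left_cancel₀ this ?_
      linear_combination h2
    linear_combination (h3 + h4) / 2
  simpa using key (star x) y

variable [PartialOrder A] [StarOrderedRing A]

theorem norm_apply_star_mul_sq_le {σ : A →ₗ[ℂ] ℂ} (hσ : ∀ x, 0 ≤ σ (star x * x)) (x y : A) :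
    ‖σ (star x * y)‖ ^ 2 ≤ (σ (star x * x)).re * (σ (star y * y)).re := by
  let g : A →ₚ[ℂ] ℂ := PositiveLinearMap.mk₀ σ fun z hz => by
    obtain ⟨w, rfl⟩ := CStarAlgebra.nonneg_iff_eq_star_mul_self.1 hz
    exact hσ w
  have h : ‖g (star x * y)‖ ≤ √(g (star x * x)).re * √(g (star y * y)).re :=
    norm_inner_le_norm (𝕜 := ℂ) (g.toPreGNS x) (g.toPreGNS y)
  have hx : 0 ≤ (g (star x * x)).re := (Complex.nonneg_iff.1 (hσ x)).1
  have hy : 0 ≤ (g (star y * y)).re := (Complex.nonneg_iff.1 (hσ y)).1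
  calc ‖g (star x * y)‖ ^ 2 ≤ (√(g (star x * x)).re * √(g (star y * y)).re) ^ 2 := by gcongr
    _ = (g (star x * x)).re * (g (star y * y)).re := by
      rw [mul_pow, Real.sq_sqrt hx, Real.sq_sqrt hy]

/-- Cauchy–Schwarz applied to σ(ez), with e running through an approximate unit. This matches the
functional norm with the norm used for quasitraces. -/
theorem norm_le_of_forall_star_mul_self_le {σ : A →L[ℂ] ℂ} (hσ : ∀ x, 0 ≤ σ (star x * x)) {u : ℝ}
    (hu : ∀ x : A, ‖star x * x‖ ≤ 1 → (σ (star x * x)).re ≤ u) : ‖σ‖ ≤ u := by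
  have hu0 : 0 ≤ u := by simpa using hu 0 (by simp)
  have hscale : ∀ z : A, (σ (star z * z)).re ≤ u * ‖z‖ ^ 2 := by
    intro z
    rcases eq_or_ne z 0 with rfl | hz
    · simp
    have hz0 : 0 < ‖z‖ := norm_pos_iff.2 hz
    have h1 : star (((‖z‖⁻¹ : ℝ) : ℂ) • z) * (((‖z‖⁻¹ : ℝ) : ℂ) • z) =
        (((‖z‖⁻¹) ^ 2 : ℝ) : ℂ) • (star z * z) := by
      rw [star_smul, smul_mul_smul_comm, Complex.star_def, Complex.conj_ofReal,
        ← Complex.ofReal_mul, ← sq]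
    have h2 := hu (((‖z‖⁻¹ : ℝ) : ℂ) • z) (by
      rw [CStarRing.norm_star_mul_self, norm_smul, Complex.norm_real, norm_inv, norm_norm,
        inv_mul_cancel₀ hz0.ne', one_mul])
    rw [h1, map_smul, smul_eq_mul, Complex.re_ofReal_mul, inv_pow, inv_mul_le_iff₀ (by positivity)]
      at h2
    linarith
  refine σ.opNorm_le_bound hu0 fun z => ?_
  have hl := CStarAlgebra.increasingApproximateUnit A
  have := hl.neBot
  have htend : Filter.Tendsto (fun e : A => ‖σ (e * z)‖) (CStarAlgebra.approximateUnit A)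
      (𝓝 ‖σ z‖) := ((σ.continuous.tendsto z).comp (hl.tendsto_mul_right z)).norm
  refine le_of_tendsto htend ?_
  filter_upwards [hl.eventually_star_eq, hl.eventually_norm] with e he1 he2
  have h1 := norm_apply_star_mul_sq_le (σ := (σ : A →ₗ[ℂ] ℂ)) hσ e z
  simp only [ContinuousLinearMap.coe_coe] at h1
  have h2 : (σ (star e * e)).re ≤ u := (hscale e).trans
    (mul_le_of_le_one_right hu0 (pow_le_one₀ (norm_nonneg e) he2))
  rw [he1] at h1 h2
  have h3 : 0 ≤ (σ (star z * z)).re := (Complex.nonneg_iff.1 (hσ z)).1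
  refine abs_le_of_sq_le_sq' ?_ (by positivity) |>.2
  calc ‖σ (e * z)‖ ^ 2 ≤ _ := h1
    _ ≤ u * (u * ‖z‖ ^ 2) := mul_le_mul h2 (hscale z) h3 hu0
    _ = (u * ‖z‖) ^ 2 := by ring

theorem isLUB_of_norm_eq_one {σ : A →L[ℂ] ℂ} (hσ : ∀ x, 0 ≤ σ (star x * x)) (h1 : ‖σ‖ = 1) :
    IsLUB {r : ℝ | ∃ x : A, ‖star x * x‖ ≤ 1 ∧ r = (σ (star x * x)).re} 1 := by
  refine ⟨?_, fun u hu => ?_⟩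
  · rintro _ ⟨x, hx, rfl⟩
    refine (Complex.re_le_norm _).trans ((σ.le_opNorm _).trans ?_)
    rwa [h1, one_mul]
  · rw [← h1]
    exact norm_le_of_forall_star_mul_self_le hσ fun x hx => hu ⟨x, hx, rfl⟩

end PositiveFunctional

/-! ### Tracial states are quasitraces -/

section TraceIsQuasitrace

theorem isOneQuasitrace_of_linearMap {R : Type u} [NonUnitalRing R] [StarRing R] [Module ℂ R]
    {σ : R →ₗ[ℂ] ℂ} (hpos : ∀ x, 0 ≤ σ (star x * x)) (htr : ∀ x, σ (star x * x) = σ (x * star x)) :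
    IsOneQuasitrace σ where
  nonneg := hpos
  tracial := htr
  add_I_smul a b _ _ := by rw [map_add, map_smul, smul_eq_mul]
  add_of_comm _ _ x _ y _ := map_add σ x y
  smul_of_comm _ _ x _ c := by rw [map_smul, smul_eq_mul]

variable {A : Type u} [NonUnitalCStarAlgebra A]

/-- The extension of a functional to matrices by summation along the diagonal. -/
def matrixExtend (σ : A →ₗ[ℂ] ℂ) (n : ℕ) : Matrix (Fin n) (Fin n) A →ₗ[ℂ] ℂ where
  toFun M := ∑ i, σ (M i i)
  map_add' M N := by simp [Finset.sum_add_distrib]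
  map_smul' c M := by simp [Finset.mul_sum]

theorem isQuasitrace_of_linearMap {σ : A →ₗ[ℂ] ℂ} (hpos : ∀ x, 0 ≤ σ (star x * x))
    (htr : ∀ x y, σ (x * y) = σ (y * x)) : IsQuasitrace σ := by
  refine ⟨isOneQuasitrace_of_linearMap hpos fun x => htr _ _, fun n =>
    ⟨matrixExtend σ (n + 1), isOneQuasitrace_of_linearMap (fun M => ?_) fun M => ?_, fun x => ?_⟩⟩
  · simp only [matrixExtend, LinearMap.coe_mk, AddHom.coe_mk, Matrix.mul_apply, Matrix.star_apply,
      map_sum]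
    exact Finset.sum_nonneg fun i _ => Finset.sum_nonneg fun k _ => hpos _
  · simp only [matrixExtend, LinearMap.coe_mk, AddHom.coe_mk, Matrix.mul_apply, Matrix.star_apply,
      map_sum]
    rw [Finset.sum_comm]
    exact Finset.sum_congr rfl fun i _ => Finset.sum_congr rfl fun k _ => htr _ _
  · simp only [matrixExtend, LinearMap.coe_mk, AddHom.coe_mk]
    rw [Finset.sum_eq_single 0 (fun i _ hi => by simp [hi.symm]) (by simp)]
    simp

variable [PartialOrder A] [StarOrderedRing A]

theorem mem_normalizedQuasitraces_of_mem_tracialStates {τ : WeakDual ℂ A}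
    (hτ : τ ∈ tracialStates A) : (τ : A → ℂ) ∈ normalizedQuasitraces A := by
  obtain ⟨hpos, htr, hn⟩ := hτ
  exact ⟨isQuasitrace_of_linearMap
      (σ := ((WeakDual.toStrongDual τ : A →L[ℂ] ℂ) : A →ₗ[ℂ] ℂ)) hpos htr,
    isLUB_of_norm_eq_one (σ := WeakDual.toStrongDual τ) hpos hn⟩

end TraceIsQuasitrace

/-! ### Additive quasitraces are tracial states -/

section Linearity

variable {A : Type u} [NonUnitalCStarAlgebra A] [PartialOrder A] [StarOrderedRing A] {τ : A → ℂ}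

theorem IsOneQuasitrace.exists_linearMap (hτ : IsOneQuasitrace τ)
    (hadd : ∀ x y, 0 ≤ x → 0 ≤ y → τ (x + y) = τ x + τ y) :
    ∃ σ : A →ₗ[ℂ] ℂ, ∀ x, σ x = τ x := by
  have hparts : ∀ x : A, IsSelfAdjoint x → τ x = τ x⁺ - τ x⁻ := by
    intro x hx
    have h1 : x = x⁺ + (-1 : ℂ) • x⁻ := by
      rw [neg_one_smul, ← sub_eq_add_neg, CFC.posPart_sub_negPart x hx]
    have hp := (CFC.posPart_nonneg x).isSelfAdjoint
    have hn := (CFC.negPart_nonneg x).isSelfAdjoint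
    have hc : Commute x⁺ ((-1 : ℂ) • x⁻) := by
      refine Commute.smul_right ?_ _
      rw [commute_iff_eq, CFC.posPart_mul_negPart, CFC.negPart_mul_posPart]
    conv_lhs => rw [h1]
    rw [hτ.map_add hp (by rw [neg_one_smul]; exact hn.neg) hc, hτ.map_smul hn]
    ring
  have hsub : ∀ p n : A, 0 ≤ p → 0 ≤ n → τ (p - n) = τ p - τ n := by
    intro p n hp hn
    have hx : IsSelfAdjoint (p - n) := hp.isSelfAdjoint.sub hn.isSelfAdjoint
    -- Comparing two decompositions of the same self-adjoint element uses additivity on positive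
    -- elements only.
    have h1 : p + (p - n)⁻ = n + (p - n)⁺ := by
      have := CFC.posPart_sub_negPart (p - n) hx
      rw [sub_eq_iff_eq_add] at this
      rw [this]; abel
    have h2 := congrArg τ h1
    rw [hadd _ _ hp (CFC.negPart_nonneg _), hadd _ _ hn (CFC.posPart_nonneg _)] at h2
    rw [hparts _ hx]
    linear_combination -h2
  have hsa : ∀ x y : A, IsSelfAdjoint x → IsSelfAdjoint y → τ (x + y) = τ x + τ y := by
    intro x y hx hy
    have h1 : x + y = (x⁺ + y⁺) - (x⁻ + y⁻) := by
      conv_lhs => rw [← CFC.posPart_sub_negPart x hx, ← CFC.posPart_sub_negPart y hy]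
      abel
    have hp := CFC.posPart_nonneg x
    have hq := CFC.posPart_nonneg y
    have hn := CFC.negPart_nonneg x
    have hm := CFC.negPart_nonneg y
    rw [h1, hsub _ _ (add_nonneg hp hq) (add_nonneg hn hm), hadd _ _ hp hq, hadd _ _ hn hm,
      hparts x hx, hparts y hy]
    ring
  have hdec : ∀ z : A, τ z = τ (realPart z : A) + Complex.I * τ (imaginaryPart z : A) := by
    intro z
    conv_lhs => rw [← realPart_add_I_smul_imaginaryPart z]
    exact hτ.add_I_smul _ _ (realPart z).2 (imaginaryPart z).2
  have hr : ∀ (r : ℝ) (x : A), IsSelfAdjoint x → τ (r • x) = r * τ x := fun r x hx => by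
    rw [← Complex.coe_smul, hτ.map_smul hx]
  refine ⟨{ toFun := τ, map_add' := fun z w => ?_, map_smul' := fun c z => ?_ }, fun _ => rfl⟩
  · rw [hdec (z + w), hdec z, hdec w, _root_.map_add, _root_.map_add,
      AddSubgroup.coe_add, AddSubgroup.coe_add, hsa _ _ (realPart z).2 (realPart w).2,
      hsa _ _ (imaginaryPart z).2 (imaginaryPart w).2]
    ring
  · have hz := (realPart z).2
    have hw := (imaginaryPart z).2
    have h1 : ((realPart (c • z) : selfAdjoint A) : A) =
        c.re • (realPart z : A) + (-c.im) • (imaginaryPart z : A) := by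
      rw [realPart_smul, neg_smul, ← sub_eq_add_neg]; rfl
    have h2 : ((imaginaryPart (c • z) : selfAdjoint A) : A) =
        c.re • (imaginaryPart z : A) + c.im • (realPart z : A) := by
      rw [imaginaryPart_smul]; rfl
    have hsm : ∀ (r : ℝ) {x : A}, x ∈ selfAdjoint A → IsSelfAdjoint (r • x) := fun r x hx =>
      IsSelfAdjoint.smul (.all r) hx
    rw [RingHom.id_apply, smul_eq_mul, hdec (c • z), hdec z, h1, h2, hsa _ _ (hsm _ hz) (hsm _ hw),
      hsa _ _ (hsm _ hw) (hsm _ hz), hr _ _ hz, hr _ _ hw, hr _ _ hz, hr _ _ hw]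
    conv_rhs => rw [← Complex.re_add_im c]
    push_cast
    linear_combination -(c.im : ℂ) * τ (imaginaryPart z : A) * Complex.I_sq

theorem exists_tracialState_of_add (hτ : τ ∈ normalizedQuasitraces A)
    (hadd : ∀ x y : A, 0 ≤ x → 0 ≤ y → (τ (x + y)).re = (τ x).re + (τ y).re) :
    ∃ σ ∈ tracialStates A, (σ : A → ℂ) = τ := by
  have ht := isPosQuasitrace_re hτ
  obtain ⟨⟨hone, -⟩, hlub⟩ := hτ
  have him : ∀ x : A, 0 ≤ x → (τ x).im = 0 := fun x hx =>
    (Complex.nonneg_iff.1 (hone.map_nonneg hx)).2.symm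
  obtain ⟨σ, hσ⟩ := hone.exists_linearMap fun x y hx hy =>
    Complex.ext (hadd x y hx hy) (by
      rw [Complex.add_im, him _ hx, him _ hy, him _ (add_nonneg hx hy), add_zero])
  have hposb : ∀ x : A, 0 ≤ x → ‖σ x‖ ≤ ‖x‖ := fun x hx => by
    have h1 : τ x = ((τ x).re : ℂ) := Complex.ext rfl (him x hx)
    rw [hσ, h1, Complex.norm_real, Real.norm_of_nonneg (ht.nonneg x hx)]
    exact ht.le_norm x hx
  have hsab : ∀ x : A, IsSelfAdjoint x → ‖σ x‖ ≤ 2 * ‖x‖ := fun x hx => by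
    have h1 : σ x = σ x⁺ - σ x⁻ := by rw [← map_sub, CFC.posPart_sub_negPart x hx]
    have h2 := hposb _ (CFC.posPart_nonneg x)
    have h3 := hposb _ (CFC.negPart_nonneg x)
    have h4 : ‖x⁺‖ ≤ ‖x‖ := CStarAlgebra.norm_posPart_le x
    have h5 : ‖x⁻‖ ≤ ‖x‖ := CStarAlgebra.norm_negPart_le x
    rw [h1]
    exact (norm_sub_le _ _).trans (by linarith)
  have hbound : ∀ z : A, ‖σ z‖ ≤ 4 * ‖z‖ := fun z => by
    have h1 : σ z = σ (realPart z : A) + Complex.I * σ (imaginaryPart z : A) := by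
      conv_lhs => rw [← realPart_add_I_smul_imaginaryPart z]
      rw [map_add, map_smul, smul_eq_mul]
    have h2 := hsab _ (realPart z).2
    have h3 := hsab _ (imaginaryPart z).2
    have h4 : ‖(realPart z : A)‖ ≤ ‖z‖ := realPart.norm_le z
    have h5 : ‖(imaginaryPart z : A)‖ ≤ ‖z‖ := imaginaryPart.norm_le z
    rw [h1]
    refine (norm_add_le _ _).trans ?_
    rw [norm_mul, Complex.norm_I, one_mul]
    linarith
  let ρ : A →L[ℂ] ℂ := σ.mkContinuous 4 hbound
  have hρ : ∀ x, ρ x = τ x := hσ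
  have hpos : ∀ x, 0 ≤ ρ (star x * x) := fun x => by rw [hρ]; exact hone.nonneg x
  refine ⟨StrongDual.toWeakDual ρ, ⟨hpos, ?_, ?_⟩, funext hρ⟩
  · exact map_mul_comm_of_star (σ := σ) fun x => by rw [hσ, hσ, hone.tracial]
  · show ‖ρ‖ = 1
    refine le_antisymm (norm_le_of_forall_star_mul_self_le hpos fun x hx => ?_) (hlub.2 ?_)
    · rw [hρ]
      exact hlub.1 ⟨x, hx, rfl⟩
    · rintro _ ⟨x, hx, rfl⟩
      rw [← hρ]
      refine (Complex.re_le_norm _).trans ((ρ.le_opNorm _).trans ?_)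
      exact mul_le_of_le_one_right (norm_nonneg _) hx

end Linearity

/-! ### Existence of tracial states and the lower bound at a -/

section TracialStates

variable {A : Type u} [NonUnitalCStarAlgebra A] [PartialOrder A] [StarOrderedRing A]

theorem apply_nonneg_of_map_nonneg {D : Type*} [NonUnitalCStarAlgebra D] {s : D → ℂ}
    (hs : ∀ x, 0 ≤ s (star x * x)) {π : D →⋆ₙₐ[ℂ] A} (hπ : Function.Injective π) {d : D}
    (hd : 0 ≤ π d) : 0 ≤ s d := by
  let _ : PartialOrder D := CStarAlgebra.spectralOrder D
  have : StarOrderedRing D := CStarAlgebra.spectralOrderedRing D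
  obtain ⟨u, rfl⟩ := CStarAlgebra.nonneg_iff_eq_star_mul_self.1 (nonneg_of_map_nonneg hπ hd)
  exact hs u

theorem re_apply_cutoff_le {D : Type*} [NonUnitalCStarAlgebra D] {s : D →L[ℂ] ℂ}
    (hs : ∀ x, 0 ≤ s (star x * x)) {π : D →⋆ₙₐ[ℂ] A} (hπ : Function.Injective π) {d : D}
    (hd : 0 ≤ π d) {ε : ℝ} (hε : 0 < ε) : (s (cfcₙ (cutoff ε) d)).re ≤ 2 / ε * (s d).re := by
  let _ : PartialOrder D := CStarAlgebra.spectralOrder D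
  have : StarOrderedRing D := CStarAlgebra.spectralOrderedRing D
  have hd0 : 0 ≤ d := nonneg_of_map_nonneg hπ hd
  have hle : cfcₙ (cutoff ε) d ≤ (2 / ε) • d := by
    have h1 : (2 / ε) • d = cfcₙ (fun r : ℝ => 2 / ε * r) d := by
      rw [cfcₙ_const_mul _ _ d (by fun_prop) rfl, cfcₙ_id' ℝ d]
    rw [h1]
    exact cfcₙ_mono (fun r hr => cutoff_le hε (quasispectrum_nonneg_of_nonneg d hd0 r hr))
      (continuous_cutoff hε).continuousOn (by fun_prop) (cutoff_zero hε) (mul_zero _)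
  obtain ⟨u, hu⟩ := CStarAlgebra.nonneg_iff_eq_star_mul_self.1 (sub_nonneg.2 hle)
  have h2 := (Complex.nonneg_iff.1 (hs u)).1
  rw [← hu, map_sub, ← Complex.coe_smul, map_smul, smul_eq_mul, Complex.sub_re,
    Complex.re_ofReal_mul] at h2
  linarith

variable {a : A} {f : ℝ}

/-- An approximation can be chosen for which τ restricted to D has norm at least 1/2. Normalized, it
is a tracial state of D, so the cutoff bound together with `cutoff (1 / 4) s ≤ 8 s` gives τ(ψ a) ≥
f/16; half of this is lost in passing to a. -/
theorem ApproxProperty.le_re_apply (h : ApproxProperty a f) (hf : 0 < f) (ha : IsStrictlyPos a)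
    (ha1 : ‖a‖ = 1) {τ : WeakDual ℂ A} (hτ : τ ∈ tracialStates A) : f / 32 ≤ (τ a).re := by
  classical
  have hQ := mem_normalizedQuasitraces_of_mem_tracialStates hτ
  have ht := isPosQuasitrace_re hQ
  -- This element forces the restriction of τ to D to have norm at least 3/4 - 1/4.
  obtain ⟨_, ⟨x, hx1, rfl⟩, hx, -⟩ := hQ.2.exists_between (show (3 / 4 : ℝ) < 1 by norm_num)
  obtain ⟨D, hDc, ψ, hψ, hD, hψn, hfs, hF⟩ := h.exists_abs_sub_le ha ha1 ht {star x * x, a}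
    (show 0 < min (1 / 4) (f / 32) by positivity)
  have h1 := (abs_le.1 ((hF (star x * x) (by simp) (star_mul_self_nonneg x)).trans
    (min_le_left _ _))).2
  have h2 := (abs_le.1 ((hF a (by simp) ha.1).trans (min_le_right _ _))).1
  let ι : D →L[ℂ] A := ⟨⟨⟨Subtype.val, fun _ _ => rfl⟩, fun _ _ => rfl⟩, continuous_subtype_val⟩
  let ρ : D →L[ℂ] ℂ := (WeakDual.toStrongDual τ : A →L[ℂ] ℂ).comp ι
  have hpos : ∀ d, 0 ≤ ρ (star d * d) := fun d => hτ.1 d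
  have htr : ∀ d e, ρ (d * e) = ρ (e * d) := fun d e => hτ.2.1 d e
  have hnorm : 1 / 2 ≤ ‖ρ‖ := by
    have h3 : (τ (ψ (star x * x))).re ≤ ‖ρ‖ * ‖ψ (star x * x)‖ :=
      (Complex.re_le_norm _).trans (ρ.le_opNorm ⟨_, hψ (star x * x)⟩)
    have h4 : ‖ψ (star x * x)‖ ≤ 1 := (hψn _).trans hx1
    have h5 := mul_le_of_le_one_right (norm_nonneg ρ) h4
    linarith
  have hn0 : 0 < ‖ρ‖ := by linarith
  have h3 := hfs _ (inv_norm_smul_mem_tracialStates hpos htr (norm_pos_iff.1 hn0))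
  have h4 : f ≤ ‖ρ‖⁻¹ * (ρ (cfcₙ (cutoff (1 / 4)) (⟨ψ a, hψ a⟩ : D))).re := by
    rw [← Complex.re_ofReal_mul]
    exact h3
  rw [le_inv_mul_iff₀ hn0] at h4
  have h5 := re_apply_cutoff_le hpos (π := NonUnitalStarSubalgebraClass.subtype D)
    Subtype.val_injective (d := ⟨ψ a, hψ a⟩) (map_nonneg ψ ha.1) (show (0 : ℝ) < 1 / 4 by norm_num)
  have h6 : ρ ⟨ψ a, hψ a⟩ = τ (ψ a) := rfl
  rw [h6] at h5
  nlinarith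

/-- Compose a tracial state of D with ψ. Both ψ(xy) and ψ(yx) are within ε/2 of the products in D,
on which the state is tracial. -/
theorem ApproxProperty.exists_almost_trace (h : ApproxProperty a f) (ha : 0 ≤ a) (ha0 : a ≠ 0)
    (F : Finset A) {ε : ℝ} (hε : 0 < ε) :
    ∃ σ : A →L[ℂ] ℂ, ‖σ‖ ≤ 1 ∧ (∀ x, 0 ≤ σ (star x * x)) ∧ f / 8 ≤ (σ a).re ∧
      ∀ x ∈ F, ∀ y ∈ F, ‖σ (x * y) - σ (y * x)‖ ≤ ε := by
  obtain ⟨D, hDc, φ, ψ, hψ, -, hψn, -, hmul, -, -, -, hD, -, hfs⟩ :=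
    h (ε / 2) (by positivity) F a ha ha0
  obtain ⟨s, hs⟩ := hD.tracialStates_nonempty
  obtain ⟨hpos, htr, hn⟩ := hs
  have hsn : ∀ d : D, ‖s d‖ ≤ ‖d‖ := fun d => by
    have := (WeakDual.toStrongDual s : D →L[ℂ] ℂ).le_opNorm d
    rwa [hn, one_mul] at this
  let σ : A →ₗ[ℂ] ℂ :=
    { toFun := fun x => s ⟨ψ x, hψ x⟩
      map_add' := fun x y => by
        rw [← map_add s]
        exact congrArg s (Subtype.ext (map_add ψ x y))
      map_smul' := fun c x => by
        rw [RingHom.id_apply, ← map_smul s]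
        exact congrArg s (Subtype.ext (map_smul ψ c x)) }
  have hσ : ∀ x, σ x = s ⟨ψ x, hψ x⟩ := fun _ => rfl
  have hb : ∀ x, ‖σ x‖ ≤ 1 * ‖x‖ := fun x => by
    rw [one_mul]
    exact (hsn _).trans (hψn x)
  have hπ : Function.Injective (NonUnitalStarSubalgebraClass.subtype D) := Subtype.val_injective
  refine ⟨σ.mkContinuous 1 hb, σ.mkContinuous_norm_le zero_le_one hb, fun x => ?_, ?_,
    fun x hx y hy => ?_⟩
  · exact apply_nonneg_of_map_nonneg hpos hπ (d := ⟨ψ (star x * x), hψ _⟩)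
      (map_nonneg ψ (star_mul_self_nonneg x))
  · have h1 := hfs s ⟨hpos, htr, hn⟩
    have h2 := re_apply_cutoff_le (s := (WeakDual.toStrongDual s : D →L[ℂ] ℂ)) hpos hπ
      (d := ⟨ψ a, hψ a⟩) (map_nonneg ψ ha) (show (0 : ℝ) < 1 / 4 by norm_num)
    have h3 := h1.trans h2
    show f / 8 ≤ (s ⟨ψ a, hψ a⟩).re
    change f ≤ 2 / (1 / 4) * (s ⟨ψ a, hψ a⟩).re at h3
    linarith
  · show ‖s ⟨ψ (x * y), hψ _⟩ - s ⟨ψ (y * x), hψ _⟩‖ ≤ ε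
    have key : ∀ x ∈ F, ∀ y ∈ F,
        ‖s ⟨ψ (x * y), hψ _⟩ - s (⟨ψ x, hψ x⟩ * ⟨ψ y, hψ y⟩)‖ ≤ ε / 2 := fun x hx y hy => by
      rw [← map_sub]
      exact (hsn _).trans (hmul x hx y hy).le
    have h1 := key x hx y hy
    have h2 := key y hy x hx
    rw [htr ⟨ψ y, hψ y⟩] at h2
    rw [norm_sub_rev] at h2
    refine (norm_sub_le_norm_sub_add_norm_sub _ _ _).trans (add_le_add h1 h2) |>.trans ?_
    linarith

/-- Weak* compactness of the unit ball and the finite intersection property. Norms may drop in the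
limit; the bound at a keeps it nonzero, so it can be normalized. -/
theorem ApproxProperty.tracialStates_nonempty (h : ApproxProperty a f) (hf : 0 < f) (ha : 0 ≤ a)
    (ha0 : a ≠ 0) : (tracialStates A).Nonempty := by
  classical
  let C : A × A × ℕ → Set (WeakDual ℂ A) := fun i =>
    {σ | ‖σ (i.1 * i.2.1) - σ (i.2.1 * i.1)‖ ≤ 1 / ((i.2.2 : ℝ) + 1)} ∩
      ({σ | ∀ x, 0 ≤ σ (star x * x)} ∩ {σ | f / 8 ≤ (σ a).re})
  have hev : ∀ x : A, Continuous fun σ : WeakDual ℂ A => σ x := fun x => WeakDual.eval_continuous x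
  have hclosed : ∀ i, IsClosed (C i) := fun i => by
    refine IsClosed.inter ?_ (IsClosed.inter ?_ ?_)
    · exact isClosed_le (((hev _).sub (hev _)).norm) continuous_const
    · rw [Set.ofPred_forall]
      exact isClosed_iInter fun x => isClosed_le continuous_const (hev _)
    · exact isClosed_le continuous_const (Complex.continuous_re.comp (hev a))
  obtain ⟨σ, -, hσ⟩ := (WeakDual.isCompact_closedBall (0 : StrongDual ℂ A) 1).inter_iInter_nonempty
    C hclosed fun u => by
      obtain ⟨N, hN⟩ : ∃ N : ℕ, ∀ i ∈ u, i.2.2 ≤ N :=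
        ⟨u.sup fun i => i.2.2, fun i hi => Finset.le_sup (f := fun i : A × A × ℕ => i.2.2) hi⟩
      obtain ⟨σ, hn, hpos, hfa, htr⟩ := h.exists_almost_trace ha ha0
        (u.image (fun i => i.1) ∪ u.image fun i => i.2.1) (show 0 < 1 / ((N : ℝ) + 1) by positivity)
      refine ⟨StrongDual.toWeakDual σ, ?_, Set.mem_iInter₂.2 fun i hi => ⟨?_, hpos, hfa⟩⟩
      · show σ ∈ Metric.closedBall 0 1
        simpa using hn
      · refine (htr _ (Finset.mem_union_left _ (Finset.mem_image_of_mem _ hi)) _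
          (Finset.mem_union_right _ (Finset.mem_image_of_mem _ hi))).trans ?_
        have : (i.2.2 : ℝ) ≤ N := by exact_mod_cast hN i hi
        exact one_div_le_one_div_of_le (by positivity) (by linarith)
  rw [Set.mem_iInter] at hσ
  have hpos : ∀ x, 0 ≤ σ (star x * x) := (hσ (0, 0, 0)).2.1
  have hfa : f / 8 ≤ (σ a).re := (hσ (0, 0, 0)).2.2
  have htr : ∀ x y, σ (x * y) = σ (y * x) := fun x y => by
    rw [← sub_eq_zero, ← norm_le_zero_iff]
    exact ge_of_tendsto' tendsto_one_div_add_atTop_nhds_zero_nat fun n => (hσ (x, y, n)).1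
  refine ⟨_, inv_norm_smul_mem_tracialStates (τ := WeakDual.toStrongDual σ) hpos htr fun h0 => ?_⟩
  have h1 : σ a = 0 := congrArg (fun g : StrongDual ℂ A => g a) h0
  rw [h1, Complex.zero_re] at hfa
  linarith

end TracialStates

end CStarD

end

theorem mainTheorem4 {A : Type*} [NonUnitalCStarAlgebra A] [PartialOrder A] [StarOrderedRing A]
    [Nontrivial A] [TopologicalSpace.SeparableSpace A]
    (hA : CStarD.InClassD A) :
    CStarD.normalizedQuasitraces A =
        (fun τ : WeakDual ℂ A => (τ : A → ℂ)) '' CStarD.tracialStates A ∧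
      (CStarD.tracialStates A).Nonempty ∧
      (0 : WeakDual ℂ A) ∉ closure (CStarD.tracialStates A) := by
  obtain ⟨-, a, ha, ha1, f, hf, -, h⟩ := hA
  have happ : CStarD.ApproxProperty a f := h
  refine ⟨Set.Subset.antisymm (fun τ hτ => ?_) ?_,
    happ.tracialStates_nonempty hf ha.1 fun h0 => by simp [h0] at ha1, fun h0 => ?_⟩
  · exact CStarD.exists_tracialState_of_add hτ fun x y hx hy =>
      happ.add ha ha1 (CStarD.isPosQuasitrace_re hτ) hx hy
  · rintro _ ⟨τ, hτ, rfl⟩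
    exact CStarD.mem_normalizedQuasitraces_of_mem_tracialStates hτ
  -- A weak* closed half-space that contains all tracial states and misses 0.
  · have hclosed : IsClosed {σ : WeakDual ℂ A | f / 32 ≤ (σ a).re} :=
      isClosed_le continuous_const (Complex.continuous_re.comp (WeakDual.eval_continuous a))
    have h1 : f / 32 ≤ ((0 : WeakDual ℂ A) a).re :=
      closure_minimal (fun τ hτ => happ.le_re_apply hf ha ha1 hτ) hclosed h0
    have h2 : (0 : WeakDual ℂ A) a = 0 := rfl
    rw [h2, Complex.zero_re] at h1
    linarith
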